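/- Let $f=f(w,v)\in C^3(\mathbb R^2;\mathbb R)$ with $D^2_{ww}f$, $D^2_{wv}f$, $D^3_{wwv}f$ bounded, and write $\|\cdot\|$ for the sup norm on $\mathbb R^2$. Consider the system $w_t+\partial_w f(w,v)\,w_x=0$, $v_t-v_x=0$ with initial data $(w_0,v_0)$ of bounded variation. Let $\varepsilon>0$ and let $w_\varepsilon(0,\cdot),v_\varepsilon(0,\cdot)$ be right continuous, compactly supported functions with values in $\mathbb Z\varepsilon$ such that $\mathrm{TV}(w_\varepsilon(0,\cdot))\le \mathrm{TV}(w_0)$ and $\mathrm{TV}(v_\varepsilon(0,\cdot))\le \mathrm{TV}(v_0)$; assume $\partial_w f>-1$ at all points $(\omega,v)$ with $\omega$ between two values of $w_\varepsilon(0,\cdot)$ and $v$ a value of $v_\varepsilon(0,\cdot)$. *Wavefront solution.* Let $f_\varepsilon(\cdot,v)$ be the piecewise affine interpolation of $f(\cdot,v)$ with nodes $\mathbb Z\varepsilon$. The Riemann problem with left state $(w^-,v^-)$ and right state $(w^+,v^+)$ is solved by the jump of $v$ travelling with speed $-1$ and by the right continuous, piecewise constant entropy solution $w$ of the scalar Riemann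 problem $(w^-,w^+)$ with flux $f_\varepsilon(\cdot,v^+)$: an elementary jump across a grid cell travels with the slope on that cell of the convex envelope of $f_\varepsilon(\cdot,v^+)$ in $[w^-,w^+]$ if $w^-<w^+$, of the concave envelope in $[w^+,w^-]$ if $w^->w^+$. The $\varepsilon$-wavefront solution $(w_\varepsilon,v_\varepsilon)$ is obtained by solving all Riemann problems at $t_0=0$, letting the wavefronts (the jumps of $v_\varepsilon$, and the jumps of $w_\varepsilon$) travel until two of them meet at a time $t_1$, solving the new Riemann problems, and so on. Let $t_1<t_2<\dots<t_J$ be its (first $J$) collision times; assume that at each $t_j$, $1\le j\le J$, exactly two wavefronts meet, at a point $x_j$. *Waves.* Let $\mathcal W=\{1,\dots,\frac1\varepsilon\mathrm{TV}(w_\varepsilon(0,\cdot))\}$ and $W(x)=\mathrm{TV}(w_\varepsilon(0,\cdot);(-\infty,x])$. For $s\in\mathcal W$ put $\mathtt x(0,s)=\inf\{x: \varepsilon s\le W(x)\}=:x^s$, $\mathcal S(s)=\mathrm{sign}[w_\varepsilon(0,x^s)-w_\varepsilon(0,x^s-)]$ and $\hat w(s)=w_\varepsilon(0,x^s-)+\mathcal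 S(s)[\varepsilon s-W(x^s-)]$. If $\mathtt x(t_j,s)<+\infty$, the speed $\sigma(t_j,s)$ of $s$ is the speed that the Riemann problem at $(t_j,\mathtt x(t_j,s))$ gives to the elementary jump $(\hat w(s)-\varepsilon,\hat w(s))$ if $\mathcal S(s)=1$, $(\hat w(s),\hat w(s)+\varepsilon)$ if $\mathcal S(s)=-1$; and $\mathtt x(t_{j+1},s)=p:=\mathtt x(t_j,s)+\sigma(t_j,s)(t_{j+1}-t_j)$, unless $p=x_{j+1}$ and the inequalities $\mathcal S(s)w_\varepsilon(t_{j+1},p-)\le \mathcal S(s)\hat w(s)-\varepsilon$ and $\mathcal S(s)\hat w(s)\le\mathcal S(s)w_\varepsilon(t_{j+1},p)$ do not both hold, in which case the wave is cancelled and $\mathtt x(t_i,s)=+\infty$ for all $i\ge j+1$. Let $\mathcal W(t_j)=\{s\in\mathcal W:\mathtt x(t_j,s)<+\infty\}$ and $|s|=\varepsilon$. Then $$\sum_{j=1}^{J}\sum_{s\in\mathcal W(t_j)}|\sigma(t_j,s)-\sigma(t_{j-1},s)|\,|s|\le\Big[3\|D^2_{ww}f\|+12\log(2)\,\|D^3_{wwv}f\|\,\mathrm{TV}(v_0)\Big]\mathrm{TV}(w_0)^2+\|D^2_{wv}f\|\,\mathrm{TV}(w_0)\,\mathrm{TV}(v_0).$$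 -/

import Mathlib

open Set

noncomputable section

namespace TriangularSystem

/-! ### Total variation, derivatives of the flux, sup norm -/

/-- Total variation of a function on the whole line. -/
def totVar (u : ℝ → ℝ) : ℝ := (eVariationOn u univ).toReal

/-- `∂f/∂w`, where `f w v` is the flux. -/
def dW (f : ℝ → ℝ → ℝ) (w v : ℝ) : ℝ := deriv (fun z => f z v) w

/-- `∂²f/∂w²`. -/
def dWW (f : ℝ → ℝ → ℝ) (w v : ℝ) : ℝ := deriv (fun z => dW f z v) w

/-- `∂²f/∂w∂v`. -/
def dWV (f : ℝ → ℝ → ℝ) (w v : ℝ) : ℝ := deriv (fun z => dW f w z) v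

/-- `∂³f/∂w²∂v`. -/
def dWWV (f : ℝ → ℝ → ℝ) (w v : ℝ) : ℝ := deriv (fun z => dWW f w z) v

/-- The function `h` is bounded on the plane. -/
def IsBdd (h : ℝ → ℝ → ℝ) : Prop := BddAbove (range fun p : ℝ × ℝ => |h p.1 p.2|)

/-- The sup norm on the plane. -/
def supNorm (h : ℝ → ℝ → ℝ) : ℝ := ⨆ p : ℝ × ℝ, |h p.1 p.2|

/-! ### Interpolation, envelopes, Riemann solver -/

/-- Piecewise affine interpolation of `g` with grid size `ε`. -/
def interp (ε : ℝ) (g : ℝ → ℝ) (u : ℝ) : ℝ :=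
  g (⌊u / ε⌋ * ε) + (g ((⌊u / ε⌋ + 1) * ε) - g (⌊u / ε⌋ * ε)) * (u / ε - ⌊u / ε⌋)

/-- Convex envelope of `g` in `[a, b]`. -/
def convEnv (a b : ℝ) (g : ℝ → ℝ) (u : ℝ) : ℝ :=
  sSup {y | ∃ φ : ℝ → ℝ, ConvexOn ℝ (Icc a b) φ ∧ (∀ z ∈ Icc a b, φ z ≤ g z) ∧ y = φ u}

/-- Concave envelope of `g` in `[a, b]`. -/
def concEnv (a b : ℝ) (g : ℝ → ℝ) (u : ℝ) : ℝ :=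
  sInf {y | ∃ φ : ℝ → ℝ, ConcaveOn ℝ (Icc a b) φ ∧ (∀ z ∈ Icc a b, g z ≤ φ z) ∧ y = φ u}

/-- Speed given to the elementary jump across `(c, c + ε)` by the scalar Riemann problem with left
state `wl`, right state `wr` and flux `g_ε`: the derivative on `(c, c + ε)` of the convex envelope
(if `wl < wr`) or of the concave envelope (if `wr < wl`) of `g_ε`. For grid values `wl`, `wr`, `c`
the envelope is affine on `[c, c + ε]`, so this derivative is the difference quotient. -/
def cellSpeed (ε : ℝ) (g : ℝ → ℝ) (wl wr c : ℝ) : ℝ :=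
  if wl < wr then
    (convEnv wl wr (interp ε g) (c + ε) - convEnv wl wr (interp ε g) c) / ε
  else
    (concEnv wr wl (interp ε g) (c + ε) - concEnv wr wl (interp ε g) c) / ε

/-- The piecewise constant, right continuous, self-similar solution of the scalar Riemann problem
`(wl, wr)` with flux `g_ε`, evaluated at `x / t = ξ`: starting from `wl`, all the elementary jumps
with speed at most `ξ` have been crossed. -/
def riemann (ε : ℝ) (g : ℝ → ℝ) (wl wr ξ : ℝ) : ℝ :=
  if wl < wr then
    sSup (insert wl {ω | (∃ k : ℤ, ω = k * ε) ∧ wl < ω ∧ ω ≤ wr ∧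
      cellSpeed ε g wl wr (ω - ε) ≤ ξ})
  else
    sInf (insert wl {ω | (∃ k : ℤ, ω = k * ε) ∧ wr ≤ ω ∧ ω < wl ∧
      cellSpeed ε g wl wr ω ≤ ξ})

/-! ### Wavefront tracking -/

/-- Discretized initial data: compactly supported, right continuous, with values in `ℤ ε`.
(Together with finite total variation this makes them piecewise constant with finitely many
jumps.) -/
structure IsGridDatum (ε : ℝ) (u : ℝ → ℝ) : Prop where
  compactSupport : HasCompactSupport u
  rightCont : ∀ x, ContinuousWithinAt u (Ici x) x
  grid : ∀ x, ∃ k : ℤ, u x = k * ε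

/-- The fan which solves the Riemann problem at the point `y` when the profiles of `w` and `v` are
`u` and `v`: left and right states `u (y-)`, `u y`, flux `f_ε(·, v y)`. -/
def fan (f : ℝ → ℝ → ℝ) (ε : ℝ) (u v : ℝ → ℝ) (y ξ : ℝ) : ℝ :=
  riemann ε (fun z => f z (v y)) (Function.leftLim u y) (u y) ξ

/-- The profile of `w` after a time `τ > 0`, when all the Riemann problems of the
profiles `(u, v)` (`u` compactly supported) are solved and the resulting wavefronts travel freely:
the superposition of the fans, each minus its left state. It is used up to and including the first
time at which two wavefronts meet. -/
def propagate (f : ℝ → ℝ → ℝ) (ε : ℝ) (u v : ℝ → ℝ) (τ x : ℝ) : ℝ :=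
  ∑ᶠ y : ℝ, (fan f ε u v y ((x - y) / τ) - Function.leftLim u y)

/-- The two families: jumps of `v` (first) and jumps of `w` (second). -/
inductive Family
  | first
  | second

/-- A wavefront leaving the point `origin` with the given speed. -/
structure Front where
  family : Family
  origin : ℝ
  speed : ℝ

/-- Position of a wavefront after a time `τ`. -/
def Front.pos (a : Front) (τ : ℝ) : ℝ := a.origin + a.speed * τ

/-- The wavefronts generated by the profiles `(u, v)`: one of the first family, with speed `-1`,
at each jump of `v`, and one of the second family for each jump of a fan. -/
def fronts (f : ℝ → ℝ → ℝ) (ε : ℝ) (u v : ℝ → ℝ) : Set Front :=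
  {a | match a.family with
    | .first => Function.leftLim v a.origin ≠ v a.origin ∧ a.speed = -1
    | .second => Function.leftLim (fan f ε u v a.origin) a.speed ≠ fan f ε u v a.origin a.speed}

/-- The two distinct wavefronts `a`, `b` generated by `(u, v)` are at the same point after `τ`. -/
def Meet (f : ℝ → ℝ → ℝ) (ε : ℝ) (u v : ℝ → ℝ) (τ : ℝ) (a b : Front) : Prop :=
  a ∈ fronts f ε u v ∧ b ∈ fronts f ε u v ∧ a ≠ b ∧ a.pos τ = b.pos τ

/-- The delays after which two wavefronts generated by `(u, v)` meet. -/
def meetingTimes (f : ℝ → ℝ → ℝ) (ε : ℝ) (u v : ℝ → ℝ) : Set ℝ :=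
  {τ | 0 < τ ∧ ∃ a b, Meet f ε u v τ a b}

/-- The delay of the first collision. -/
def delay (f : ℝ → ℝ → ℝ) (ε : ℝ) (u v : ℝ → ℝ) : ℝ := sInf (meetingTimes f ε u v)

/-- Value of `v` at time `t`: the solution of `v_t - v_x = 0`, `v(0) = v0`. -/
def transport (v0 : ℝ → ℝ) (t x : ℝ) : ℝ := v0 (x + t)

/-- The pair `(t_j, w(t_j, ·))` in the wavefront solution with data `(w0, v0)`, where `t_0 = 0` and
`t_j` is the time of the `j`-th collision. (Meaningful as long as there are at least `j`
collisions.) -/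
def collisionState (f : ℝ → ℝ → ℝ) (ε : ℝ) (w0 v0 : ℝ → ℝ) : ℕ → ℝ × (ℝ → ℝ)
  | 0 => (0, w0)
  | j + 1 =>
    let st := collisionState f ε w0 v0 j
    let Δ := delay f ε st.2 (transport v0 st.1)
    (st.1 + Δ, propagate f ε st.2 (transport v0 st.1) Δ)

/-- The time `t_j`. -/
def tj (f : ℝ → ℝ → ℝ) (ε : ℝ) (w0 v0 : ℝ → ℝ) (j : ℕ) : ℝ := (collisionState f ε w0 v0 j).1

/-- The profile `w(t_j, ·)`. -/
def wj (f : ℝ → ℝ → ℝ) (ε : ℝ) (w0 v0 : ℝ → ℝ) (j : ℕ) : ℝ → ℝ := (collisionState f ε w0 v0 j).2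

/-- The profile `v(t_j, ·)`. -/
def vj (f : ℝ → ℝ → ℝ) (ε : ℝ) (w0 v0 : ℝ → ℝ) (j : ℕ) : ℝ → ℝ :=
  transport v0 (tj f ε w0 v0 j)

/-- The points where two wavefronts meet at time `t_{j+1}`. -/
def collisionPoints (f : ℝ → ℝ → ℝ) (ε : ℝ) (w0 v0 : ℝ → ℝ) (j : ℕ) : Set ℝ :=
  {p | ∃ a b, Meet f ε (wj f ε w0 v0 j) (vj f ε w0 v0 j)
    (delay f ε (wj f ε w0 v0 j) (vj f ε w0 v0 j)) a b ∧
    p = a.pos (delay f ε (wj f ε w0 v0 j) (vj f ε w0 v0 j))}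

/-- After time `t_j` there is a further collision, and at the time `t_{j+1}` of the first one
exactly two wavefronts meet. -/
def BinaryCollision (f : ℝ → ℝ → ℝ) (ε : ℝ) (w0 v0 : ℝ → ℝ) (j : ℕ) : Prop :=
  (meetingTimes f ε (wj f ε w0 v0 j) (vj f ε w0 v0 j)).Nonempty ∧
  ∃ a b : Front, ∀ c d : Front,
    Meet f ε (wj f ε w0 v0 j) (vj f ε w0 v0 j)
      (delay f ε (wj f ε w0 v0 j) (vj f ε w0 v0 j)) c d →
    (c = a ∧ d = b) ∨ (c = b ∧ d = a)

/-! ### Waves: initial enumeration, position, speed -/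

/-- The total variation function `W(x) = TV(w0; (-∞, x])`. -/
def varFun (w0 : ℝ → ℝ) (x : ℝ) : ℝ := (eVariationOn w0 (Iic x)).toReal

/-- The set of waves `{1, …, TV(w0) / ε}`. -/
def waves (ε : ℝ) (w0 : ℝ → ℝ) : Finset ℕ := Finset.Icc 1 ⌊totVar w0 / ε⌋₊

/-- Initial position of the wave `s`. -/
def initPos (ε : ℝ) (w0 : ℝ → ℝ) (s : ℕ) : ℝ := sInf {x | ε * s ≤ varFun w0 x}

/-- Sign of the wave `s`. -/
def waveSign (ε : ℝ) (w0 : ℝ → ℝ) (s : ℕ) : ℝ :=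
  Real.sign (w0 (initPos ε w0 s) - Function.leftLim w0 (initPos ε w0 s))

/-- Right state of the wave `s`. -/
def rightState (ε : ℝ) (w0 : ℝ → ℝ) (s : ℕ) : ℝ :=
  Function.leftLim w0 (initPos ε w0 s) +
    waveSign ε w0 s * (ε * s - Function.leftLim (varFun w0) (initPos ε w0 s))

/-- Speed of the wave `s` at time `t_j` if its position is `x`: the speed which the Riemann problem
at `(t_j, x)` gives to the elementary jump `(ŵ(s) - ε, ŵ(s))` if `s` is positive, `(ŵ(s), ŵ(s) + ε)`
if `s` is negative. -/
def speedAt (f : ℝ → ℝ → ℝ) (ε : ℝ) (w0 v0 : ℝ → ℝ) (j s : ℕ) (x : ℝ) : ℝ :=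
  cellSpeed ε (fun z => f z (vj f ε w0 v0 j x))
    (Function.leftLim (wj f ε w0 v0 j) x) (wj f ε w0 v0 j x)
    (if 0 < waveSign ε w0 s then rightState ε w0 s - ε else rightState ε w0 s)

/-- The wave `s` lies in the jump of `w(t_j, ·)` at `x`. -/
def Survives (f : ℝ → ℝ → ℝ) (ε : ℝ) (w0 v0 : ℝ → ℝ) (j s : ℕ) (x : ℝ) : Prop :=
  waveSign ε w0 s * Function.leftLim (wj f ε w0 v0 j) x
      ≤ waveSign ε w0 s * rightState ε w0 s - ε ∧
    waveSign ε w0 s * rightState ε w0 s ≤ waveSign ε w0 s * wj f ε w0 v0 j x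

open Classical in
/-- Position of the wave `s` at time `t_j`; it is `⊤` from the moment the wave is cancelled. -/
def position (f : ℝ → ℝ → ℝ) (ε : ℝ) (w0 v0 : ℝ → ℝ) : ℕ → ℕ → WithTop ℝ
  | 0, s => ((initPos ε w0 s : ℝ) : WithTop ℝ)
  | j + 1, s =>
    match position f ε w0 v0 j s with
    | ⊤ => ⊤
    | (x : ℝ) =>
      let p : ℝ := x + speedAt f ε w0 v0 j s x * delay f ε (wj f ε w0 v0 j) (vj f ε w0 v0 j)
      if p ∈ collisionPoints f ε w0 v0 j ∧ ¬ Survives f ε w0 v0 (j + 1) s p then ⊤ else (p : ℝ)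

open Classical in
/-- The set `𝒲(t_j)` of the waves which are not yet cancelled at time `t_j`. -/
def realWaves (f : ℝ → ℝ → ℝ) (ε : ℝ) (w0 v0 : ℝ → ℝ) (j : ℕ) : Finset ℕ :=
  (waves ε w0).filter fun s => position f ε w0 v0 j s ≠ ⊤

/-- The speed `σ(t_j, s)` of the wave `s ∈ 𝒲(t_j)` (only used for such waves). -/
def sigma (f : ℝ → ℝ → ℝ) (ε : ℝ) (w0 v0 : ℝ → ℝ) (j s : ℕ) : ℝ :=
  speedAt f ε w0 v0 j s ((position f ε w0 v0 j s).untopD 0)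

end TriangularSystem

end

open Set

noncomputable section

namespace TriangularSystem

/-! ### Discrete envelopes -/

/-! Cut the datum of `w` into elementary waves of size ε and follow each of them. Write D₂, D₃ for
the sup norms of f_ww and f_wwv. The speed of a wave changes for three reasons.

Crossing a jump of `v` changes only the parameter of the flux. Speeds are slopes of envelopes, so
they move by at most ‖f_wv‖ times the jump. Since all speeds exceed -1, X + t increases along a
wave, and the total variation of `v` bounds what the wave can see. This gives the last term of the
estimate.

When fronts of opposite sign meet, the survivors form an initial or final segment of one front.
Their total change of speed is paid by the cancelled waves, D₂ TV(w) for each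
(`sum_abs_sub_le_of_cancelAt`), and a wave is cancelled only once. This is one of the three copies
of D₂ TV(w)².

When fronts of equal sign merge, with l and r waves and speeds cL > cR, all take the weighted mean
speed, and the total change is 2lr(cL - cR)/(l + r) (`sum_abs_sub_le_of_merge`). To sum this over
time, give each wave the weight W = D₂ + D₃ V, where V is the variation of `v` seen so far, and let
Ω(s, s') be the weight at the last time when s and s' were together, or 0 if there is none. Then Ω
is nondecreasing in time, bounded by D₂ + D₃ TV(v), and larger for nested inner pairs (`Ω_nest`).
The central claim (`almostConvexAt`) is that, for neighbouring waves m, m' in different fronts, the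
average slope on the left exceeds the one on the right by at most ε Σ (W - Ω(q, m')) over the left
waves plus ε Σ (W - Ω(m, q)) over the right ones. By nesting, the cost of a merger is then at most
2ε times the growth of Σ Ω over pairs of waves, which telescopes.

The claim holds because two neighbours which split are separated by a kink of a convex envelope, so
there the averages are ordered. Afterwards the flux changes only through its parameter, at a rate D₃
|dv| per unit of `w`, and the growth of W absorbs this. Waves which have never met are compared by
the Lipschitz bound D₂ ≤ W. The induction alternates `farConvex_succ` with
`frontConvex_of_farConvex`.

All this is carried out for the abstract `WaveHistory`. It remains to show that the wavefront
solution provides one: envelopes of interpolated fluxes are discrete envelopes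
(`PiecewiseAffine.isSeqEnvelope`), the profile is at all collision times a sum of waves
(`WaveState`), and a binary collision has one of the three types above (`BinaryStep.outcome`). The
constant obtained is 2 in place of 12 log 2. -/

/-- The slopes `σ` on the cells `B` are those of the convex envelope of the piecewise affine
function with slopes `ℓ`: they are nondecreasing, the primitive of `σ` lies below the one of `ℓ`,
and the primitives agree at the end points and wherever `σ` jumps. -/
structure IsEnvelope (B : Finset ℕ) (σ ℓ : ℕ → ℝ) : Prop where
  mono : ∀ q ∈ B, ∀ q' ∈ B, q ≤ q' → σ q ≤ σ q'
  le : ∀ k, ∑ q ∈ B with q < k, σ q ≤ ∑ q ∈ B with q < k, ℓ q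
  touch : ∀ k, (∀ q ∈ B, ∀ q' ∈ B, q < k → k ≤ q' → σ q < σ q') →
    ∑ q ∈ B with q < k, σ q = ∑ q ∈ B with q < k, ℓ q

/-- The convex envelope of the piecewise affine function with slopes `ℓ` on the cells `F` is affine
with slope `c`. -/
structure IsFlat (F : Finset ℕ) (ℓ : ℕ → ℝ) (c : ℝ) : Prop where
  le : ∀ k, c * (F.filter (· < k)).card ≤ ∑ q ∈ F with q < k, ℓ q
  total : ∑ q ∈ F, ℓ q = c * F.card

lemma sum_filter_lt_add_ge (B : Finset ℕ) (g : ℕ → ℝ) (k : ℕ) :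
    ∑ q ∈ B with q < k, g q + ∑ q ∈ B with k ≤ q, g q = ∑ q ∈ B, g q := by
  simpa [not_lt] using Finset.sum_filter_add_sum_filter_not B (· < k) g

lemma card_filter_lt_add_ge (B : Finset ℕ) (k : ℕ) :
    ((B.filter (· < k)).card : ℝ) + (B.filter (k ≤ ·)).card = B.card := by
  simpa using sum_filter_lt_add_ge B (fun _ => 1) k

lemma IsFlat.ge {F : Finset ℕ} {ℓ : ℕ → ℝ} {c : ℝ} (h : IsFlat F ℓ c) (k : ℕ) :
    ∑ q ∈ F with k ≤ q, ℓ q ≤ c * (F.filter (k ≤ ·)).card := by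
  have h1 := sum_filter_lt_add_ge F ℓ k
  have h2 := card_filter_lt_add_ge F k
  have h3 := h.le k
  have h4 := h.total
  rw [← h2] at h4
  linarith

namespace IsEnvelope

variable {B : Finset ℕ} {σ ℓ : ℕ → ℝ}

/-- A lower set of `B` is an initial segment. -/
lemma exists_lt_iff (B : Finset ℕ) (p : ℕ → Prop)
    (hp : ∀ q ∈ B, ∀ q' ∈ B, q ≤ q' → p q' → p q) : ∃ k, ∀ q ∈ B, p q ↔ q < k := by
  classical
  by_cases hB : ∃ q ∈ B, ¬ p q
  · obtain ⟨k, ⟨hk, hpk⟩, hmin⟩ : ∃ k, (k ∈ B ∧ ¬ p k) ∧ ∀ m < k, ¬ (m ∈ B ∧ ¬ p m) :=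
      ⟨Nat.find hB, Nat.find_spec hB, fun m hm => Nat.find_min hB hm⟩
    refine ⟨k, fun q hq => ⟨fun h => ?_, fun h => ?_⟩⟩
    · by_contra hle
      exact hpk (hp k hk q hq (not_lt.1 hle) h)
    · by_contra hpq
      exact hmin q h ⟨hq, hpq⟩
  · push Not at hB
    refine ⟨B.sup id + 1, fun q hq => ⟨fun _ => ?_, fun _ => hB q hq⟩⟩
    exact Nat.lt_succ_of_le (Finset.le_sup (f := id) hq)

/-- By monotonicity of `σ` such a set is an initial segment of `B`, and it ends where `σ` jumps,
that is, where the two primitives touch. -/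
lemma sum_eq_of_lower (h : IsEnvelope B σ ℓ) (p : ℕ → Prop) [DecidablePred p]
    (hp : ∀ q ∈ B, ∀ q' ∈ B, p q → ¬ p q' → σ q < σ q') :
    ∑ q ∈ B with p q, σ q = ∑ q ∈ B with p q, ℓ q := by
  obtain ⟨k, hk⟩ := exists_lt_iff B p (fun q hq q' hq' hle hpq' => by
    by_contra hpq
    exact absurd (hp q' hq' q hq hpq' hpq) (not_lt.2 (h.mono q hq q' hq' hle)))
  have hf : B.filter p = B.filter (· < k) := Finset.filter_congr hk
  rw [hf]
  refine h.touch k fun q hq q' hq' h1 h2 => hp q hq q' hq' ((hk q hq).2 h1) fun h3 => ?_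
  exact absurd ((hk q' hq').1 h3) (not_lt.2 h2)

lemma sum_eq (h : IsEnvelope B σ ℓ) : ∑ q ∈ B, σ q = ∑ q ∈ B, ℓ q := by
  simpa using h.sum_eq_of_lower (fun _ => True) (by simp)

/-- The part of an envelope where the slope has a given value. -/
lemma isFlat (h : IsEnvelope B σ ℓ) (c : ℝ) : IsFlat (B.filter (σ · = c)) ℓ c := by
  classical
  have hlt := h.sum_eq_of_lower (fun q => σ q < c) (fun q _ q' _ h1 h2 => by
    linarith [not_lt.1 h2])
  have hle := h.sum_eq_of_lower (fun q => σ q ≤ c) (fun q _ q' _ h1 h2 => by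
    linarith [not_le.1 h2])
  have hsplit : ∀ g : ℕ → ℝ, ∑ q ∈ B with σ q ≤ c, g q =
      ∑ q ∈ B with σ q < c, g q + ∑ q ∈ B with σ q = c, g q := by
    intro g
    rw [← Finset.sum_union]
    · congr 1
      ext q
      simp only [Finset.mem_filter, Finset.mem_union, le_iff_lt_or_eq]
      tauto
    · rw [Finset.disjoint_filter]
      intro q _ h1 h2
      exact absurd h2 h1.ne
  have hc : ∀ s : Finset ℕ, s ⊆ B.filter (σ · = c) → ∑ q ∈ s, σ q = c * s.card := by
    intro s hs
    rw [Finset.sum_congr rfl (fun q hq => (Finset.mem_filter.1 (hs hq)).2)]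
    simp [mul_comm]
  have htot : ∑ q ∈ B with σ q = c, ℓ q = c * (B.filter (σ · = c)).card := by
    rw [← hc _ (Finset.Subset.refl _)]
    have h1 := hsplit σ
    have h2 := hsplit ℓ
    linarith
  refine ⟨fun k => ?_, htot⟩
  rw [← hc _ (Finset.filter_subset _ _)]
  -- The cells with slope `c` are consecutive. The cut `k` lies before them, behind them, or inside;
  -- inside, the primitives agree at the start of the block and are ordered at `k`.
  by_cases hk : ∃ q ∈ B, σ q < c ∧ k ≤ q
  · obtain ⟨q₀, hq₀, hlt₀, hkq⟩ := hk
    have : (B.filter (σ · = c)).filter (· < k) = ∅ := by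
      apply Finset.filter_eq_empty_iff.2
      intro q hq h1
      obtain ⟨hqB, hqc⟩ := Finset.mem_filter.1 hq
      have := h.mono q hqB q₀ hq₀ (by omega)
      linarith
    rw [this]; simp
  · push Not at hk
    by_cases hk2 : ∃ q ∈ B, c < σ q ∧ q < k
    · obtain ⟨q₀, hq₀, hlt₀, hkq⟩ := hk2
      have : (B.filter (σ · = c)).filter (· < k) = B.filter (σ · = c) := by
        apply Finset.filter_eq_self.2
        intro q hq
        obtain ⟨hqB, hqc⟩ := Finset.mem_filter.1 hq
        by_contra hcon
        have := h.mono q₀ hq₀ q hqB (by omega)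
        linarith
      rw [this, hc _ (Finset.Subset.refl _), htot]
    · push Not at hk2
      have hs : ∀ g : ℕ → ℝ, ∑ q ∈ B with q < k, g q =
          ∑ q ∈ B with σ q < c, g q + ∑ q ∈ B.filter (σ · = c) with q < k, g q := by
        intro g
        rw [← Finset.sum_union]
        · congr 1
          ext q
          simp only [Finset.mem_filter, Finset.mem_union]
          constructor
          · rintro ⟨h1, h2⟩
            rcases lt_trichotomy (σ q) c with h3 | h3 | h3
            · exact Or.inl ⟨h1, h3⟩
            · exact Or.inr ⟨⟨h1, h3⟩, h2⟩
            · exact absurd h2 (not_lt.2 (hk2 q h1 h3))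
          · rintro (⟨h1, h2⟩ | ⟨⟨h1, h2⟩, h3⟩)
            · exact ⟨h1, hk q h1 h2⟩
            · exact ⟨h1, h3⟩
        · rw [Finset.filter_filter, Finset.disjoint_filter]
          intro q _ h1 h2
          exact absurd h2.1 h1.ne
      have h1 := hs σ
      have h2 := hs ℓ
      have h3 := h.le k
      linarith

/-- The cells of least slope form an initial segment on which the envelope is flat, so the least
slope is the average of `ℓ` over an initial segment. It is enough to bound such averages. -/
lemma lower_bound (h : IsEnvelope B σ ℓ) {c : ℝ}
    (hc : ∀ k, c * (B.filter (· < k)).card ≤ ∑ q ∈ B with q < k, ℓ q) {s : ℕ} (hs : s ∈ B) :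
    c ≤ σ s := by
  classical
  obtain ⟨m, hm, hmin⟩ := B.exists_min_image σ ⟨s, hs⟩
  refine le_trans ?_ (hmin s hs)
  obtain ⟨k, hk⟩ := exists_lt_iff B (fun q => σ q ≤ σ m)
    (fun q hq q' hq' hle h1 => (h.mono q hq q' hq' hle).trans h1)
  have hf : B.filter (σ · = σ m) = B.filter (· < k) := by
    apply Finset.filter_congr
    intro q hq
    rw [← hk q hq]
    exact ⟨fun h => h.le, fun h => le_antisymm h (hmin q hq)⟩
  have h1 := (h.isFlat (σ m)).total
  rw [hf] at h1
  have h2 := hc k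
  rw [h1] at h2
  refine le_of_mul_le_mul_right h2 ?_
  rw [← hf]
  have hpos : 0 < (B.filter (σ · = σ m)).card := Finset.card_pos.2 ⟨m, by simp [hm]⟩
  exact_mod_cast hpos

/-- As for the lower bound, with the cells of greatest slope, which form a final segment. -/
lemma upper_bound (h : IsEnvelope B σ ℓ) {c : ℝ}
    (hc : ∀ k, ∑ q ∈ B with k ≤ q, ℓ q ≤ c * (B.filter (k ≤ ·)).card) {s : ℕ} (hs : s ∈ B) :
    σ s ≤ c := by
  classical
  obtain ⟨m, hm, hmax⟩ := B.exists_max_image σ ⟨s, hs⟩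
  refine (hmax s hs).trans ?_
  obtain ⟨k, hk⟩ := exists_lt_iff B (fun q => σ q < σ m)
    (fun q hq q' hq' hle h1 => (h.mono q hq q' hq' hle).trans_lt h1)
  have hf : B.filter (σ · = σ m) = B.filter (k ≤ ·) := by
    apply Finset.filter_congr
    intro q hq
    rw [← not_lt, ← hk q hq]
    exact ⟨fun h => h.ge.not_gt, fun h => le_antisymm (hmax q hq) (not_lt.1 h)⟩
  have h1 := (h.isFlat (σ m)).total
  rw [hf] at h1
  have h2 := hc k
  rw [h1] at h2
  refine le_of_mul_le_mul_right h2 ?_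
  rw [← hf]
  have hpos : 0 < (B.filter (σ · = σ m)).card := Finset.card_pos.2 ⟨m, by simp [hm]⟩
  exact_mod_cast hpos

/-- At a jump of the slope, the averages of `ℓ` over the cells on the left are at most the slope
on the left. -/
lemma sum_le_of_break (h : IsEnvelope B σ ℓ) {m : ℕ}
    (hbr : ∀ q ∈ B, m < q → σ m < σ q) (hm : m ∈ B) (r : ℕ) :
    ∑ q ∈ B with r ≤ q ∧ q ≤ m, ℓ q ≤ σ m * (B.filter fun q => r ≤ q ∧ q ≤ m).card := by
  classical
  by_cases hrm : r ≤ m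
  swap
  · have : (B.filter fun q => r ≤ q ∧ q ≤ m) = ∅ := by
      apply Finset.filter_eq_empty_iff.2
      intro q _ h1; omega
    rw [this]; simp
  have hs : ∀ g : ℕ → ℝ, ∑ q ∈ B with q < m + 1, g q =
      ∑ q ∈ B with q < r, g q + ∑ q ∈ B with r ≤ q ∧ q ≤ m, g q := by
    intro g
    rw [← Finset.sum_union]
    · congr 1
      ext q
      simp only [Finset.mem_filter, Finset.mem_union]
      constructor
      · rintro ⟨h1, h2⟩
        by_cases h3 : q < r
        · exact Or.inl ⟨h1, h3⟩
        · exact Or.inr ⟨h1, by omega, by omega⟩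
      · rintro (⟨h1, h2⟩ | ⟨h1, h2, h3⟩)
        · exact ⟨h1, by omega⟩
        · exact ⟨h1, by omega⟩
    · rw [Finset.disjoint_filter]
      intro q _ h1 h2; omega
  -- The primitives agree just behind `m` and are ordered at `r`, so between the two cuts `ℓ` has at
  -- most the sum of `σ`.
  have h1 := h.touch (m + 1) (fun q hq q' hq' h1 h2 =>
    (h.mono q hq m hm (by omega)).trans_lt (hbr q' hq' (by omega)))
  have h2 := h.le r
  have h3 := hs σ
  have h4 := hs ℓ
  have h5 : ∑ q ∈ B with r ≤ q ∧ q ≤ m, σ q ≤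
      σ m * (B.filter fun q => r ≤ q ∧ q ≤ m).card := by
    rw [mul_comm, ← nsmul_eq_mul]
    refine Finset.sum_le_card_nsmul _ _ _ fun q hq => ?_
    obtain ⟨hqB, -, hqm⟩ := Finset.mem_filter.1 hq
    exact h.mono q hqB m hm hqm
  linarith

/-- Mirror image of `sum_le_of_break`: the primitives agree just before `m'` and are ordered behind
`r`. -/
lemma le_sum_of_break (h : IsEnvelope B σ ℓ) {m' : ℕ}
    (hbr : ∀ q ∈ B, q < m' → σ q < σ m') (hm : m' ∈ B) (r : ℕ) :
    σ m' * (B.filter fun q => m' ≤ q ∧ q ≤ r).card ≤ ∑ q ∈ B with m' ≤ q ∧ q ≤ r, ℓ q := by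
  classical
  by_cases hrm : m' ≤ r
  swap
  · have : (B.filter fun q => m' ≤ q ∧ q ≤ r) = ∅ := by
      apply Finset.filter_eq_empty_iff.2
      intro q _ h1; omega
    rw [this]; simp
  have hs : ∀ g : ℕ → ℝ, ∑ q ∈ B with q < r + 1, g q =
      ∑ q ∈ B with q < m', g q + ∑ q ∈ B with m' ≤ q ∧ q ≤ r, g q := by
    intro g
    rw [← Finset.sum_union]
    · congr 1
      ext q
      simp only [Finset.mem_filter, Finset.mem_union]
      constructor
      · rintro ⟨h1, h2⟩
        by_cases h3 : q < m'
        · exact Or.inl ⟨h1, h3⟩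
        · exact Or.inr ⟨h1, by omega, by omega⟩
      · rintro (⟨h1, h2⟩ | ⟨h1, h2, h3⟩)
        · exact ⟨h1, by omega⟩
        · exact ⟨h1, by omega⟩
    · rw [Finset.disjoint_filter]
      intro q _ h1 h2; omega
  have h1 := h.touch m' (fun q hq q' hq' h1 h2 =>
    (hbr q hq h1).trans_le (h.mono m' hm q' hq' h2))
  have h2 := h.le (r + 1)
  have h3 := hs σ
  have h4 := hs ℓ
  have h5 : σ m' * (B.filter fun q => m' ≤ q ∧ q ≤ r).card ≤
      ∑ q ∈ B with m' ≤ q ∧ q ≤ r, σ q := by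
    rw [mul_comm, ← nsmul_eq_mul]
    refine Finset.card_nsmul_le_sum _ _ _ fun q hq => ?_
    obtain ⟨hqB, hqm, -⟩ := Finset.mem_filter.1 hq
    exact h.mono m' hm q hqB hqm
  linarith

/-- Perturbation of a flat envelope. -/
lemma abs_sub_le_of_isFlat (h : IsEnvelope B σ ℓ) {ℓ' : ℕ → ℝ} {c d : ℝ} (hflat : IsFlat B ℓ' c)
    (hd : ∀ q ∈ B, |ℓ q - ℓ' q| ≤ d) {s : ℕ} (hs : s ∈ B) : |σ s - c| ≤ d := by
  rw [abs_le]
  constructor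
  · have : c - d ≤ σ s := by
      refine h.lower_bound (fun k => ?_) hs
      have h1 := hflat.le k
      have h2 : ∑ q ∈ B with q < k, (ℓ' q - ℓ q) ≤ (B.filter (· < k)).card • d :=
        Finset.sum_le_card_nsmul _ _ _ fun q hq => by
          have := (abs_le.1 (hd q (Finset.mem_filter.1 hq).1)).1
          linarith
      rw [Finset.sum_sub_distrib, nsmul_eq_mul] at h2
      linarith
    linarith
  · have : σ s ≤ c + d := by
      refine h.upper_bound (fun k => ?_) hs
      have h1 := hflat.ge k
      have h2 : ∑ q ∈ B with k ≤ q, (ℓ q - ℓ' q) ≤ (B.filter (k ≤ ·)).card • d :=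
        Finset.sum_le_card_nsmul _ _ _ fun q hq =>
          (abs_le.1 (hd q (Finset.mem_filter.1 hq).1)).2
      rw [Finset.sum_sub_distrib, nsmul_eq_mul] at h2
      linarith
    linarith

/-- Total change of slope when two flat pieces with decreasing slopes are merged. -/
lemma sum_abs_sub_le_of_merge {L R : Finset ℕ} {cL cR : ℝ}
    (h : IsEnvelope (L ∪ R) σ ℓ) (hL : IsFlat L ℓ cL) (hR : IsFlat R ℓ cR)
    (hLR : ∀ q ∈ L, ∀ q' ∈ R, q < q') (hc : cR ≤ cL) (hLne : L.Nonempty) :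
    ∑ q ∈ L, |σ q - cL| + ∑ q ∈ R, |σ q - cR| ≤
      2 * (L.card * R.card * (cL - cR) / (L.card + R.card)) := by
  classical
  have hdisj : Disjoint L R := by
    rw [Finset.disjoint_left]
    intro q h1 h2
    exact lt_irrefl q (hLR q h1 q h2)
  set l : ℝ := (L.card : ℝ) with hl
  set r : ℝ := (R.card : ℝ) with hr
  have hl0 : 0 < l := by rw [hl]; exact_mod_cast hLne.card_pos
  have hr0 : 0 ≤ r := by rw [hr]; positivity
  -- The merged front travels with the mean speed weighted by the numbers of waves, as conservation
  -- requires.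
  set c := (l * cL + r * cR) / (l + r) with hcdef
  have hlr : 0 < l + r := by linarith
  have hcL : cL - c = r * (cL - cR) / (l + r) := by rw [hcdef]; field_simp; ring
  have hcR : c - cR = l * (cL - cR) / (l + r) := by rw [hcdef]; field_simp; ring
  have hcL0 : 0 ≤ cL - c := by rw [hcL]; have := sub_nonneg.2 hc; positivity
  have hcR0 : 0 ≤ c - cR := by rw [hcR]; have := sub_nonneg.2 hc; positivity
  have hcc : (l + r) * c = l * cL + r * cR := by rw [hcdef]; field_simp
  have hsum : ∀ (p : ℕ → Prop) [DecidablePred p] (g : ℕ → ℝ), ∑ q ∈ L ∪ R with p q, g q =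
      ∑ q ∈ L with p q, g q + ∑ q ∈ R with p q, g q := by
    intro p _ g
    rw [Finset.filter_union, Finset.sum_union (Finset.disjoint_filter_filter hdisj)]
  have hcard : ∀ (p : ℕ → Prop) [DecidablePred p], (((L ∪ R).filter p).card : ℝ) =
      (L.filter p).card + (R.filter p).card := by
    intro p _
    simpa using hsum p (fun _ => 1)
  have hsplit : ∀ k, (∀ q ∈ L, q < k) ∨ R.filter (· < k) = ∅ := by
    intro k
    by_cases hk : ∀ q ∈ L, q < k
    · exact Or.inl hk
    · push Not at hk
      obtain ⟨q₀, h1, h2⟩ := hk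
      refine Or.inr (Finset.filter_eq_empty_iff.2 fun q hq hlt => ?_)
      have := hLR q₀ h1 q hq
      omega
  -- Slopes `cL` followed by the smaller `cR` give a concave corner. The primitive stays above the
  -- chord of slope `c`, so the envelope of the union is that chord.
  have hflat : IsFlat (L ∪ R) ℓ c := by
    constructor
    · intro k
      rw [hsum, hcard]
      have h1 := hL.le k
      have h2 := hR.le k
      rcases hsplit k with hk | hk
      · rw [Finset.filter_true_of_mem hk, ← hl] at *
        have h3 : ((R.filter (· < k)).card : ℝ) ≤ r := by
          rw [hr]; exact_mod_cast Finset.card_filter_le _ _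
        nlinarith
      · rw [hk] at h2 ⊢
        have h3 : (0 : ℝ) ≤ (L.filter (· < k)).card := by positivity
        simp only [Finset.card_empty, Nat.cast_zero, add_zero, Finset.sum_empty]
        nlinarith
    · rw [Finset.sum_union hdisj, hL.total, hR.total, Finset.card_union_of_disjoint hdisj]
      push_cast
      rw [← hl, ← hr]
      linarith
  have hσ : ∀ s ∈ L ∪ R, σ s = c := fun s hs => by
    have := h.abs_sub_le_of_isFlat hflat (d := 0) (by simp) hs
    linarith [abs_nonpos_iff.1 this]
  have hsL : ∑ q ∈ L, |σ q - cL| = ∑ _q ∈ L, (cL - c) := Finset.sum_congr rfl fun q hq => by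
    rw [hσ q (Finset.mem_union_left _ hq), abs_sub_comm, abs_of_nonneg hcL0]
  have hsR : ∑ q ∈ R, |σ q - cR| = ∑ _q ∈ R, (c - cR) := Finset.sum_congr rfl fun q hq => by
    rw [hσ q (Finset.mem_union_right _ hq), abs_of_nonneg hcR0]
  rw [hsL, hsR, Finset.sum_const, Finset.sum_const, nsmul_eq_mul, nsmul_eq_mul, ← hl, ← hr,
    hcL, hcR]
  apply le_of_eq; ring

/-- Total change of slope when an initial or final segment of a flat piece is kept. -/
lemma sum_abs_sub_le_of_segment {F : Finset ℕ} {c d : ℝ} (h : IsEnvelope B σ ℓ)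
    (hF : IsFlat F ℓ c) (hBF : B ⊆ F) (hd : ∀ q ∈ F, ∀ q' ∈ F, |ℓ q - ℓ q'| ≤ d)
    (hseg : (∀ q ∈ F, ∀ q' ∈ B, q ≤ q' → q ∈ B) ∨ (∀ q ∈ F, ∀ q' ∈ B, q' ≤ q → q ∈ B)) :
    ∑ q ∈ B, |σ q - c| ≤ (F \ B).card * d := by
  classical
  -- `c` is the mean of `ℓ` over `F`, and the oscillation of `ℓ` on `F` is at most `d`.
  have havg : ∀ q ∈ F, |ℓ q - c| ≤ d := by
    intro q hq
    have hpos : (0 : ℝ) < F.card := by exact_mod_cast Finset.card_pos.2 ⟨q, hq⟩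
    have h1 : ∑ q' ∈ F, (ℓ q - ℓ q') ≤ F.card • d :=
      Finset.sum_le_card_nsmul _ _ _ fun q' hq' => (abs_le.1 (hd q hq q' hq')).2
    have h2 : ∑ q' ∈ F, (ℓ q' - ℓ q) ≤ F.card • d :=
      Finset.sum_le_card_nsmul _ _ _ fun q' hq' => (abs_le.1 (hd q' hq' q hq)).2
    rw [Finset.sum_sub_distrib, hF.total, Finset.sum_const, nsmul_eq_mul, nsmul_eq_mul] at h1 h2
    rw [abs_le]
    constructor <;> nlinarith
  have hsd : ∀ g : ℕ → ℝ, ∑ q ∈ F \ B, g q + ∑ q ∈ B, g q = ∑ q ∈ F, g q :=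
    fun g => Finset.sum_sdiff hBF
  have hcard : ((F \ B).card : ℝ) + B.card = F.card := by simpa using hsd fun _ => 1
  have hℓ := hsd ℓ
  rw [hF.total, ← h.sum_eq, ← hcard] at hℓ
  -- The removed cells carry the whole defect: what `B` gains relative to the slope `c` is what `F \
  -- B` loses.
  have hdev : |∑ q ∈ F \ B, ℓ q - (F \ B).card * c| ≤ (F \ B).card * d := by
    have : ∑ q ∈ F \ B, ℓ q - (F \ B).card * c = ∑ q ∈ F \ B, (ℓ q - c) := by
      rw [Finset.sum_sub_distrib, Finset.sum_const, nsmul_eq_mul]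
    rw [this]
    refine (Finset.abs_sum_le_sum_abs _ _).trans ?_
    rw [← nsmul_eq_mul]
    exact Finset.sum_le_card_nsmul _ _ _ fun q hq => havg q (Finset.mem_sdiff.1 hq).1
  rw [abs_le] at hdev
  rcases hseg with hseg | hseg
  · obtain ⟨k', hk'⟩ := exists_lt_iff F (· ∈ B)
      (fun q hq q' _ hle h1 => hseg q hq q' h1 hle)
    have hfil : ∀ k, B.filter (· < k) = F.filter (· < min k k') := by
      intro k
      ext q
      simp only [Finset.mem_filter, lt_min_iff]
      exact ⟨fun ⟨h1, h2⟩ => ⟨hBF h1, h2, (hk' q (hBF h1)).1 h1⟩,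
        fun ⟨h1, h2, h3⟩ => ⟨(hk' q h1).2 h3, h2⟩⟩
    -- After a final segment is removed, all the remaining slopes move in the same direction, so the
    -- sum of absolute values is the absolute value of the sum.
    have hlow : ∀ s ∈ B, c ≤ σ s := fun s hs =>
      h.lower_bound (fun k => by rw [hfil k]; exact hF.le _) hs
    rw [Finset.sum_congr rfl (fun q hq => abs_of_nonneg (sub_nonneg.2 (hlow q hq))),
      Finset.sum_sub_distrib, Finset.sum_const, nsmul_eq_mul]
    linarith
  · obtain ⟨k', hk'⟩ := exists_lt_iff F (· ∉ B)
      (fun q hq q' hq' hle h1 h2 => h1 (hseg q' hq' q h2 hle))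
    have hfil : ∀ k, B.filter (k ≤ ·) = F.filter (max k k' ≤ ·) := by
      intro k
      ext q
      simp only [Finset.mem_filter, max_le_iff]
      refine ⟨fun ⟨h1, h2⟩ => ⟨hBF h1, h2, ?_⟩, fun ⟨h1, h2, h3⟩ => ⟨?_, h2⟩⟩
      · by_contra hcon
        exact (hk' q (hBF h1)).2 (not_le.1 hcon) h1
      · by_contra hcon
        exact absurd ((hk' q h1).1 hcon) (not_lt.2 h3)
    have hup : ∀ s ∈ B, σ s ≤ c := fun s hs =>
      h.upper_bound (fun k => by rw [hfil k]; exact hF.ge _) hs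
    rw [Finset.sum_congr rfl (fun q hq => abs_of_nonpos (sub_nonpos.2 (hup q hq))),
      Finset.sum_neg_distrib, Finset.sum_sub_distrib, Finset.sum_const, nsmul_eq_mul]
    linarith

end IsEnvelope

/-! ### Averages -/

/-- The average of `g` over a finite set. -/
def avg (I : Finset ℕ) (g : ℕ → ℝ) : ℝ := (∑ q ∈ I, g q) / I.card

lemma avg_le {I : Finset ℕ} (hI : I.Nonempty) {g : ℕ → ℝ} {c : ℝ} (h : ∀ q ∈ I, g q ≤ c) :
    avg I g ≤ c := by
  have hpos : (0 : ℝ) < I.card := by exact_mod_cast hI.card_pos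
  rw [avg, div_le_iff₀ hpos, mul_comm, ← nsmul_eq_mul]
  exact Finset.sum_le_card_nsmul _ _ _ h

lemma le_avg {I : Finset ℕ} (hI : I.Nonempty) {g : ℕ → ℝ} {c : ℝ} (h : ∀ q ∈ I, c ≤ g q) :
    c ≤ avg I g := by
  have hpos : (0 : ℝ) < I.card := by exact_mod_cast hI.card_pos
  rw [avg, le_div_iff₀ hpos, mul_comm, ← nsmul_eq_mul]
  exact Finset.card_nsmul_le_sum _ _ _ h

lemma avg_sub_avg_le {I₁ I₂ : Finset ℕ} (h₁ : I₁.Nonempty) (h₂ : I₂.Nonempty) {g : ℕ → ℝ} {d : ℝ}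
    (h : ∀ q ∈ I₁, ∀ q' ∈ I₂, g q - g q' ≤ d) : avg I₁ g - avg I₂ g ≤ d := by
  have : avg I₁ g - d ≤ avg I₂ g := le_avg h₂ fun q' hq' => by
    have : avg I₁ g ≤ g q' + d := avg_le h₁ fun q hq => by linarith [h q hq q' hq']
    linarith
  linarith

lemma avg_sub (I : Finset ℕ) (g g' : ℕ → ℝ) :
    avg I (fun q => g q - g' q) = avg I g - avg I g' := by
  simp [avg, Finset.sum_sub_distrib, sub_div]

lemma avg_neg (I : Finset ℕ) (g : ℕ → ℝ) : avg I (fun q => - g q) = - avg I g := by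
  simp [avg, neg_div]

/-- If the averages over two disjoint sets are comparable up to the penalties `β` and `γ`, adding
the first set to the second one increases the average by at most the penalty on the first set. -/
lemma avg_union_le {I₁ I₂ : Finset ℕ} (h₁ : I₁.Nonempty) (h₂ : I₂.Nonempty)
    (hdisj : Disjoint I₁ I₂) {g α β γ : ℕ → ℝ}
    (h : avg I₁ g - avg I₂ g ≤ ∑ q ∈ I₁, β q + ∑ q ∈ I₂, γ q)
    (hβ : ∀ q ∈ I₁, β q ≤ α q) (hγ : ∀ q ∈ I₁, ∀ q' ∈ I₂, γ q' ≤ α q) :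
    avg (I₁ ∪ I₂) g ≤ avg I₂ g + ∑ q ∈ I₁, α q := by
  have hn₁ : (0 : ℝ) < I₁.card := by exact_mod_cast h₁.card_pos
  have hn₂ : (0 : ℝ) < I₂.card := by exact_mod_cast h₂.card_pos
  have hβ' : ∑ q ∈ I₁, β q ≤ ∑ q ∈ I₁, α q := Finset.sum_le_sum hβ
  have hγ' : (I₁.card : ℝ) * ∑ q ∈ I₂, γ q ≤ I₂.card * ∑ q ∈ I₁, α q := by
    rw [Finset.mul_sum, ← nsmul_eq_mul I₂.card, ← Finset.sum_const]
    refine Finset.sum_le_sum fun q' hq' => ?_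
    rw [← nsmul_eq_mul]
    exact Finset.card_nsmul_le_sum _ _ _ fun q hq => hγ q hq q' hq'
  have e₁ : ∑ q ∈ I₁, g q = avg I₁ g * I₁.card := by rw [avg]; field_simp
  have e₂ : ∑ q ∈ I₂, g q = avg I₂ g * I₂.card := by rw [avg]; field_simp
  rw [avg, Finset.sum_union hdisj, e₁, e₂, Finset.card_union_of_disjoint hdisj, Nat.cast_add,
    div_le_iff₀ (by positivity)]
  nlinarith

/-- The elements of `A` between `r` and `m`. -/
def seg (A : Finset ℕ) (r m : ℕ) : Finset ℕ := A.filter fun q => r ≤ q ∧ q ≤ m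

lemma mem_seg {A : Finset ℕ} {r m q : ℕ} : q ∈ seg A r m ↔ q ∈ A ∧ r ≤ q ∧ q ≤ m := by
  simp [seg]

/-- `m` and `m'` are consecutive elements of `A`. -/
structure Adjacent (A : Finset ℕ) (m m' : ℕ) : Prop where
  left_mem : m ∈ A
  right_mem : m' ∈ A
  lt : m < m'
  out : ∀ q ∈ A, q ≤ m ∨ m' ≤ q

lemma Adjacent.seg_union {A : Finset ℕ} {m m' : ℕ} (h : Adjacent A m m') {r r' : ℕ}
    (hr : r ≤ m) (hr' : m' ≤ r') : seg A r m ∪ seg A m' r' = seg A r r' := by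
  ext q
  have := h.lt
  simp only [Finset.mem_union, mem_seg]
  constructor
  · rintro (⟨h1, h2, h3⟩ | ⟨h1, h2, h3⟩) <;> exact ⟨h1, by omega, by omega⟩
  · rintro ⟨h1, h2, h3⟩
    rcases h.out q h1 with h4 | h4
    · exact Or.inl ⟨h1, h2, h4⟩
    · exact Or.inr ⟨h1, h4, h3⟩

lemma Adjacent.disjoint {A : Finset ℕ} {m m' : ℕ} (h : Adjacent A m m') (r r' : ℕ) :
    Disjoint (seg A r m) (seg A m' r') := by
  rw [Finset.disjoint_left]
  intro q h1 h2
  rw [mem_seg] at h1 h2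
  have := h.lt
  omega

lemma exists_adjacent_left {A : Finset ℕ} {r a : ℕ} (hr : r ∈ A) (ha : a ∈ A) (hlt : r < a) :
    ∃ b, Adjacent A b a ∧ r ≤ b := by
  classical
  obtain ⟨b, hb, hmax⟩ := (A.filter (· < a)).exists_max_image id ⟨r, by simp [hr, hlt]⟩
  simp only [Finset.mem_filter, id_eq] at hb hmax
  refine ⟨b, ⟨hb.1, ha, hb.2, fun q hq => ?_⟩, hmax r ⟨hr, hlt⟩⟩
  by_cases hqa : q < a
  · exact Or.inl (hmax q ⟨hq, hqa⟩)
  · exact Or.inr (not_lt.1 hqa)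

lemma exists_adjacent_right {A : Finset ℕ} {r a : ℕ} (hr : r ∈ A) (ha : a ∈ A) (hlt : a < r) :
    ∃ b, Adjacent A a b ∧ b ≤ r := by
  classical
  obtain ⟨b, hb, hmin⟩ := (A.filter (a < ·)).exists_min_image id ⟨r, by simp [hr, hlt]⟩
  simp only [Finset.mem_filter, id_eq] at hb hmin
  refine ⟨b, ⟨ha, hb.1, hb.2, fun q hq => ?_⟩, hmin r ⟨hr, hlt⟩⟩
  by_cases hqa : a < q
  · exact Or.inr (hmin q ⟨hq, hqa⟩)
  · exact Or.inl (not_lt.1 hqa)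

/-! ### Histories of waves -/

/-- All the waves which arrive at `x` come from one front, and none is cancelled. -/
def SingleAt (A A' : Finset ℕ) (X σ p : ℕ → ℝ) (x : ℝ) : Prop :=
  (∀ s ∈ A, p s = x → s ∈ A') ∧
    ∀ s ∈ A, ∀ s' ∈ A, p s = x → p s' = x → X s = X s' ∧ σ s = σ s'

/-- Two fronts merge at `x`; the variation `V` of `v` does not change along them. -/
def MergeAt (A A' : Finset ℕ) (X σ p V V' : ℕ → ℝ) (x : ℝ) : Prop :=
  (∀ s ∈ A, p s = x → s ∈ A') ∧ (∀ s ∈ A, p s = x → V s = V' s) ∧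
    ∃ sL ∈ A, ∃ sR ∈ A, p sL = x ∧ p sR = x ∧ X sL < X sR ∧
      ∀ s ∈ A, p s = x → (X s = X sL ∧ σ s = σ sL) ∨ (X s = X sR ∧ σ s = σ sR)

/-- The waves which survive at `x` form an initial or final segment of one front; the variation
of `v` does not change along them. -/
def CancelAt (A A' : Finset ℕ) (X σ p V V' : ℕ → ℝ) (x : ℝ) : Prop :=
  (∀ s ∈ A', p s = x → V s = V' s) ∧
    ∃ sF ∈ A, (∀ s ∈ A', p s = x → X s = X sF ∧ σ s = σ sF) ∧
      ((∀ s ∈ A, ∀ s' ∈ A', X s = X sF → σ s = σ sF → p s' = x → s ≤ s' → s ∈ A') ∨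
        (∀ s ∈ A, ∀ s' ∈ A', X s = X sF → σ s = σ sF → p s' = x → s' ≤ s → s ∈ A'))

/-- The evolution of the waves during the first `J` collisions: signs `S`, right states `R`, slopes
`Λ u s` of the flux with parameter `u` on the cell of the wave `s`, sets `A j` of the waves which
exist at the time `t j`, their positions `X j` and speeds `σ j`. The parameter which the wave `s`
sees is `v (X j s + t j)`, and `V` is the variation of `v`. -/
structure WaveHistory where
  J : ℕ
  ε : ℝ
  D₂ : ℝ
  D₃ : ℝ
  Dv : ℝ
  T : ℝ
  S : ℕ → ℝ
  R : ℕ → ℝ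
  Λ : ℝ → ℕ → ℝ
  v : ℝ → ℝ
  V : ℝ → ℝ
  A : ℕ → Finset ℕ
  X : ℕ → ℕ → ℝ
  σ : ℕ → ℕ → ℝ
  t : ℕ → ℝ
  Δ : ℕ → ℝ
  ε_pos : 0 < ε
  D₂_nonneg : 0 ≤ D₂
  D₃_nonneg : 0 ≤ D₃
  Dv_nonneg : 0 ≤ Dv
  V_nonneg : ∀ y, 0 ≤ V y
  V_le : ∀ y, V y ≤ T
  abs_v_sub_le : ∀ y y', y ≤ y' → |v y' - v y| ≤ V y' - V y
  sign : ∀ s ∈ A 0, S s = 1 ∨ S s = -1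
  slope_lip : ∀ u s s', S s = S s' → |Λ u s - Λ u s'| ≤ D₂ * |R s - R s'|
  slope_mixed : ∀ u u' s s', S s = S s' →
    |(Λ u' s - Λ u s) - (Λ u' s' - Λ u s')| ≤ D₃ * |u' - u| * |R s - R s'|
  slope_param : ∀ u u' s, |Λ u' s - Λ u s| ≤ Dv * |u' - u|
  X_mono : ∀ j ≤ J, ∀ s ∈ A j, ∀ s' ∈ A j, s ≤ s' → X j s ≤ X j s'
  state : ∀ j ≤ J, ∀ s ∈ A j, R s = ε * ∑ q ∈ A j with q ≤ s, S q
  same_sign : ∀ j ≤ J, ∀ s ∈ A j, ∀ s' ∈ A j, X j s = X j s' → S s = S s'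
  env : ∀ j ≤ J, ∀ x, IsEnvelope ((A j).filter (X j · = x)) (σ j) (Λ (v (x + t j)))
  A_succ_subset : ∀ j < J, A (j + 1) ⊆ A j
  Δ_pos : ∀ j < J, 0 < Δ j
  X_succ : ∀ j < J, ∀ s ∈ A (j + 1), X (j + 1) s = X j s + σ j s * Δ j
  arrival_mono : ∀ j < J, ∀ s ∈ A j, ∀ s' ∈ A j, s ≤ s' →
    X j s + σ j s * Δ j ≤ X j s' + σ j s' * Δ j
  y_mono : ∀ j < J, ∀ s ∈ A (j + 1), X j s + t j ≤ X (j + 1) s + t (j + 1)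
  collision : ∀ j < J, ∃ x₀,
    (∀ x ≠ x₀, SingleAt (A j) (A (j + 1)) (X j) (σ j) (fun s => X j s + σ j s * Δ j) x) ∧
    (SingleAt (A j) (A (j + 1)) (X j) (σ j) (fun s => X j s + σ j s * Δ j) x₀ ∨
      MergeAt (A j) (A (j + 1)) (X j) (σ j) (fun s => X j s + σ j s * Δ j)
        (fun s => V (X j s + t j)) (fun s => V (X j s + σ j s * Δ j + t (j + 1))) x₀ ∨
      CancelAt (A j) (A (j + 1)) (X j) (σ j) (fun s => X j s + σ j s * Δ j)
        (fun s => V (X j s + t j)) (fun s => V (X j s + σ j s * Δ j + t (j + 1))) x₀)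

/-! ### Weights of waves and of pairs, signs and states. -/

namespace WaveHistory

variable (H : WaveHistory)

/-- The weight of a wave: bound for the second derivative of the flux, plus the bound for the
changes of the second derivative along the history of the wave. -/
def W (j s : ℕ) : ℝ := H.D₂ + H.D₃ * H.V (H.X j s + H.t j)

open Classical in
/-- The weight of a pair of waves at the last time at which they had the same position, `0` if there
is no such time. -/
def Ω : ℕ → ℕ → ℕ → ℝ
  | 0, s, s' => if s ∈ H.A 0 ∧ s' ∈ H.A 0 ∧ H.X 0 s = H.X 0 s' then H.W 0 s else 0
  | j + 1, s, s' =>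
    if s ∈ H.A (j + 1) ∧ s' ∈ H.A (j + 1) ∧ H.X (j + 1) s = H.X (j + 1) s' then H.W (j + 1) s
    else Ω j s s'

variable {H}

lemma V_mono {y y' : ℝ} (h : y ≤ y') : H.V y ≤ H.V y' := by
  have := (abs_nonneg _).trans (H.abs_v_sub_le y y' h)
  linarith

lemma W_nonneg (j s : ℕ) : 0 ≤ H.W j s :=
  add_nonneg H.D₂_nonneg (mul_nonneg H.D₃_nonneg (H.V_nonneg _))

lemma D₂_le_W (j s : ℕ) : H.D₂ ≤ H.W j s :=
  le_add_of_nonneg_right (mul_nonneg H.D₃_nonneg (H.V_nonneg _))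

lemma W_le (j s : ℕ) : H.W j s ≤ H.D₂ + H.D₃ * H.T :=
  add_le_add_right (mul_le_mul_of_nonneg_left (H.V_le _) H.D₃_nonneg) _

lemma W_le_W {j s s' : ℕ} (h : H.X j s ≤ H.X j s') : H.W j s ≤ H.W j s' :=
  add_le_add_right (mul_le_mul_of_nonneg_left (V_mono (by linarith)) H.D₃_nonneg) _

lemma W_congr {j s s' : ℕ} (h : H.X j s = H.X j s') : H.W j s = H.W j s' := by
  rw [W, W, h]

/-- X + t does not decrease along a wave, so the wave has seen at least as much variation of `v` as
before. -/
lemma W_succ {j s : ℕ} (hj : j < H.J) (hs : s ∈ H.A (j + 1)) : H.W j s ≤ H.W (j + 1) s :=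
  add_le_add_right (mul_le_mul_of_nonneg_left (V_mono (H.y_mono j hj s hs)) H.D₃_nonneg) _

lemma A_subset_zero {j : ℕ} (hj : j ≤ H.J) : H.A j ⊆ H.A 0 := by
  induction j with
  | zero => exact Finset.Subset.refl _
  | succ j ih => exact (H.A_succ_subset j hj).trans (ih (by omega))

lemma Ω_together {j s s' : ℕ} (hs : s ∈ H.A j) (hs' : s' ∈ H.A j) (hX : H.X j s = H.X j s') :
    H.Ω j s s' = H.W j s := by
  cases j <;> rw [Ω, if_pos ⟨hs, hs', hX⟩]

lemma Ω_succ_of_ne {j s s' : ℕ} (hX : H.X (j + 1) s ≠ H.X (j + 1) s') :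
    H.Ω (j + 1) s s' = H.Ω j s s' := by
  rw [Ω, if_neg fun h => hX h.2.2]

lemma Ω_nonneg (j s s' : ℕ) : 0 ≤ H.Ω j s s' := by
  induction j with
  | zero => rw [Ω]; split_ifs <;> simp [W_nonneg]
  | succ j ih => rw [Ω]; split_ifs <;> simp [W_nonneg, ih]

lemma Ω_le (hT : 0 ≤ H.T) (j s s' : ℕ) : H.Ω j s s' ≤ H.D₂ + H.D₃ * H.T := by
  have h0 : 0 ≤ H.D₂ + H.D₃ * H.T := add_nonneg H.D₂_nonneg (mul_nonneg H.D₃_nonneg hT)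
  induction j with
  | zero => rw [Ω]; split_ifs; exacts [W_le _ _, h0]
  | succ j ih => rw [Ω]; split_ifs; exacts [W_le _ _, ih]

/-- The recorded value is a past weight of `s`, and weights grow along a wave. -/
lemma Ω_le_W {j s : ℕ} (hj : j ≤ H.J) (hs : s ∈ H.A j) (s' : ℕ) : H.Ω j s s' ≤ H.W j s := by
  induction j with
  | zero => rw [Ω]; split_ifs; exacts [le_rfl, W_nonneg _ _]
  | succ j ih =>
    rw [Ω]; split_ifs
    · exact le_rfl
    · exact (ih (by omega) (H.A_succ_subset j hj hs)).trans (W_succ hj hs)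

lemma Ω_le_succ {j : ℕ} (hj : j < H.J) (s s' : ℕ) : H.Ω j s s' ≤ H.Ω (j + 1) s s' := by
  rw [Ω]; split_ifs with h
  · exact (Ω_le_W hj.le (H.A_succ_subset j hj h.1) s').trans (W_succ hj h.1)
  · exact le_rfl

/-- Positions are monotone in the labels, so whenever the outer pair is together the inner pair is
at the same place. The last meeting of the inner pair is therefore not earlier, and weights only
grow. This monotonicity later turns penalties at the neighbours `m`, `m'` into penalties over all
pairs. -/
lemma Ω_nest {j : ℕ} (hj : j ≤ H.J) {r q q' r' : ℕ} (hr : r ∈ H.A j) (hq : q ∈ H.A j)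
    (hq' : q' ∈ H.A j) (hr' : r' ∈ H.A j) (h₁ : r ≤ q) (h₂ : q ≤ q') (h₃ : q' ≤ r') :
    H.Ω j r r' ≤ H.Ω j q q' := by
  have key : H.X j r = H.X j r' → H.X j q = H.X j q' ∧ H.X j r = H.X j q := fun h => by
    have e₁ := H.X_mono j hj r hr q hq h₁
    have e₂ := H.X_mono j hj q hq q' hq' h₂
    have e₃ := H.X_mono j hj q' hq' r' hr' h₃
    constructor <;> linarith
  by_cases h : H.X j r = H.X j r'
  · obtain ⟨h4, h5⟩ := key h
    rw [Ω_together hr hr' h, Ω_together hq hq' h4, W_congr h5]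
  · induction j with
    | zero =>
      rw [Ω, if_neg fun h' => h h'.2.2]
      exact Ω_nonneg _ _ _
    | succ j ih =>
      rw [Ω_succ_of_ne h]
      have hs := H.A_succ_subset j hj
      refine le_trans ?_ (Ω_le_succ hj q q')
      have key' : H.X j r = H.X j r' → H.X j q = H.X j q' ∧ H.X j r = H.X j q := fun h => by
        have e₁ := H.X_mono j (by omega) r (hs hr) q (hs hq) h₁
        have e₂ := H.X_mono j (by omega) q (hs hq) q' (hs hq') h₂
        have e₃ := H.X_mono j (by omega) q' (hs hq') r' (hs hr') h₃
        constructor <;> linarith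
      by_cases h' : H.X j r = H.X j r'
      · obtain ⟨h4, h5⟩ := key' h'
        rw [Ω_together (hs hr) (hs hr') h', Ω_together (hs hq) (hs hq') h4, W_congr h5]
      · exact ih (by omega) (hs hr) (hs hq) (hs hq') (hs hr') key' h'

/-- Waves between two waves which have been at the same position have the same sign. -/
lemma sign_eq_of_Ω_pos {j : ℕ} (hj : j ≤ H.J) {s s' : ℕ} (hs : s ∈ H.A j) (hs' : s' ∈ H.A j)
    (hΩ : 0 < H.Ω j s s') {q : ℕ} (hq : q ∈ H.A j) (h₁ : s ≤ q) (h₂ : q ≤ s') :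
    H.S q = H.S s := by
  by_cases h : H.X j s = H.X j s'
  · have e₁ := H.X_mono j hj s hs q hq h₁
    have e₂ := H.X_mono j hj q hq s' hs' h₂
    exact H.same_sign j hj q hq s hs (by linarith)
  · induction j with
    | zero =>
      rw [Ω, if_neg fun h' => h h'.2.2] at hΩ
      exact absurd hΩ (lt_irrefl _)
    | succ j ih =>
      rw [Ω_succ_of_ne h] at hΩ
      have hsub := H.A_succ_subset j hj
      by_cases h' : H.X j s = H.X j s'
      · have e₁ := H.X_mono j (by omega) s (hsub hs) q (hsub hq) h₁
        have e₂ := H.X_mono j (by omega) q (hsub hq) s' (hsub hs') h₂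
        exact H.same_sign j (by omega) q (hsub hq) s (hsub hs) (by linarith)
      · exact ih (by omega) (hsub hs) (hsub hs') hΩ (hsub hq) h'

lemma S_ne_zero {s : ℕ} (hs : s ∈ H.A 0) : H.S s ≠ 0 := by
  rcases H.sign s hs with h | h <;> rw [h] <;> norm_num

lemma abs_S {s : ℕ} (hs : s ∈ H.A 0) : |H.S s| = 1 := by
  rcases H.sign s hs with h | h <;> rw [h] <;> norm_num

lemma R_sub {j : ℕ} (hj : j ≤ H.J) {m m' : ℕ} (hm : m ∈ H.A j) (hm' : m' ∈ H.A j) (h : m ≤ m') :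
    H.R m' - H.R m = H.ε * ∑ q ∈ H.A j with m < q ∧ q ≤ m', H.S q := by
  rw [H.state j hj m hm, H.state j hj m' hm', ← mul_sub]
  congr 1
  rw [sub_eq_iff_eq_add, ← Finset.sum_union]
  · congr 1
    ext q
    simp only [Finset.mem_filter, Finset.mem_union]
    constructor
    · rintro ⟨h1, h2⟩
      by_cases h3 : q ≤ m
      · exact Or.inr ⟨h1, h3⟩
      · exact Or.inl ⟨h1, by omega, h2⟩
    · rintro (⟨h1, h2⟩ | ⟨h1, h2⟩)
      · exact ⟨h1, h2.2⟩
      · exact ⟨h1, by omega⟩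
  · rw [Finset.disjoint_filter]
    intro q _ h1 h2; omega

/-- No wave between `m` and `m'` has been cancelled if the waves between them have the same sign. -/
lemma mem_succ_of_sign {j : ℕ} (hj : j < H.J) {m m' : ℕ} (hm : m ∈ H.A (j + 1))
    (hm' : m' ∈ H.A (j + 1)) (hS : ∀ q ∈ H.A j, m ≤ q → q ≤ m' → H.S q = H.S m)
    {q : ℕ} (hq : q ∈ H.A j) (h₁ : m ≤ q) (h₂ : q ≤ m') : q ∈ H.A (j + 1) := by
  have hsub := H.A_succ_subset j hj
  by_contra hcon
  have hmq : m < q := lt_of_le_of_ne h₁ (by rintro rfl; exact hcon hm)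
  -- The difference of right states does not depend on time. Computed at both times it shows that
  -- the signs of the cancelled waves in between sum to zero; if they are all equal there are no
  -- such waves.
  have e₁ := R_sub hj.le (hsub hm) (hsub hm') (h₁.trans h₂)
  have e₂ := R_sub (j := j + 1) hj hm hm' (h₁.trans h₂)
  rw [e₁] at e₂
  have e₃ := mul_left_cancel₀ H.ε_pos.ne' e₂
  have hss : (H.A (j + 1)).filter (fun q => m < q ∧ q ≤ m') ⊆
      (H.A j).filter (fun q => m < q ∧ q ≤ m') := Finset.filter_subset_filter _ hsub
  rw [← Finset.sum_sdiff hss, add_eq_right] at e₃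
  have e₄ : ∑ x ∈ (H.A j).filter (fun q => m < q ∧ q ≤ m') \
      (H.A (j + 1)).filter (fun q => m < q ∧ q ≤ m'), H.S x = _ :=
    Finset.sum_congr rfl (g := fun _ => H.S m) fun x hx => by
      simp only [Finset.mem_sdiff, Finset.mem_filter] at hx
      exact hS x hx.1.1 hx.1.2.1.le hx.1.2.2
  rw [e₄, Finset.sum_const, nsmul_eq_mul, mul_eq_zero] at e₃
  rcases e₃ with h | h
  · rw [Nat.cast_eq_zero, Finset.card_eq_zero] at h
    have : q ∈ (H.A j).filter (fun q => m < q ∧ q ≤ m') \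
        (H.A (j + 1)).filter (fun q => m < q ∧ q ≤ m') := by
      simp [hq, hmq, h₂, hcon]
    rw [h] at this
    simp at this
  · exact S_ne_zero (A_subset_zero hj hm) h

/-- Each existing wave changes the state by exactly ε in absolute value. -/
lemma abs_R_sub_le {j : ℕ} (hj : j ≤ H.J) {r r' q q' : ℕ} (hq : q ∈ seg (H.A j) r r')
    (hq' : q' ∈ seg (H.A j) r r') : |H.R q - H.R q'| ≤ H.ε * (seg (H.A j) r r').card := by
  wlog h : q' ≤ q generalizing q q'
  · rw [abs_sub_comm]
    exact this hq' hq (by omega)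
  obtain ⟨hq1, hq2, hq3⟩ := mem_seg.1 hq
  obtain ⟨hq1', hq2', hq3'⟩ := mem_seg.1 hq'
  rw [R_sub hj hq1' hq1 h, abs_mul, abs_of_pos H.ε_pos]
  refine mul_le_mul_of_nonneg_left ?_ H.ε_pos.le
  refine (Finset.abs_sum_le_sum_abs _ _).trans ?_
  rw [Finset.sum_congr rfl (g := fun _ => (1 : ℝ)) fun x hx =>
    abs_S (A_subset_zero hj (Finset.mem_filter.1 hx).1)]
  simp only [Finset.sum_const, nsmul_eq_mul, mul_one, Nat.cast_le]
  apply Finset.card_le_card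
  intro x hx
  simp only [Finset.mem_filter] at hx
  exact mem_seg.2 ⟨hx.1, by omega, by omega⟩

end WaveHistory

/-! ### Almost convexity of the flux across neighbouring waves. -/

namespace WaveHistory

variable {H : WaveHistory}

lemma avg_slope_sub_le {j : ℕ} (hj : j ≤ H.J) {r r' : ℕ}
    (hS : ∀ q ∈ H.A j, r ≤ q → q ≤ r' → H.S q = H.S r) {I₁ I₂ : Finset ℕ}
    (h₁ : I₁ ⊆ seg (H.A j) r r') (h₂ : I₂ ⊆ seg (H.A j) r r') (hn₁ : I₁.Nonempty)
    (hn₂ : I₂.Nonempty) (u : ℝ) :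
    avg I₁ (H.Λ u) - avg I₂ (H.Λ u) ≤ H.D₂ * (H.ε * (seg (H.A j) r r').card) := by
  refine avg_sub_avg_le hn₁ hn₂ fun q hq q' hq' => ?_
  have hq1 := mem_seg.1 (h₁ hq)
  have hq1' := mem_seg.1 (h₂ hq')
  refine (le_abs_self _).trans ((H.slope_lip u q q' ?_).trans ?_)
  · rw [hS q hq1.1 hq1.2.1 hq1.2.2, hS q' hq1'.1 hq1'.2.1 hq1'.2.2]
  · exact mul_le_mul_of_nonneg_left (abs_R_sub_le hj (h₁ hq) (h₂ hq')) H.D₂_nonneg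

/-- The increment of the slopes from `u` to `u'` is itself Lipschitz in the state, with constant `D₃
* |u' - u|`. Only this part of the increment affects a difference of averages. -/
lemma avg_slope_sub_le_param {j : ℕ} (hj : j ≤ H.J) {r r' : ℕ}
    (hS : ∀ q ∈ H.A j, r ≤ q → q ≤ r' → H.S q = H.S r) {I₁ I₂ : Finset ℕ}
    (h₁ : I₁ ⊆ seg (H.A j) r r') (h₂ : I₂ ⊆ seg (H.A j) r r') (hn₁ : I₁.Nonempty)
    (hn₂ : I₂.Nonempty) (u u' : ℝ) :
    avg I₁ (H.Λ u') - avg I₂ (H.Λ u') ≤ avg I₁ (H.Λ u) - avg I₂ (H.Λ u) +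
      H.D₃ * |u' - u| * (H.ε * (seg (H.A j) r r').card) := by
  have : avg I₁ (fun q => H.Λ u' q - H.Λ u q) - avg I₂ (fun q => H.Λ u' q - H.Λ u q) ≤
      H.D₃ * |u' - u| * (H.ε * (seg (H.A j) r r').card) := by
    refine avg_sub_avg_le hn₁ hn₂ fun q hq q' hq' => ?_
    have hq1 := mem_seg.1 (h₁ hq)
    have hq1' := mem_seg.1 (h₂ hq')
    refine (le_abs_self _).trans ((H.slope_mixed u u' q q' ?_).trans ?_)
    · rw [hS q hq1.1 hq1.2.1 hq1.2.2, hS q' hq1'.1 hq1'.2.1 hq1'.2.2]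
    · exact mul_le_mul_of_nonneg_left (abs_R_sub_le hj (h₁ hq) (h₂ hq'))
        (mul_nonneg H.D₃_nonneg (abs_nonneg _))
  rw [avg_sub, avg_sub] at this
  linarith

variable (H) in
/-- The averages of the slopes of the flux with parameter `u` on the two sides of the pair
`(m, m')` are ordered, up to the total weight `w` which the pairs of waves have not yet spent. -/
def AlmostConvexAt (j m m' r r' : ℕ) (u w : ℝ) : Prop :=
  avg (seg (H.A j) r m) (H.Λ u) - avg (seg (H.A j) m' r') (H.Λ u) ≤
    ∑ q ∈ seg (H.A j) r m, H.ε * (w - H.Ω j q m') +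
      ∑ q ∈ seg (H.A j) m' r', H.ε * (w - H.Ω j m q)

lemma seg_nonempty {A : Finset ℕ} {r m : ℕ} (hr : r ∈ A) (h : r ≤ m) : (seg A r m).Nonempty :=
  ⟨r, mem_seg.2 ⟨hr, le_rfl, h⟩⟩

lemma seg_nonempty' {A : Finset ℕ} {r m : ℕ} (hm : m ∈ A) (h : r ≤ m) : (seg A r m).Nonempty :=
  ⟨m, mem_seg.2 ⟨hm, h, le_rfl⟩⟩

/-- Raising the weight from `w` to `w'` gives each wave of the interval an additional allowance `ε *
(w' - w)`. Summed over the interval, this covers what the change of parameter costs by the mixed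
derivative bound. -/
lemma AlmostConvexAt.change_param {j m m' r r' : ℕ} {u w u' w' : ℝ} (hj : j ≤ H.J)
    (h : H.AlmostConvexAt j m m' r r' u w) (hadj : Adjacent (H.A j) m m')
    (hS : ∀ q ∈ H.A j, r ≤ q → q ≤ r' → H.S q = H.S r)
    (hr : r ≤ m) (hr' : m' ≤ r') (hw : H.D₃ * |u' - u| ≤ w' - w) :
    H.AlmostConvexAt j m m' r r' u' w' := by
  have hun := hadj.seg_union hr hr'
  have key := avg_slope_sub_le_param hj hS (I₁ := seg (H.A j) r m) (I₂ := seg (H.A j) m' r')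
    (hun ▸ Finset.subset_union_left) (hun ▸ Finset.subset_union_right)
    (seg_nonempty' hadj.left_mem hr) (seg_nonempty hadj.right_mem hr') u u'
  have hcard : ((seg (H.A j) r r').card : ℝ) =
      (seg (H.A j) r m).card + (seg (H.A j) m' r').card := by
    rw [← hun, Finset.card_union_of_disjoint (hadj.disjoint r r')]
    push_cast; rfl
  have e : ∀ (I : Finset ℕ) (o : ℕ → ℝ), ∑ q ∈ I, H.ε * (w' - o q) =
      ∑ q ∈ I, H.ε * (w - o q) + H.ε * (w' - w) * I.card := by
    intro I o
    rw [mul_comm _ (I.card : ℝ), ← nsmul_eq_mul, ← Finset.sum_const, ← Finset.sum_add_distrib]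
    exact Finset.sum_congr rfl fun q _ => by ring
  unfold AlmostConvexAt at h ⊢
  rw [e, e]
  rw [hcard] at key
  have h3 := mul_le_mul_of_nonneg_right hw (mul_nonneg H.ε_pos.le
    (add_nonneg (Nat.cast_nonneg (α := ℝ) (seg (H.A j) r m).card)
      (Nat.cast_nonneg (α := ℝ) (seg (H.A j) m' r').card)))
  linarith

variable (H) in
/-- Almost convexity across the pairs of consecutive waves at different positions. -/
def FarConvex (j : ℕ) : Prop := ∀ m m' r r', Adjacent (H.A j) m m' → H.X j m ≠ H.X j m' →
  r ∈ H.A j → r' ∈ H.A j → r ≤ m → m' ≤ r' → 0 < H.Ω j r m' → 0 < H.Ω j m r' →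
    H.AlmostConvexAt j m m' r r' (H.v (H.X j m + H.t j)) (H.W j m)

variable (H) in
/-- Almost convexity across the pairs of consecutive waves in different fronts. -/
def FrontConvex (j : ℕ) : Prop := ∀ m m' r r', Adjacent (H.A j) m m' →
  (H.X j m ≠ H.X j m' ∨ H.σ j m ≠ H.σ j m') →
  r ∈ H.A j → r' ∈ H.A j → r ≤ m → m' ≤ r' → 0 < H.Ω j r m' → 0 < H.Ω j m r' →
    H.AlmostConvexAt j m m' r r' (H.v (H.X j m + H.t j)) (H.W j m)

/-- Vacuous: initially a pair has met only if it is together, and then so are all the waves in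
between. -/
lemma farConvex_zero : H.FarConvex 0 := by
  intro m m' r r' hadj hX hr hr' h₁ h₂ hΩ _
  exfalso
  have h := H.X_mono 0 (Nat.zero_le _)
  by_cases hc : H.X 0 r = H.X 0 m'
  · apply hX
    have e₁ := h r hr m hadj.left_mem h₁
    have e₂ := h m hadj.left_mem m' hadj.right_mem hadj.lt.le
    linarith
  · rw [Ω, if_neg fun h' => hc h'.2.2] at hΩ
    exact lt_irrefl _ hΩ

/-- Waves of `[r, r']` have the same sign if both `(r, m')` and `(m, r')` have met. -/
lemma sign_eq_of_Ω_pos_pair {j : ℕ} (hj : j ≤ H.J) {m m' r r' : ℕ} (hm : m ∈ H.A j)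
    (hm' : m' ∈ H.A j) (hmm : m ≤ m')
    (hr : r ∈ H.A j) (hr' : r' ∈ H.A j) (h₁ : r ≤ m) (hΩ₁ : 0 < H.Ω j r m')
    (hΩ₂ : 0 < H.Ω j m r') : ∀ q ∈ H.A j, r ≤ q → q ≤ r' → H.S q = H.S r := by
  intro q hq e₁ e₂
  have hmr := sign_eq_of_Ω_pos hj hr hm' hΩ₁ hm h₁ hmm
  rcases le_total q m with h | h
  · exact sign_eq_of_Ω_pos hj hr hm' hΩ₁ hq e₁ (h.trans hmm)
  · rw [← hmr]
    exact sign_eq_of_Ω_pos hj hm hr' hΩ₂ hq h e₂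

/-- Neighbours which are apart after the step were in different fronts before it, since waves of one
front arrive together. No pair across them has just met, so its Ω is unchanged. Equality of signs
rules out cancellations in the interval, so the averages run over the same waves. What changes is
the parameter, and the growth of the weight of `m` pays for it. -/
lemma farConvex_succ {j : ℕ} (hj : j < H.J) (h : H.FrontConvex j) : H.FarConvex (j + 1) := by
  intro m m' r r' hadj hX hr hr' h₁ h₂ hΩ₁ hΩ₂
  have hsub := H.A_succ_subset j hj
  have hm := hadj.left_mem
  have hm' := hadj.right_mem
  have hne : ∀ q ∈ H.A (j + 1), ∀ q' ∈ H.A (j + 1), q ≤ m → m' ≤ q' →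
      H.X (j + 1) q ≠ H.X (j + 1) q' := by
    intro q hq q' hq' e₁ e₂ hcon
    apply hX
    have f₁ := H.X_mono (j + 1) hj q hq m hm e₁
    have f₂ := H.X_mono (j + 1) hj m hm m' hm' hadj.lt.le
    have f₃ := H.X_mono (j + 1) hj m' hm' q' hq' e₂
    linarith
  have hΩ : ∀ q ∈ H.A (j + 1), ∀ q' ∈ H.A (j + 1), q ≤ m → m' ≤ q' →
      H.Ω (j + 1) q q' = H.Ω j q q' := fun q hq q' hq' e₁ e₂ =>
    Ω_succ_of_ne (hne q hq q' hq' e₁ e₂)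
  have hS := sign_eq_of_Ω_pos_pair hj.le (hsub hm) (hsub hm') hadj.lt.le (hsub hr) (hsub hr') h₁
    (by rwa [← hΩ r hr m' hm' h₁ le_rfl]) (by rwa [← hΩ m hm r' hr' le_rfl h₂])
  have hmem : ∀ q ∈ H.A j, r ≤ q → q ≤ r' → q ∈ H.A (j + 1) := fun q hq e₁ e₂ =>
    mem_succ_of_sign hj hr hr' hS hq e₁ e₂
  have hlt := hadj.lt
  -- No wave between `m` and `m'` was lost, so they were neighbours already before the step.
  have hadj' : Adjacent (H.A j) m m' := ⟨hsub hm, hsub hm', hadj.lt, fun q hq => by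
    by_contra hcon
    push Not at hcon
    have := hadj.out q (hmem q hq (by omega) (by omega))
    omega⟩
  have hseg : ∀ a b, r ≤ a → b ≤ r' → seg (H.A (j + 1)) a b = seg (H.A j) a b := by
    intro a b ha hb
    ext q
    simp only [mem_seg]
    exact ⟨fun ⟨e₁, e₂⟩ => ⟨hsub e₁, e₂⟩,
      fun ⟨e₁, e₂, e₃⟩ => ⟨hmem q e₁ (by omega) (by omega), e₂, e₃⟩⟩
  have key := h m m' r r' hadj' (by
    by_contra hcon
    push Not at hcon
    apply hX
    rw [H.X_succ j hj m hm, H.X_succ j hj m' hm', hcon.1, hcon.2]) (hsub hr) (hsub hr') h₁ h₂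
    (by rwa [← hΩ r hr m' hm' h₁ le_rfl]) (by rwa [← hΩ m hm r' hr' le_rfl h₂])
  have key' := key.change_param (u' := H.v (H.X (j + 1) m + H.t (j + 1)))
    (w' := H.W (j + 1) m) hj.le hadj' hS h₁ h₂ (by
      have := mul_le_mul_of_nonneg_left
        (H.abs_v_sub_le _ _ (H.y_mono j hj m hm)) H.D₃_nonneg
      rw [W, W]
      linarith)
  unfold AlmostConvexAt at key' ⊢
  rw [hseg r m le_rfl (by omega), hseg m' r' (by omega) le_rfl]
  refine key'.trans (le_of_eq ?_)
  congr 1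
  · refine Finset.sum_congr rfl fun q hq => ?_
    have := mem_seg.1 hq
    rw [hΩ q (hmem q this.1 this.2.1 (by omega)) m' hm' this.2.2 le_rfl]
  · refine Finset.sum_congr rfl fun q hq => ?_
    have := mem_seg.1 hq
    rw [hΩ m hm q (hmem q this.1 (by omega) this.2.2) le_rfl this.2.1]

lemma Ω_le_W_of_le {j : ℕ} (hj : j ≤ H.J) {q m : ℕ} (hq : q ∈ H.A j) (hm : m ∈ H.A j)
    (h : q ≤ m) (q' : ℕ) : H.Ω j q q' ≤ H.W j m :=
  (Ω_le_W hj hq q').trans (W_le_W (H.X_mono j hj q hq m hm h))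

lemma seg_eq_of_position {j : ℕ} (hj : j ≤ H.J) {a b : ℕ} {x : ℝ} (ha : a ∈ H.A j)
    (hb : b ∈ H.A j) (hXa : H.X j a = x) (hXb : H.X j b = x) :
    seg (H.A j) a b = ((H.A j).filter (H.X j · = x)).filter fun q => a ≤ q ∧ q ≤ b := by
  ext q
  simp only [mem_seg, Finset.mem_filter]
  constructor
  · rintro ⟨h1, h2, h3⟩
    refine ⟨⟨h1, ?_⟩, h2, h3⟩
    have e₁ := H.X_mono j hj a ha q h1 h2
    have e₂ := H.X_mono j hj q h1 b hb h3
    linarith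
  · rintro ⟨⟨h1, _⟩, h2, h3⟩
    exact ⟨h1, h2, h3⟩

/-- One-sided estimate on the left of a jump of the speed inside a group of waves. -/
lemma avg_left_le {j : ℕ} (hj : j ≤ H.J) (h : H.FarConvex j) {m m' r : ℕ}
    (hadj : Adjacent (H.A j) m m') (hX : H.X j m = H.X j m') (hσ : H.σ j m < H.σ j m')
    (hr : r ∈ H.A j) (h₁ : r ≤ m) (hΩ : 0 < H.Ω j r m') :
    avg (seg (H.A j) r m) (H.Λ (H.v (H.X j m + H.t j))) ≤
      H.σ j m + ∑ q ∈ seg (H.A j) r m, H.ε * (H.W j m - H.Ω j q m') := by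
  classical
  have hm := hadj.left_mem
  have hm' := hadj.right_mem
  have hlt := hadj.lt
  set x := H.X j m with hx
  set u := H.v (x + H.t j) with hu
  set B := (H.A j).filter (H.X j · = x) with hB
  have henv := H.env j hj x
  have hmB : m ∈ B := by simp [hB, hm, hx]
  have hm'B : m' ∈ B := by simp [hB, hm', hX]
  have hbr : ∀ q ∈ B, m < q → H.σ j m < H.σ j q := fun q hq hmq => by
    rcases hadj.out q (Finset.mem_filter.1 hq).1 with h1 | h1
    · omega
    · exact hσ.trans_le (henv.mono m' hm'B q hq h1)
  -- Inside the group the kink of the envelope between `m` and `m'` gives the bound with no penalty.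
  have hin : ∀ a ∈ H.A j, a ≤ m → H.X j a = x →
      avg (seg (H.A j) a m) (H.Λ u) ≤ H.σ j m := by
    intro a ha ham hXa
    have hpos : (0 : ℝ) < (seg (H.A j) a m).card := by
      exact_mod_cast (seg_nonempty ha ham).card_pos
    rw [avg, div_le_iff₀ hpos, seg_eq_of_position hj ha hm hXa rfl]
    exact henv.sum_le_of_break hbr hmB a
  have hpen : ∀ q ∈ seg (H.A j) r m, 0 ≤ H.ε * (H.W j m - H.Ω j q m') := fun q hq => by
    have hq1 := mem_seg.1 hq
    exact mul_nonneg H.ε_pos.le (sub_nonneg.2 (Ω_le_W_of_le hj hq1.1 hm hq1.2.2 _))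
  -- `a'` is the first wave of the group. If `r` lies before it, the group is extended to the left
  -- using almost convexity across `a'` and its left neighbour `a`.
  obtain ⟨a', ha', hmin⟩ := B.exists_min_image id ⟨m, hmB⟩
  simp only [id_eq] at hmin
  have ha'm := hmin m hmB
  obtain ⟨ha'A, hXa'⟩ := Finset.mem_filter.1 ha'
  rcases le_or_gt a' r with hra | hra
  · have hXr : H.X j r = x := by
      have e₁ := H.X_mono j hj a' ha'A r hr hra
      have e₂ := H.X_mono j hj r hr m hm h₁
      rw [hXa'] at e₁
      exact le_antisymm e₂ e₁
    have := hin r hr h₁ hXr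
    have := Finset.sum_nonneg hpen
    linarith
  · obtain ⟨a, hadj', hra'⟩ := exists_adjacent_left hr ha'A hra
    have ha := hadj'.left_mem
    have haa' := hadj'.lt
    have hXa : H.X j a ≠ H.X j a' := fun hcon => by
      have := hmin a (by simp [hB, ha, hcon, hXa'])
      omega
    have hΩ₁ : 0 < H.Ω j r a' := hΩ.trans_le (Ω_nest hj hr hr ha'A hm' le_rfl hra.le (by omega))
    have hΩ₂ : 0 < H.Ω j a m := hΩ.trans_le (Ω_nest hj hr ha hm hm' hra' (by omega) hlt.le)
    have key := h a a' r m hadj' hXa hr hm hra' ha'm hΩ₁ hΩ₂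
    have hS := sign_eq_of_Ω_pos_pair hj ha ha'A haa'.le hr hm hra' hΩ₁ hΩ₂
    -- `a` lies further left and refers to the value of `v` there. Moving to the parameter of the
    -- group raises the weight from that of `a` to that of `m`.
    have key' := key.change_param (u' := u) (w' := H.W j m) hj hadj' hS hra' ha'm (by
      have := mul_le_mul_of_nonneg_left (H.abs_v_sub_le (H.X j a + H.t j) (x + H.t j)
        (by have := H.X_mono j hj a ha m hm (by omega); linarith)) H.D₃_nonneg
      rw [W, W]
      linarith)
    have hun := hadj'.seg_union hra' ha'm
    -- Both kinds of penalty at the pair `(a, a')` are dominated by the penalties at `m'` of the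
    -- waves of `[r, a]`, because the pairs `(q, m')` enclose the pairs `(q, a')` and `(a, q')`.
    have e := avg_union_le (α := fun q => H.ε * (H.W j m - H.Ω j q m'))
      (seg_nonempty hr hra') (seg_nonempty ha'A ha'm)
      (hadj'.disjoint r m) key' (fun q hq => by
        have hq1 := mem_seg.1 hq
        refine mul_le_mul_of_nonneg_left (sub_le_sub_left ?_ _) H.ε_pos.le
        exact Ω_nest hj hq1.1 hq1.1 ha'A hm' le_rfl (by omega) (by omega)) (fun q hq q' hq' => by
        have hq1 := mem_seg.1 hq
        have hq1' := mem_seg.1 hq'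
        refine mul_le_mul_of_nonneg_left (sub_le_sub_left ?_ _) H.ε_pos.le
        exact Ω_nest hj hq1.1 ha hq1'.1 hm' (by omega) (by omega) (by omega))
    rw [hun] at e
    refine e.trans (add_le_add (hin a' ha'A ha'm hXa') ?_)
    refine Finset.sum_le_sum_of_subset_of_nonneg ?_ fun q hq _ => hpen q hq
    rw [← hun]
    exact Finset.subset_union_left

/-- One-sided estimate on the right of a jump of the speed inside a group of waves. -/
lemma le_avg_right {j : ℕ} (hj : j ≤ H.J) (h : H.FarConvex j) {m m' r : ℕ}
    (hadj : Adjacent (H.A j) m m') (hX : H.X j m = H.X j m') (hσ : H.σ j m < H.σ j m')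
    (hr : r ∈ H.A j) (h₁ : m' ≤ r) (hΩ : 0 < H.Ω j m r) :
    H.σ j m' - ∑ q ∈ seg (H.A j) m' r, H.ε * (H.W j m - H.Ω j m q) ≤
      avg (seg (H.A j) m' r) (H.Λ (H.v (H.X j m + H.t j))) := by
  classical
  have hm := hadj.left_mem
  have hm' := hadj.right_mem
  have hlt := hadj.lt
  set x := H.X j m with hx
  set u := H.v (x + H.t j) with hu
  set B := (H.A j).filter (H.X j · = x) with hB
  have henv := H.env j hj x
  have hmB : m ∈ B := by simp [hB, hm, hx]
  have hm'B : m' ∈ B := by simp [hB, hm', hX]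
  have hbr : ∀ q ∈ B, q < m' → H.σ j q < H.σ j m' := fun q hq hmq => by
    rcases hadj.out q (Finset.mem_filter.1 hq).1 with h1 | h1
    · exact (henv.mono q hq m hmB h1).trans_lt hσ
    · omega
  have hin : ∀ b ∈ H.A j, m' ≤ b → H.X j b = x →
      H.σ j m' ≤ avg (seg (H.A j) m' b) (H.Λ u) := by
    intro b hb hmb hXb
    have hpos : (0 : ℝ) < (seg (H.A j) m' b).card := by
      exact_mod_cast (seg_nonempty hm' hmb).card_pos
    rw [avg, le_div_iff₀ hpos, seg_eq_of_position hj hm' hb hX.symm hXb]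
    exact henv.le_sum_of_break hbr hm'B b
  have hpen : ∀ q ∈ seg (H.A j) m' r, 0 ≤ H.ε * (H.W j m - H.Ω j m q) := fun q _ =>
    mul_nonneg H.ε_pos.le (sub_nonneg.2 (Ω_le_W hj hm _))
  obtain ⟨b, hb, hmax⟩ := B.exists_max_image id ⟨m', hm'B⟩
  simp only [id_eq] at hmax
  have hmb := hmax m' hm'B
  obtain ⟨hbA, hXb⟩ := Finset.mem_filter.1 hb
  rcases le_or_gt r b with hrb | hrb
  · have hXr : H.X j r = x := by
      have e₁ := H.X_mono j hj m' hm' r hr h₁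
      have e₂ := H.X_mono j hj r hr b hbA hrb
      rw [hXb] at e₂
      rw [← hX] at e₁
      exact le_antisymm e₂ e₁
    have := hin r hr h₁ hXr
    have := Finset.sum_nonneg hpen
    linarith
  · obtain ⟨b', hadj', hrb'⟩ := exists_adjacent_right hr hbA hrb
    have hb' := hadj'.right_mem
    have hbb' := hadj'.lt
    have hXb' : H.X j b ≠ H.X j b' := fun hcon => by
      have := hmax b' (by simp [hB, hb', ← hcon, hXb])
      omega
    have hΩ₁ : 0 < H.Ω j m' b' := hΩ.trans_le (Ω_nest hj hm hm' hb' hr hlt.le (by omega) hrb')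
    have hΩ₂ : 0 < H.Ω j b r := hΩ.trans_le (Ω_nest hj hm hbA hr hr (by omega) hrb.le le_rfl)
    have key := h b b' m' r hadj' hXb' hm' hr hmb hrb' hΩ₁ hΩ₂
    -- On this side the left neighbour `b` belongs to the group, so parameter and weight are already
    -- those of `m` and no change of parameter is needed.
    rw [hXb, W_congr (hXb.trans hx)] at key
    -- Passing to the negative slopes exchanges the two sides, so that `avg_union_le` adds the outer
    -- interval to the right of the group.
    have key' : avg (seg (H.A j) b' r) (fun q => - H.Λ u q) -
        avg (seg (H.A j) m' b) (fun q => - H.Λ u q) ≤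
        ∑ q ∈ seg (H.A j) b' r, H.ε * (H.W j m - H.Ω j b q) +
          ∑ q ∈ seg (H.A j) m' b, H.ε * (H.W j m - H.Ω j q b') := by
      unfold AlmostConvexAt at key
      rw [avg_neg, avg_neg]
      linarith
    have hun := hadj'.seg_union hmb hrb'
    have e := avg_union_le (α := fun q => H.ε * (H.W j m - H.Ω j m q))
      (seg_nonempty hb' hrb') (seg_nonempty hm' hmb)
      (hadj'.disjoint m' r).symm key' (fun q hq => by
        have hq1 := mem_seg.1 hq
        refine mul_le_mul_of_nonneg_left (sub_le_sub_left ?_ _) H.ε_pos.le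
        exact Ω_nest hj hm hbA hq1.1 hq1.1 (by omega) (by omega) le_rfl) (fun q hq q' hq' => by
        have hq1 := mem_seg.1 hq
        have hq1' := mem_seg.1 hq'
        refine mul_le_mul_of_nonneg_left (sub_le_sub_left ?_ _) H.ε_pos.le
        exact Ω_nest hj hm hq1'.1 hb' hq1.1 (by omega) (by omega) (by omega))
    rw [Finset.union_comm, hun, avg_neg, avg_neg] at e
    have e₂ := hin b hbA hmb hXb
    have e₃ : ∑ q ∈ seg (H.A j) b' r, H.ε * (H.W j m - H.Ω j m q) ≤
        ∑ q ∈ seg (H.A j) m' r, H.ε * (H.W j m - H.Ω j m q) := by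
      refine Finset.sum_le_sum_of_subset_of_nonneg ?_ fun q hq _ => hpen q hq
      rw [← hun]
      exact Finset.subset_union_right
    linarith

/-- The new pairs are those at one position with a jump of the speed. There the left average is at
most `σ j m` and the right one at least `σ j m'`, up to penalties, and the speeds are ordered. -/
lemma frontConvex_of_farConvex {j : ℕ} (hj : j ≤ H.J) (h : H.FarConvex j) : H.FrontConvex j := by
  intro m m' r r' hadj hne hr hr' h₁ h₂ hΩ₁ hΩ₂
  by_cases hX : H.X j m = H.X j m'
  swap
  · exact h m m' r r' hadj hX hr hr' h₁ h₂ hΩ₁ hΩ₂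
  have hσ : H.σ j m < H.σ j m' := by
    refine lt_of_le_of_ne ?_ (hne.resolve_left (not_not.2 hX))
    exact (H.env j hj (H.X j m)).mono m (by simp [hadj.left_mem]) m'
      (by simp [hadj.right_mem, hX]) hadj.lt.le
  have e₁ := avg_left_le hj h hadj hX hσ hr h₁ hΩ₁
  have e₂ := le_avg_right hj h hadj hX hσ hr' h₂ hΩ₂
  unfold AlmostConvexAt
  linarith

theorem frontConvex {j : ℕ} (hj : j ≤ H.J) : H.FrontConvex j := by
  induction j with
  | zero => exact frontConvex_of_farConvex hj farConvex_zero
  | succ j ih => exact frontConvex_of_farConvex hj (farConvex_succ hj (ih (by omega)))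

/-- Almost convexity over all the intervals of waves with the same sign. -/
theorem almostConvexAt {j : ℕ} (hj : j ≤ H.J) {m m' r r' : ℕ} (hadj : Adjacent (H.A j) m m')
    (hne : H.X j m ≠ H.X j m' ∨ H.σ j m ≠ H.σ j m') (hr : r ∈ H.A j) (hr' : r' ∈ H.A j)
    (h₁ : r ≤ m) (h₂ : m' ≤ r') (hS : ∀ q ∈ H.A j, r ≤ q → q ≤ r' → H.S q = H.S r) :
    H.AlmostConvexAt j m m' r r' (H.v (H.X j m + H.t j)) (H.W j m) := by
  classical
  have hm := hadj.left_mem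
  have hm' := hadj.right_mem
  have hlt := hadj.lt
  set u := H.v (H.X j m + H.t j) with hu
  -- The Lipschitz bound alone costs `ε * D₂` per wave. This suffices wherever Ω vanishes, since the
  -- full weight is at least `D₂`.
  have hD : ∀ (I₁ I₂ : Finset ℕ) (a b : ℕ), I₁ ∪ I₂ = seg (H.A j) a b → Disjoint I₁ I₂ →
      I₁.Nonempty → I₂.Nonempty → a ∈ H.A j → r ≤ a → a ≤ r' → b ≤ r' →
      avg I₁ (H.Λ u) - avg I₂ (H.Λ u) ≤
        ∑ _q ∈ I₁, H.ε * H.D₂ + ∑ _q ∈ I₂, H.ε * H.D₂ := by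
    intro I₁ I₂ a b hun hdisj hn₁ hn₂ haA hra har hb
    have hS' : ∀ q ∈ H.A j, a ≤ q → q ≤ b → H.S q = H.S a := fun q hq e₁ e₂ => by
      rw [hS q hq (by omega) (by omega), hS a haA (by omega) (by omega)]
    have := avg_slope_sub_le hj hS' (I₁ := I₁) (I₂ := I₂) (hun ▸ Finset.subset_union_left)
      (hun ▸ Finset.subset_union_right) hn₁ hn₂ u
    rw [← hun, Finset.card_union_of_disjoint hdisj] at this
    simp only [Finset.sum_const, nsmul_eq_mul]
    push_cast at this
    linarith
  have hpen : ∀ o : ℝ, o = 0 → H.ε * H.D₂ ≤ H.ε * (H.W j m - o) := fun o ho => by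
    rw [ho, sub_zero]
    exact mul_le_mul_of_nonneg_left (D₂_le_W _ _) H.ε_pos.le
  have hzero : ∀ q q' : ℕ, ¬ 0 < H.Ω j q q' → H.Ω j q q' = 0 := fun q q' h =>
    le_antisymm (not_lt.1 h) (Ω_nonneg _ _ _)
  by_cases hΩ : 0 < H.Ω j m m'
  swap
  -- If the neighbours have never met, by nesting no pair across them has.
  · have hΩ0 : ∀ q ∈ H.A j, ∀ q' ∈ H.A j, q ≤ m → m' ≤ q' → H.Ω j q q' = 0 :=
      fun q hq q' hq' e₁ e₂ => le_antisymm
        ((Ω_nest hj hq hm hm' hq' e₁ hlt.le e₂).trans (not_lt.1 hΩ)) (Ω_nonneg _ _ _)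
    refine (hD _ _ r r' (hadj.seg_union h₁ h₂) (hadj.disjoint r r') (seg_nonempty hr h₁)
      (seg_nonempty hm' h₂) hr le_rfl (by omega) le_rfl).trans (add_le_add ?_ ?_)
    · exact Finset.sum_le_sum fun q hq =>
        hpen _ (hΩ0 q (mem_seg.1 hq).1 m' hm' (mem_seg.1 hq).2.2 le_rfl)
    · exact Finset.sum_le_sum fun q hq =>
        hpen _ (hΩ0 m hm q (mem_seg.1 hq).1 le_rfl (mem_seg.1 hq).2.1)
  -- `[r₀, r₁]` is bounded by the outermost waves which have met `m'`, respectively `m`.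
  -- `frontConvex` applies there, and the waves outside are added by the Lipschitz bound.
  obtain ⟨r₀, hr₀, hmin⟩ := ((seg (H.A j) r m).filter (fun q => 0 < H.Ω j q m')).exists_min_image
    id ⟨m, Finset.mem_filter.2 ⟨mem_seg.2 ⟨hm, h₁, le_rfl⟩, hΩ⟩⟩
  obtain ⟨r₁, hr₁, hmax⟩ := ((seg (H.A j) m' r').filter (fun q => 0 < H.Ω j m q)).exists_max_image
    id ⟨m', Finset.mem_filter.2 ⟨mem_seg.2 ⟨hm', le_rfl, h₂⟩, hΩ⟩⟩
  simp only [Finset.mem_filter, mem_seg, id_eq, and_imp] at hr₀ hmin hr₁ hmax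
  obtain ⟨⟨hr₀A, hrr₀, hr₀m⟩, hΩ₀⟩ := hr₀
  obtain ⟨⟨hr₁A, hmr₁, hrr₁⟩, hΩ₁⟩ := hr₁
  have key := frontConvex hj m m' r₀ r₁ hadj hne hr₀A hr₁A hr₀m hmr₁ hΩ₀ hΩ₁
  have hleft : avg (seg (H.A j) r m) (H.Λ u) -
      ∑ q ∈ seg (H.A j) r m, H.ε * (H.W j m - H.Ω j q m') ≤ avg (seg (H.A j) r₀ m) (H.Λ u) -
      ∑ q ∈ seg (H.A j) r₀ m, H.ε * (H.W j m - H.Ω j q m') := by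
    rcases hrr₀.eq_or_lt with rfl | hlt₀
    · exact le_rfl
    obtain ⟨a, hadj', hra⟩ := exists_adjacent_left hr hr₀A hlt₀
    have ha := hadj'.lt
    have hun := hadj'.seg_union hra hr₀m
    have hΩ0 : ∀ q ∈ seg (H.A j) r a, H.Ω j q m' = 0 := fun q hq => by
      have hq1 := mem_seg.1 hq
      refine hzero q m' fun hpos => ?_
      have := hmin q hq1.1 hq1.2.1 (by omega) hpos
      omega
    have e := avg_union_le (α := fun q => H.ε * (H.W j m - H.Ω j q m'))
      (seg_nonempty hr hra) (seg_nonempty hr₀A hr₀m) (hadj'.disjoint r m)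
      (hD _ _ r m hun (hadj'.disjoint r m) (seg_nonempty hr hra) (seg_nonempty hr₀A hr₀m) hr
        le_rfl (by omega) (by omega))
      (fun q hq => hpen _ (hΩ0 q hq)) (fun q hq _ _ => hpen _ (hΩ0 q hq))
    rw [← hun, Finset.sum_union (hadj'.disjoint r m)]
    linarith
  have hright : avg (seg (H.A j) m' r₁) (H.Λ u) +
      ∑ q ∈ seg (H.A j) m' r₁, H.ε * (H.W j m - H.Ω j m q) ≤ avg (seg (H.A j) m' r') (H.Λ u) +
      ∑ q ∈ seg (H.A j) m' r', H.ε * (H.W j m - H.Ω j m q) := by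
    rcases hrr₁.eq_or_lt with rfl | hlt₁
    · exact le_rfl
    obtain ⟨b, hadj', hbr⟩ := exists_adjacent_right hr' hr₁A hlt₁
    have hb := hadj'.lt
    have hbA := hadj'.right_mem
    have hun := hadj'.seg_union hmr₁ hbr
    have hΩ0 : ∀ q ∈ seg (H.A j) b r', H.Ω j m q = 0 := fun q hq => by
      have hq1 := mem_seg.1 hq
      refine hzero m q fun hpos => ?_
      have := hmax q hq1.1 (by omega) hq1.2.2 hpos
      omega
    have hD' := hD _ _ m' r' hun (hadj'.disjoint m' r') (seg_nonempty hm' hmr₁)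
      (seg_nonempty hbA hbr) hm' (by omega) (by omega) le_rfl
    have e := avg_union_le (α := fun q => H.ε * (H.W j m - H.Ω j m q))
      (g := fun q => - H.Λ u q) (β := fun _ => H.ε * H.D₂) (γ := fun _ => H.ε * H.D₂)
      (seg_nonempty hbA hbr) (seg_nonempty hm' hmr₁) (hadj'.disjoint m' r').symm
      (by rw [avg_neg, avg_neg]; linarith)
      (fun q hq => hpen _ (hΩ0 q hq)) (fun q hq _ _ => hpen _ (hΩ0 q hq))
    rw [Finset.union_comm, hun, avg_neg, avg_neg] at e
    rw [← Finset.sum_union (hadj'.disjoint m' r') |>.symm.trans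
      (congrArg (fun I => ∑ q ∈ I, H.ε * (H.W j m - H.Ω j m q)) hun)]
    linarith
  unfold AlmostConvexAt at key ⊢
  linarith

end WaveHistory

/-! ### Change of the speeds in one collision, and summation over the collisions. -/

namespace WaveHistory

variable {H : WaveHistory}

variable (H) in
/-- The waves in the front of `s` at the time `t j`. -/
def front (j s : ℕ) : Finset ℕ :=
  ((H.A j).filter (H.X j · = H.X j s)).filter (H.σ j · = H.σ j s)

lemma mem_front {j s q : ℕ} :
    q ∈ H.front j s ↔ q ∈ H.A j ∧ H.X j q = H.X j s ∧ H.σ j q = H.σ j s := by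
  simp [front, and_assoc]

lemma isFlat_front {j : ℕ} (hj : j ≤ H.J) (s : ℕ) :
    IsFlat (H.front j s) (H.Λ (H.v (H.X j s + H.t j))) (H.σ j s) :=
  (H.env j hj (H.X j s)).isFlat (H.σ j s)

/-- The waves arriving together are exactly the old front of `s`, on which the flux had a flat
envelope. Only the parameter changes, so this is a perturbation of a flat envelope. -/
lemma abs_sub_le_of_singleAt {j : ℕ} (hj : j < H.J) {s : ℕ} (hs : s ∈ H.A (j + 1))
    (h : SingleAt (H.A j) (H.A (j + 1)) (H.X j) (H.σ j) (fun s => H.X j s + H.σ j s * H.Δ j)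
      (H.X (j + 1) s)) :
    |H.σ (j + 1) s - H.σ j s| ≤
      H.Dv * (H.V (H.X (j + 1) s + H.t (j + 1)) - H.V (H.X j s + H.t j)) := by
  have hsub := H.A_succ_subset j hj
  have hB : (H.A (j + 1)).filter (H.X (j + 1) · = H.X (j + 1) s) = H.front j s := by
    ext q
    rw [mem_front, Finset.mem_filter]
    constructor
    · rintro ⟨h1, h2⟩
      rw [H.X_succ j hj q h1] at h2
      exact ⟨hsub h1, h.2 q (hsub h1) s (hsub hs) h2 (H.X_succ j hj s hs).symm⟩
    · rintro ⟨h1, h2, h3⟩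
      have h4 : H.X j q + H.σ j q * H.Δ j = H.X (j + 1) s := by
        rw [H.X_succ j hj s hs, h2, h3]
      have h5 := h.1 q h1 h4
      exact ⟨h5, by rw [H.X_succ j hj q h5, h4]⟩
  have henv := H.env (j + 1) hj (H.X (j + 1) s)
  rw [hB] at henv
  refine (henv.abs_sub_le_of_isFlat (isFlat_front hj.le s)
    (d := H.Dv * |H.v (H.X (j + 1) s + H.t (j + 1)) - H.v (H.X j s + H.t j)|)
    (fun q _ => H.slope_param _ _ _) (mem_front.2 ⟨hsub hs, rfl, rfl⟩)).trans ?_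
  exact mul_le_mul_of_nonneg_left (H.abs_v_sub_le _ _ (H.y_mono j hj s hs)) H.Dv_nonneg

/-- The survivors are an initial or final segment of a flat front under the same flux, because
constant variation forces `v` to be unchanged. The number of waves removed from that front is at
most the total number cancelled. -/
lemma sum_abs_sub_le_of_cancelAt {j : ℕ} (hj : j < H.J) {x : ℝ}
    (h : CancelAt (H.A j) (H.A (j + 1)) (H.X j) (H.σ j) (fun s => H.X j s + H.σ j s * H.Δ j)
      (fun s => H.V (H.X j s + H.t j))
      (fun s => H.V (H.X j s + H.σ j s * H.Δ j + H.t (j + 1))) x) :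
    ∑ s ∈ H.A (j + 1) with H.X (j + 1) s = x, |H.σ (j + 1) s - H.σ j s| ≤
      ((H.A j).card - (H.A (j + 1)).card) * (H.D₂ * (H.ε * (H.A 0).card)) := by
  classical
  have hsub := H.A_succ_subset j hj
  obtain ⟨hV, sF, hsF, hF, hseg⟩ := h
  set B := (H.A (j + 1)).filter (H.X (j + 1) · = x) with hB
  have hmemB : ∀ q, q ∈ B ↔ q ∈ H.A (j + 1) ∧ H.X j q + H.σ j q * H.Δ j = x := fun q => by
    rw [hB, Finset.mem_filter]
    exact and_congr_right fun hq => by rw [H.X_succ j hj q hq]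
  have hcardA : ((H.A (j + 1)).card : ℝ) ≤ (H.A j).card := by
    exact_mod_cast Finset.card_le_card hsub
  rcases B.eq_empty_or_nonempty with hemp | ⟨s₀, hs₀⟩
  · rw [hemp, Finset.sum_empty]
    exact mul_nonneg (sub_nonneg.2 hcardA)
      (mul_nonneg H.D₂_nonneg (mul_nonneg H.ε_pos.le (Nat.cast_nonneg _)))
  have hBF : B ⊆ H.front j sF := fun q hq => by
    obtain ⟨h1, h2⟩ := (hmemB q).1 hq
    exact mem_front.2 ⟨hsub h1, hF q h1 h2⟩
  obtain ⟨hs₀A, hs₀x⟩ := (hmemB s₀).1 hs₀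
  obtain ⟨hXs₀, hσs₀⟩ := hF s₀ hs₀A hs₀x
  have hFx : ∀ q ∈ H.front j sF, H.X j q + H.σ j q * H.Δ j = x := fun q hq => by
    obtain ⟨-, h2, h3⟩ := mem_front.1 hq
    rw [h2, h3, ← hXs₀, ← hσs₀, hs₀x]
  -- Here the variation of `v` is used to identify values: equal variations along a wave mean equal
  -- values of `v`.
  have hv : H.v (x + H.t (j + 1)) = H.v (H.X j sF + H.t j) := by
    have h1 := H.abs_v_sub_le _ _ (H.y_mono j hj s₀ hs₀A)
    have h2 := hV s₀ hs₀A hs₀x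
    simp only at h2
    rw [H.X_succ j hj s₀ hs₀A, ← h2, sub_self] at h1
    rw [hs₀x, hXs₀] at h1
    exact sub_eq_zero.1 (abs_nonpos_iff.1 h1)
  have henv := H.env (j + 1) hj x
  rw [← hB, hv] at henv
  have key := henv.sum_abs_sub_le_of_segment (isFlat_front hj.le sF) hBF
    (d := H.D₂ * (H.ε * (H.A 0).card)) (fun q hq q' hq' => by
      obtain ⟨h1, h2, h3⟩ := mem_front.1 hq
      obtain ⟨h1', h2', h3'⟩ := mem_front.1 hq'
      refine (H.slope_lip _ q q' (H.same_sign j hj.le q h1 q' h1' (h2.trans h2'.symm))).trans ?_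
      refine mul_le_mul_of_nonneg_left ?_ H.D₂_nonneg
      refine (abs_R_sub_le hj.le (r := 0) (r' := max q q') (mem_seg.2 ⟨h1, by omega, by omega⟩)
        (mem_seg.2 ⟨h1', by omega, by omega⟩)).trans ?_
      refine mul_le_mul_of_nonneg_left ?_ H.ε_pos.le
      exact_mod_cast Finset.card_le_card
        ((Finset.filter_subset _ _).trans (A_subset_zero hj.le))) (by
      rcases hseg with hseg | hseg
      · refine Or.inl fun q hq q' hq' hle => ?_
        obtain ⟨h1, h2, h3⟩ := mem_front.1 hq
        obtain ⟨h1', h2'⟩ := (hmemB q').1 hq'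
        exact (hmemB q).2 ⟨hseg q h1 q' h1' h2 h3 h2' hle, hFx q hq⟩
      · refine Or.inr fun q hq q' hq' hle => ?_
        obtain ⟨h1, h2, h3⟩ := mem_front.1 hq
        obtain ⟨h1', h2'⟩ := (hmemB q').1 hq'
        exact (hmemB q).2 ⟨hseg q h1 q' h1' h2 h3 h2' hle, hFx q hq⟩)
  rw [Finset.sum_congr rfl fun q hq => by rw [(mem_front.1 (hBF hq)).2.2]]
  refine key.trans (mul_le_mul_of_nonneg_right ?_
    (mul_nonneg H.D₂_nonneg (mul_nonneg H.ε_pos.le (Nat.cast_nonneg _))))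
  have h1 : H.front j sF \ B ⊆ H.A j \ H.A (j + 1) := fun q hq => by
    rw [Finset.mem_sdiff] at hq ⊢
    exact ⟨(mem_front.1 hq.1).1, fun hcon => hq.2 ((hmemB q).2 ⟨hcon, hFx q hq.1⟩)⟩
  have h2 := Finset.card_le_card h1
  have h3 := Finset.card_sdiff_add_card_eq_card hsub
  rw [← h3]
  push_cast
  rw [add_sub_cancel_right]
  exact_mod_cast h2

/-- The two speeds are averages of the current slopes over the two fronts, so `almostConvexAt`
bounds their gap. All pairs of `L × R` meet now, so each Ω jumps up to the current weight, and this
increase pays for the change of speed. -/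
lemma sum_abs_sub_le_of_mergeAt {j : ℕ} (hj : j < H.J) {x : ℝ}
    (h : MergeAt (H.A j) (H.A (j + 1)) (H.X j) (H.σ j) (fun s => H.X j s + H.σ j s * H.Δ j)
      (fun s => H.V (H.X j s + H.t j))
      (fun s => H.V (H.X j s + H.σ j s * H.Δ j + H.t (j + 1))) x) :
    ∑ s ∈ H.A (j + 1) with H.X (j + 1) s = x, |H.σ (j + 1) s - H.σ j s| ≤
      2 * (H.ε * ∑ q ∈ H.A 0, ∑ q' ∈ H.A 0, (H.Ω (j + 1) q q' - H.Ω j q q')) := by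
  classical
  have hsub := H.A_succ_subset j hj
  obtain ⟨hA, hV, sL, hsL, sR, hsR, hpL, hpR, hXLR, hLR⟩ := h
  simp only at hA hV hpL hpR hLR
  set B := (H.A (j + 1)).filter (H.X (j + 1) · = x) with hB
  have hmemB : ∀ q, q ∈ B ↔ q ∈ H.A j ∧ H.X j q + H.σ j q * H.Δ j = x := fun q => by
    rw [hB, Finset.mem_filter]
    constructor
    · rintro ⟨h1, h2⟩
      exact ⟨hsub h1, by rw [← H.X_succ j hj q h1, h2]⟩
    · rintro ⟨h1, h2⟩
      exact ⟨hA q h1 h2, by rw [H.X_succ j hj q (hA q h1 h2), h2]⟩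
  set L := H.front j sL with hLdef
  set R := H.front j sR with hRdef
  have hunion : B = L ∪ R := by
    ext q
    rw [hmemB, Finset.mem_union, mem_front, mem_front]
    constructor
    · rintro ⟨h1, h2⟩
      rcases hLR q h1 h2 with h3 | h3
      · exact Or.inl ⟨h1, h3⟩
      · exact Or.inr ⟨h1, h3⟩
    · rintro (⟨h1, h2, h3⟩ | ⟨h1, h2, h3⟩)
      · exact ⟨h1, by rw [h2, h3, hpL]⟩
      · exact ⟨h1, by rw [h2, h3, hpR]⟩
  have hlt : ∀ q ∈ L, ∀ q' ∈ R, q < q' := fun q hq q' hq' => by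
    obtain ⟨h1, h2, -⟩ := mem_front.1 hq
    obtain ⟨h1', h2', -⟩ := mem_front.1 hq'
    by_contra hcon
    have := H.X_mono j hj.le q' h1' q h1 (not_lt.1 hcon)
    linarith
  have hσ : H.σ j sR < H.σ j sL := by
    have := H.Δ_pos j hj
    by_contra hcon
    nlinarith [not_lt.1 hcon]
  have hBA : ∀ q ∈ B, q ∈ H.A (j + 1) ∧ H.X (j + 1) q = x := fun q hq => Finset.mem_filter.1 hq
  have hv : ∀ q ∈ B, H.v (H.X j q + H.t j) = H.v (x + H.t (j + 1)) := fun q hq => by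
    obtain ⟨h0, h0'⟩ := (hmemB q).1 hq
    have h1 := H.abs_v_sub_le _ _ (H.y_mono j hj q (hBA q hq).1)
    have h2 := hV q h0 h0'
    rw [h0'] at h2
    rw [(hBA q hq).2, ← h2, sub_self] at h1
    exact (sub_eq_zero.1 (abs_nonpos_iff.1 h1)).symm
  have hsLL : sL ∈ L := mem_front.2 ⟨hsL, rfl, rfl⟩
  have hsRR : sR ∈ R := mem_front.2 ⟨hsR, rfl, rfl⟩
  have hLB : L ⊆ B := hunion ▸ Finset.subset_union_left
  have hRB : R ⊆ B := hunion ▸ Finset.subset_union_right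
  have henv := H.env (j + 1) hj x
  rw [← hB, hunion] at henv
  set ℓ := H.Λ (H.v (x + H.t (j + 1))) with hℓ
  have hfL : IsFlat L ℓ (H.σ j sL) := by
    rw [hℓ, ← hv sL (hLB hsLL)]; exact isFlat_front hj.le sL
  have hfR : IsFlat R ℓ (H.σ j sR) := by
    rw [hℓ, ← hv sR (hRB hsRR)]; exact isFlat_front hj.le sR
  have cost := henv.sum_abs_sub_le_of_merge hfL hfR hlt hσ.le ⟨sL, hsLL⟩
  have hdisj : Disjoint L R := by
    rw [Finset.disjoint_left]
    intro q h1 h2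
    exact lt_irrefl q (hlt q h1 q h2)
  obtain ⟨m, hm, hmmax⟩ := L.exists_max_image id ⟨sL, hsLL⟩
  obtain ⟨r, hr, hrmin⟩ := L.exists_min_image id ⟨sL, hsLL⟩
  obtain ⟨m', hm', hmmin⟩ := R.exists_min_image id ⟨sR, hsRR⟩
  obtain ⟨r', hr', hrmax⟩ := R.exists_max_image id ⟨sR, hsRR⟩
  simp only [id_eq] at hmmax hrmin hmmin hrmax
  have hmA := (mem_front.1 hm).1
  have hmA' := (mem_front.1 hm').1
  have hrA := (mem_front.1 hr).1
  have hrA' := (mem_front.1 hr').1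
  have hmm := hlt m hm m' hm'
  have hbetween : ∀ q ∈ H.A j, r ≤ q → q ≤ r' → q ∈ B := fun q hq h1 h2 => by
    have e₁ := H.arrival_mono j hj r hrA q hq h1
    have e₂ := H.arrival_mono j hj q hq r' hrA' h2
    rw [((hmemB r).1 (hLB hr)).2] at e₁
    rw [((hmemB r').1 (hRB hr')).2] at e₂
    exact (hmemB q).2 ⟨hq, le_antisymm e₂ e₁⟩
  have hrm := hrmin m hm
  have hmr := hrmax m' hm'
  have hadj : Adjacent (H.A j) m m' := ⟨hmA, hmA', hmm, fun q hq => by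
    by_contra hcon
    push Not at hcon
    have hqB := hbetween q hq (by omega) (by omega)
    rw [hunion, Finset.mem_union] at hqB
    rcases hqB with h1 | h1
    · have := hmmax q h1; omega
    · have := hmmin q h1; omega⟩
  have hsegL : seg (H.A j) r m = L := by
    ext q
    rw [mem_seg]
    constructor
    · rintro ⟨h1, h2, h3⟩
      have hqB := hbetween q h1 h2 (by omega)
      rw [hunion, Finset.mem_union] at hqB
      refine hqB.resolve_right fun h4 => ?_
      have := hmmin q h4; omega
    · intro h1
      exact ⟨(mem_front.1 h1).1, hrmin q h1, hmmax q h1⟩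
  have hsegR : seg (H.A j) m' r' = R := by
    ext q
    rw [mem_seg]
    constructor
    · rintro ⟨h1, h2, h3⟩
      have hqB := hbetween q h1 (by omega) h3
      rw [hunion, Finset.mem_union] at hqB
      refine hqB.resolve_left fun h4 => ?_
      have := hmmax q h4; omega
    · intro h1
      exact ⟨(mem_front.1 h1).1, hmmin q h1, hrmax q h1⟩
  have hne : H.X j m ≠ H.X j m' := by
    rw [(mem_front.1 hm).2.1, (mem_front.1 hm').2.1]
    exact hXLR.ne
  have hconv := almostConvexAt hj.le hadj (Or.inl hne) hrA hrA' hrm hmr (fun q hq h1 h2 => by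
    have e₁ := hBA q (hbetween q hq h1 h2)
    have e₂ := hBA r (hLB hr)
    exact H.same_sign (j + 1) hj q e₁.1 r e₂.1 (by rw [e₁.2, e₂.2]))
  unfold AlmostConvexAt at hconv
  rw [hsegL, hsegR, hv m (hLB hm), ← hℓ] at hconv
  have hl : (0 : ℝ) < L.card := by exact_mod_cast Finset.card_pos.2 ⟨sL, hsLL⟩
  have hrr : (0 : ℝ) < R.card := by exact_mod_cast Finset.card_pos.2 ⟨sR, hsRR⟩
  have havL : avg L ℓ = H.σ j sL := by rw [avg, hfL.total]; field_simp
  have havR : avg R ℓ = H.σ j sR := by rw [avg, hfR.total]; field_simp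
  rw [havL, havR] at hconv
  have hWm : ∀ q ∈ B, H.W (j + 1) q = H.W j m := fun q hq => by
    rw [W, W, (hBA q hq).2]
    have h0 := (hmemB m).1 (hLB hm)
    rw [hV m h0.1 h0.2, h0.2]
  have hΩ : ∀ q ∈ B, ∀ q' ∈ B, H.Ω (j + 1) q q' = H.W j m := fun q hq q' hq' => by
    rw [Ω_together (hBA q hq).1 (hBA q' hq').1 (by rw [(hBA q hq).2, (hBA q' hq').2]), hWm q hq]
  set C := ∑ q ∈ L, ∑ q' ∈ R, (H.Ω (j + 1) q q' - H.Ω j q q') with hC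
  -- By nesting, every pair `(q, q')` gains at least as much as `(q, m')`, so one penalty is counted
  -- once for each wave of the other front. This produces the factors which cancel `L.card * R.card
  -- / (L.card + R.card)`.
  have hC1 : (R.card : ℝ) * ∑ q ∈ L, (H.W j m - H.Ω j q m') ≤ C := by
    rw [Finset.mul_sum, hC]
    refine Finset.sum_le_sum fun q hq => ?_
    rw [← nsmul_eq_mul]
    refine Finset.card_nsmul_le_sum _ _ _ fun q' hq' => ?_
    rw [hΩ q (hLB hq) q' (hRB hq')]
    have := hlt q hq m' hm'
    exact sub_le_sub_left (Ω_nest hj.le (mem_front.1 hq).1 (mem_front.1 hq).1 hmA'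
      (mem_front.1 hq').1 le_rfl this.le (hmmin q' hq')) _
  have hC2 : (L.card : ℝ) * ∑ q ∈ R, (H.W j m - H.Ω j m q) ≤ C := by
    rw [hC, Finset.sum_comm, Finset.mul_sum]
    refine Finset.sum_le_sum fun q' hq' => ?_
    rw [← nsmul_eq_mul]
    refine Finset.card_nsmul_le_sum _ _ _ fun q hq => ?_
    rw [hΩ q (hLB hq) q' (hRB hq')]
    have := hlt m hm q' hq'
    exact sub_le_sub_left (Ω_nest hj.le (mem_front.1 hq).1 hmA (mem_front.1 hq').1
      (mem_front.1 hq').1 (hmmax q hq) this.le le_rfl) _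
  rw [← Finset.mul_sum, ← Finset.mul_sum, ← mul_add] at hconv
  have hcostC : (L.card * R.card * (H.σ j sL - H.σ j sR) / (L.card + R.card) : ℝ) ≤ H.ε * C := by
    rw [div_le_iff₀ (by positivity)]
    have h1 := mul_le_mul_of_nonneg_left hconv (mul_pos hl hrr).le
    have h2 := mul_le_mul_of_nonneg_left hC1 (mul_pos H.ε_pos hl).le
    have h3 := mul_le_mul_of_nonneg_left hC2 (mul_pos H.ε_pos hrr).le
    linarith
  have hCle : C ≤ ∑ q ∈ H.A 0, ∑ q' ∈ H.A 0, (H.Ω (j + 1) q q' - H.Ω j q q') := by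
    have hpos : ∀ q q', 0 ≤ H.Ω (j + 1) q q' - H.Ω j q q' := fun q q' =>
      sub_nonneg.2 (Ω_le_succ hj q q')
    have hL0 : L ⊆ H.A 0 := fun q hq => A_subset_zero hj.le (mem_front.1 hq).1
    have hR0 : R ⊆ H.A 0 := fun q hq => A_subset_zero hj.le (mem_front.1 hq).1
    refine (Finset.sum_le_sum fun q _ => Finset.sum_le_sum_of_subset_of_nonneg hR0
      fun q' _ _ => hpos q q').trans ?_
    exact Finset.sum_le_sum_of_subset_of_nonneg hL0
      fun q _ _ => Finset.sum_nonneg fun q' _ => hpos q q'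
  rw [hunion, Finset.sum_union hdisj,
    Finset.sum_congr rfl (fun q (hq : q ∈ L) => by rw [(mem_front.1 hq).2.2]),
    Finset.sum_congr rfl (fun q (hq : q ∈ R) => by rw [(mem_front.1 hq).2.2])]
  refine cost.trans ?_
  have := mul_le_mul_of_nonneg_left hCle H.ε_pos.le
  linarith

variable (H) in
open Classical in
/-- The variation of `v` seen by the wave `s` up to the time `t j` (or up to its cancellation). -/
def seen : ℕ → ℕ → ℝ
  | 0, s => H.V (H.X 0 s + H.t 0)
  | j + 1, s => if s ∈ H.A (j + 1) then H.V (H.X (j + 1) s + H.t (j + 1)) else seen j s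

lemma seen_of_mem {j s : ℕ} (hs : s ∈ H.A j) : H.seen j s = H.V (H.X j s + H.t j) := by
  cases j with
  | zero => rfl
  | succ j => rw [seen, if_pos hs]

lemma seen_le (j s : ℕ) : H.seen j s ≤ H.T := by
  induction j with
  | zero => exact H.V_le _
  | succ j ih => rw [seen]; split_ifs; exacts [H.V_le _, ih]

lemma seen_le_succ {j : ℕ} (hj : j < H.J) (s : ℕ) : H.seen j s ≤ H.seen (j + 1) s := by
  rw [seen]
  split_ifs with h
  · rw [seen_of_mem (H.A_succ_subset j hj h)]
    exact V_mono (H.y_mono j hj s h)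
  · exact le_rfl

/-- Away from the special point every arrival is a single front and is paid by the variation of `v`
newly seen. At the special point one of the three bounds applies; the terms not needed are
nonnegative. -/
lemma step_estimate {j : ℕ} (hj : j < H.J) :
    ∑ s ∈ H.A (j + 1), |H.σ (j + 1) s - H.σ j s| ≤
      2 * (H.ε * ∑ q ∈ H.A 0, ∑ q' ∈ H.A 0, (H.Ω (j + 1) q q' - H.Ω j q q')) +
      H.Dv * ∑ s ∈ H.A 0, (H.seen (j + 1) s - H.seen j s) +
      ((H.A j).card - (H.A (j + 1)).card) * (H.D₂ * (H.ε * (H.A 0).card)) := by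
  classical
  have hsub := H.A_succ_subset j hj
  obtain ⟨x₀, hne, hx₀⟩ := H.collision j hj
  have hΩ : 0 ≤ 2 * (H.ε * ∑ q ∈ H.A 0, ∑ q' ∈ H.A 0, (H.Ω (j + 1) q q' - H.Ω j q q')) :=
    mul_nonneg two_pos.le (mul_nonneg H.ε_pos.le (Finset.sum_nonneg fun q _ =>
      Finset.sum_nonneg fun q' _ => sub_nonneg.2 (Ω_le_succ hj q q')))
  have hkill : 0 ≤ ((H.A j).card - (H.A (j + 1)).card : ℝ) * (H.D₂ * (H.ε * (H.A 0).card)) :=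
    mul_nonneg (sub_nonneg.2 (by exact_mod_cast Finset.card_le_card hsub))
      (mul_nonneg H.D₂_nonneg (mul_nonneg H.ε_pos.le (Nat.cast_nonneg _)))
  have hsingle : ∀ p : Finset ℕ, p ⊆ H.A (j + 1) → (∀ s ∈ p, SingleAt (H.A j) (H.A (j + 1))
      (H.X j) (H.σ j) (fun s => H.X j s + H.σ j s * H.Δ j) (H.X (j + 1) s)) →
      ∑ s ∈ p, |H.σ (j + 1) s - H.σ j s| ≤
        H.Dv * ∑ s ∈ H.A 0, (H.seen (j + 1) s - H.seen j s) := by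
    intro p hp hps
    have h1 : ∑ s ∈ p, |H.σ (j + 1) s - H.σ j s| ≤
        ∑ s ∈ p, H.Dv * (H.seen (j + 1) s - H.seen j s) := by
      refine Finset.sum_le_sum fun s hs => ?_
      rw [seen_of_mem (hp hs), seen_of_mem (hsub (hp hs))]
      exact abs_sub_le_of_singleAt hj (hp hs) (hps s hs)
    rw [← Finset.mul_sum] at h1
    refine h1.trans (mul_le_mul_of_nonneg_left ?_ H.Dv_nonneg)
    exact Finset.sum_le_sum_of_subset_of_nonneg (hp.trans (A_subset_zero (j := j + 1) hj))
      fun s _ _ => sub_nonneg.2 (seen_le_succ hj s)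
  rcases hx₀ with h | h
  · have := hsingle (H.A (j + 1)) (Finset.Subset.refl _) fun s _ => by
      by_cases hs : H.X (j + 1) s = x₀
      · rw [hs]; exact h
      · exact hne _ hs
    linarith
  · have h1 := hsingle ((H.A (j + 1)).filter fun s => ¬ H.X (j + 1) s = x₀)
      (Finset.filter_subset _ _) fun s hs => hne _ (Finset.mem_filter.1 hs).2
    rw [← Finset.sum_filter_add_sum_filter_not (H.A (j + 1)) (fun s => H.X (j + 1) s = x₀)]
    rcases h with h | h
    · have := sum_abs_sub_le_of_mergeAt hj h
      linarith
    · have := sum_abs_sub_le_of_cancelAt hj h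
      linarith

/-- The quadratic interaction estimate. -/
theorem interaction_estimate :
    ∑ j ∈ Finset.range H.J, ∑ s ∈ H.A (j + 1), |H.σ (j + 1) s - H.σ j s| * H.ε ≤
      (3 * H.D₂ + 2 * (H.D₃ * H.T)) * (H.ε * (H.A 0).card) ^ 2 +
        H.Dv * (H.ε * (H.A 0).card) * H.T := by
  have hT : 0 ≤ H.T := (H.V_nonneg 0).trans (H.V_le 0)
  set N : ℝ := ((H.A 0).card : ℝ) with hN
  set Θ : ℕ → ℝ := fun j => ∑ q ∈ H.A 0, ∑ q' ∈ H.A 0, H.Ω j q q' with hΘ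
  set Γ : ℕ → ℝ := fun j => ∑ s ∈ H.A 0, H.seen j s with hΓ
  -- The sums of Ω and of the seen variation, and the number of waves, all telescope.
  have key : ∀ k ≤ H.J, ∑ j ∈ Finset.range k, ∑ s ∈ H.A (j + 1), |H.σ (j + 1) s - H.σ j s| ≤
      2 * (H.ε * (Θ k - Θ 0)) + H.Dv * (Γ k - Γ 0) +
        (N - (H.A k).card) * (H.D₂ * (H.ε * N)) := by
    intro k hk
    induction k with
    | zero => simp [hN]
    | succ k ih =>
      rw [Finset.sum_range_succ]
      have h1 := ih (by omega)
      have h2 := step_estimate (H := H) (j := k) hk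
      simp only [Finset.sum_sub_distrib] at h2
      linarith
  have hk := key H.J le_rfl
  have hΘ0 : 0 ≤ Θ 0 := Finset.sum_nonneg fun q _ => Finset.sum_nonneg fun q' _ => Ω_nonneg _ _ _
  have hΓ0 : 0 ≤ Γ 0 := Finset.sum_nonneg fun q _ => H.V_nonneg _
  have hΘJ : Θ H.J ≤ N * (N * (H.D₂ + H.D₃ * H.T)) := by
    rw [hN, ← nsmul_eq_mul, ← nsmul_eq_mul]
    exact Finset.sum_le_card_nsmul _ _ _ fun q _ =>
      Finset.sum_le_card_nsmul _ _ _ fun q' _ => Ω_le hT _ _ _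
  have hΓJ : Γ H.J ≤ N * H.T := by
    rw [hN, ← nsmul_eq_mul]
    exact Finset.sum_le_card_nsmul _ _ _ fun q _ => seen_le _ _
  have hN0 : 0 ≤ N := by rw [hN]; positivity
  have hε := H.ε_pos
  have hkill : (N - (H.A H.J).card) * (H.D₂ * (H.ε * N)) ≤ N * (H.D₂ * (H.ε * N)) := by
    refine mul_le_mul_of_nonneg_right ?_ (mul_nonneg H.D₂_nonneg (mul_nonneg hε.le hN0))
    have : (0 : ℝ) ≤ (H.A H.J).card := by positivity
    linarith
  have h1 : H.ε * (Θ H.J - Θ 0) ≤ H.ε * (N * (N * (H.D₂ + H.D₃ * H.T))) :=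
    mul_le_mul_of_nonneg_left (by linarith) hε.le
  have h2 : H.Dv * (Γ H.J - Γ 0) ≤ H.Dv * (N * H.T) :=
    mul_le_mul_of_nonneg_left (by linarith) H.Dv_nonneg
  have h3 := mul_le_mul_of_nonneg_right (hk.trans (add_le_add (add_le_add
    (mul_le_mul_of_nonneg_left h1 two_pos.le) h2) hkill)) hε.le
  rw [Finset.sum_mul] at h3
  simp only [Finset.sum_mul] at h3
  refine h3.trans (le_of_eq ?_)
  ring

end WaveHistory

/-! ### Slopes of the flux on a cell -/

/-- Slope of `g` between `c` and `c + ε`. -/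
def cellSlope (ε : ℝ) (g : ℝ → ℝ) (c : ℝ) : ℝ := (g (c + ε) - g c) / ε

lemma abs_sub_le_of_hasDerivAt {g g' : ℝ → ℝ} (h : ∀ x, HasDerivAt g (g' x) x) {C : ℝ}
    (hC : ∀ x, |g' x| ≤ C) (x y : ℝ) : |g y - g x| ≤ C * |y - x| := by
  have := convex_univ.norm_image_sub_le_of_norm_hasDerivWithin_le (f := g) (f' := g') (C := C)
    (fun x _ => (h x).hasDerivWithinAt) (fun x _ => hC x) (mem_univ x) (mem_univ y)
  simpa using this

lemma abs_cellSlope_le {ε : ℝ} (hε : 0 < ε) {g g' : ℝ → ℝ} (h : ∀ x, HasDerivAt g (g' x) x) {C : ℝ}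
    (hC : ∀ x, |g' x| ≤ C) (c : ℝ) : |cellSlope ε g c| ≤ C := by
  rw [cellSlope, abs_div, abs_of_pos hε, div_le_iff₀ hε]
  have := abs_sub_le_of_hasDerivAt h hC c (c + ε)
  rwa [add_sub_cancel_left, abs_of_pos hε] at this

/-- As a function of the cell, the slope of `g` has as derivative the slope of `g'`, which is
bounded by the second derivative. -/
lemma abs_cellSlope_sub_le {ε : ℝ} (hε : 0 < ε) {g g' g'' : ℝ → ℝ}
    (h : ∀ x, HasDerivAt g (g' x) x) (h' : ∀ x, HasDerivAt g' (g'' x) x) {C : ℝ}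
    (hC : ∀ x, |g'' x| ≤ C) (c c' : ℝ) :
    |cellSlope ε g c - cellSlope ε g c'| ≤ C * |c - c'| := by
  refine abs_sub_le_of_hasDerivAt (g' := cellSlope ε g') (fun x => ?_)
    (fun x => abs_cellSlope_le hε h' hC x) c' c
  exact (((h (x + ε)).comp_add_const x ε).sub (h x)).div_const ε

lemma contDiff_deriv_fst {G : ℝ × ℝ → ℝ} {n : ℕ} (hG : ContDiff ℝ (n + 1) G) :
    ContDiff ℝ n fun p : ℝ × ℝ => deriv (fun z => G (z, p.2)) p.1 := by
  have hd : Differentiable ℝ G := hG.differentiable (by simp)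
  have : (fun p : ℝ × ℝ => deriv (fun z => G (z, p.2)) p.1) = fun p => fderiv ℝ G p (1, 0) := by
    ext p
    have h1 : HasDerivAt (fun z : ℝ => (z, p.2)) ((1 : ℝ), (0 : ℝ)) p.1 :=
      (hasDerivAt_id _).prodMk (hasDerivAt_const _ _)
    exact ((hd (p.1, p.2)).hasFDerivAt.comp_hasDerivAt p.1 h1).deriv
  rw [this]
  exact (hG.fderiv_right le_rfl).clm_apply contDiff_const

lemma hasDerivAt_fst {G : ℝ × ℝ → ℝ} (hG : Differentiable ℝ G) (w v : ℝ) :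
    HasDerivAt (fun z => G (z, v)) (deriv (fun z => G (z, v)) w) w :=
  ((hG (w, v)).comp w (differentiableAt_id.prodMk (differentiableAt_const v))).hasDerivAt

lemma hasDerivAt_snd {G : ℝ × ℝ → ℝ} (hG : Differentiable ℝ G) (w v : ℝ) :
    HasDerivAt (fun z => G (w, z)) (deriv (fun z => G (w, z)) v) v :=
  ((hG (w, v)).comp v ((differentiableAt_const w).prodMk differentiableAt_id)).hasDerivAt

lemma contDiff_dW {f : ℝ → ℝ → ℝ} (hf : ContDiff ℝ 3 (Function.uncurry f))
    : ContDiff ℝ 2 fun p : ℝ × ℝ => dW f p.1 p.2 :=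
  contDiff_deriv_fst (n := 2) (G := Function.uncurry f) (by exact_mod_cast hf)

lemma contDiff_dWW {f : ℝ → ℝ → ℝ} (hf : ContDiff ℝ 3 (Function.uncurry f))
    : ContDiff ℝ 1 fun p : ℝ × ℝ => dWW f p.1 p.2 :=
  contDiff_deriv_fst (n := 1) (G := fun p : ℝ × ℝ => dW f p.1 p.2)
    (by exact_mod_cast contDiff_dW hf)

lemma hasDerivAt_dW {f : ℝ → ℝ → ℝ} (hf : ContDiff ℝ 3 (Function.uncurry f))
    (w v : ℝ) : HasDerivAt (fun z => f z v) (dW f w v) w :=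
  hasDerivAt_fst (hf.differentiable (by norm_num)) w v

lemma hasDerivAt_dWW {f : ℝ → ℝ → ℝ} (hf : ContDiff ℝ 3 (Function.uncurry f))
    (w v : ℝ) : HasDerivAt (fun z => dW f z v) (dWW f w v) w :=
  hasDerivAt_fst (G := fun p : ℝ × ℝ => dW f p.1 p.2)
    ((contDiff_dW hf).differentiable (by norm_num)) w v

lemma hasDerivAt_dWV {f : ℝ → ℝ → ℝ} (hf : ContDiff ℝ 3 (Function.uncurry f))
    (w v : ℝ) : HasDerivAt (fun z => dW f w z) (dWV f w v) v :=
  hasDerivAt_snd (G := fun p : ℝ × ℝ => dW f p.1 p.2)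
    ((contDiff_dW hf).differentiable (by norm_num)) w v

lemma hasDerivAt_dWWV {f : ℝ → ℝ → ℝ} (hf : ContDiff ℝ 3 (Function.uncurry f))
    (w v : ℝ) : HasDerivAt (fun z => dWW f w z) (dWWV f w v) v :=
  hasDerivAt_snd (G := fun p : ℝ × ℝ => dWW f p.1 p.2)
    ((contDiff_dWW hf).differentiable (by norm_num)) w v

lemma IsBdd.abs_le {h : ℝ → ℝ → ℝ} (hh : IsBdd h) (w v : ℝ) : |h w v| ≤ supNorm h :=
  le_ciSup (f := fun p : ℝ × ℝ => |h p.1 p.2|) hh (w, v)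

lemma supNorm_nonneg (h : ℝ → ℝ → ℝ) : 0 ≤ supNorm h := Real.iSup_nonneg fun _ => abs_nonneg _

lemma abs_cellSlope_flux_sub_le {f : ℝ → ℝ → ℝ} (hf : ContDiff ℝ 3 (Function.uncurry f))
    (hww : IsBdd (dWW f)) {ε : ℝ} (hε : 0 < ε) (u c c' : ℝ) :
    |cellSlope ε (fun z => f z u) c - cellSlope ε (fun z => f z u) c'| ≤
      supNorm (dWW f) * |c - c'| :=
  abs_cellSlope_sub_le hε (fun x => hasDerivAt_dW hf x u) (fun x => hasDerivAt_dWW hf x u)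
    (fun x => hww.abs_le x u) c c'

lemma cellSlope_sub (ε : ℝ) (g h : ℝ → ℝ) (c : ℝ) :
    cellSlope ε (fun z => g z - h z) c = cellSlope ε g c - cellSlope ε h c := by
  simp only [cellSlope]; ring

lemma abs_cellSlope_param_sub_le {f : ℝ → ℝ → ℝ} (hf : ContDiff ℝ 3 (Function.uncurry f))
    (hwv : IsBdd (dWV f)) {ε : ℝ} (hε : 0 < ε) (u u' c : ℝ) :
    |cellSlope ε (fun z => f z u') c - cellSlope ε (fun z => f z u) c| ≤
      supNorm (dWV f) * |u' - u| := by
  rw [← cellSlope_sub]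
  exact abs_cellSlope_le hε (fun x => (hasDerivAt_dW hf x u').sub (hasDerivAt_dW hf x u))
    (fun x => abs_sub_le_of_hasDerivAt (fun z => hasDerivAt_dWV hf x z)
      (fun z => hwv.abs_le x z) u u') c

/-- The Lipschitz bound for slopes, applied to the difference of the two fluxes, whose second
derivative in the state is at most ‖f_wwv‖ |u' - u|. -/
lemma abs_cellSlope_mixed_le {f : ℝ → ℝ → ℝ} (hf : ContDiff ℝ 3 (Function.uncurry f))
    (hwwv : IsBdd (dWWV f)) {ε : ℝ} (hε : 0 < ε) (u u' c c' : ℝ) :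
    |(cellSlope ε (fun z => f z u') c - cellSlope ε (fun z => f z u) c) -
      (cellSlope ε (fun z => f z u') c' - cellSlope ε (fun z => f z u) c')| ≤
      supNorm (dWWV f) * |u' - u| * |c - c'| := by
  rw [← cellSlope_sub, ← cellSlope_sub]
  exact abs_cellSlope_sub_le hε (fun x => (hasDerivAt_dW hf x u').sub (hasDerivAt_dW hf x u))
    (fun x => (hasDerivAt_dWW hf x u').sub (hasDerivAt_dWW hf x u))
    (fun x => abs_sub_le_of_hasDerivAt (fun z => hasDerivAt_dWWV hf x z)
      (fun z => hwwv.abs_le x z) u u') c c'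

/-- The slope on a cell is a value of `∂f/∂w` in the cell. -/
lemma exists_cellSlope_eq {f : ℝ → ℝ → ℝ} (hf : ContDiff ℝ 3 (Function.uncurry f))
    {ε : ℝ} (hε : 0 < ε) (u c : ℝ) :
    ∃ ω ∈ Ioo c (c + ε), cellSlope ε (fun z => f z u) c = dW f ω u := by
  obtain ⟨ω, hω, h⟩ := exists_hasDerivAt_eq_slope (fun z => f z u) (fun z => dW f z u)
    (by linarith : c < c + ε) (fun x _ => (hasDerivAt_dW hf x u).continuousAt.continuousWithinAt)
    (fun x _ => hasDerivAt_dW hf x u)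
  refine ⟨ω, hω, ?_⟩
  rw [h, cellSlope, add_sub_cancel_left]

/-! ### Convex envelopes of piecewise affine functions -/

/-- `G` is affine between consecutive points `a + ε k`, `k ≤ n`. -/
def PiecewiseAffine (ε a : ℝ) (n : ℕ) (G : ℝ → ℝ) : Prop :=
  ∀ k < n, ∀ θ ∈ Icc (0 : ℝ) 1,
    G (a + ε * (k + θ)) = G (a + ε * k) + θ * (G (a + ε * (k + 1)) - G (a + ε * k))

/-- `E` is the convex envelope of the finite sequence `g 0, …, g n`. -/
structure IsSeqEnvelope (n : ℕ) (E g : ℕ → ℝ) : Prop where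
  convex : ∀ k, k + 2 ≤ n → E (k + 1) - E k ≤ E (k + 2) - E (k + 1)
  le : ∀ k ≤ n, E k ≤ g k
  left : E 0 = g 0
  right : E n = g n
  touch : ∀ k, k + 2 ≤ n → E (k + 1) - E k < E (k + 2) - E (k + 1) → E (k + 1) = g (k + 1)

section Envelope

variable {ε a : ℝ} {n : ℕ} {G : ℝ → ℝ}

lemma node_mem (hε : 0 < ε) {k : ℕ} (hk : k ≤ n) : a + ε * k ∈ Icc a (a + ε * n) := by
  constructor
  · have : 0 ≤ ε * k := by positivity
    linarith
  · have : ε * (k : ℝ) ≤ ε * n := mul_le_mul_of_nonneg_left (by exact_mod_cast hk) hε.le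
    linarith

lemma PiecewiseAffine.affine_le (hε : 0 < ε) (hG : PiecewiseAffine ε a n G) {α β : ℝ}
    (h : ∀ k ≤ n, α + β * (a + ε * k) ≤ G (a + ε * k)) :
    ∀ z ∈ Icc a (a + ε * n), α + β * z ≤ G z := by
  intro z hz
  have hz0 : 0 ≤ (z - a) / ε := div_nonneg (by linarith [hz.1]) hε.le
  have hzn : (z - a) / ε ≤ n := by rw [div_le_iff₀ hε]; linarith [hz.2]
  set k := ⌊(z - a) / ε⌋₊ with hk
  have hk1 : (k : ℝ) ≤ (z - a) / ε := Nat.floor_le hz0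
  have hk2 : (z - a) / ε < k + 1 := Nat.lt_floor_add_one _
  have hkn : k ≤ n := by exact_mod_cast hk1.trans hzn
  rcases hkn.eq_or_lt with hkn | hkn
  · have hzk : (z - a) / ε = n := le_antisymm hzn (by rw [← hkn]; exact hk1)
    have : z = a + ε * n := by field_simp at hzk; linarith
    rw [this]
    exact h n le_rfl
  · have hz' : z = a + ε * (k + ((z - a) / ε - k)) := by field_simp; ring
    have hθ : (z - a) / ε - k ∈ Icc (0 : ℝ) 1 := ⟨by linarith, by linarith⟩
    set θ := (z - a) / ε - k with hθd
    have h1 := h k hkn.le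
    have h2 := h (k + 1) hkn
    push_cast at h2
    rw [hz', hG k hkn θ hθ]
    nlinarith [hθ.1, hθ.2]

lemma affine_convexOn (α β : ℝ) (s : Set ℝ) (hs : Convex ℝ s) :
    ConvexOn ℝ s fun z => α + β * z := by
  refine ⟨hs, fun x _ y _ p q _ _ hpq => le_of_eq ?_⟩
  simp only [smul_eq_mul]
  have : α = (p + q) * α := by rw [hpq, one_mul]
  linear_combination this

lemma le_convEnv {b u : ℝ} {φ : ℝ → ℝ} (hφ : ConvexOn ℝ (Icc a b) φ)
    (hle : ∀ z ∈ Icc a b, φ z ≤ G z) (hu : u ∈ Icc a b) : φ u ≤ convEnv a b G u := by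
  refine le_csSup ⟨G u, ?_⟩ ⟨φ, hφ, hle, rfl⟩
  rintro y ⟨ψ, -, hψ, rfl⟩
  exact hψ u hu

/-- Needed because a real supremum is meaningful only for nonempty sets. A constant below all node
values is a competitor. -/
lemma PiecewiseAffine.convEnv_set_nonempty (hε : 0 < ε) (hG : PiecewiseAffine ε a n G) (u : ℝ) :
    {y | ∃ φ : ℝ → ℝ, ConvexOn ℝ (Icc a (a + ε * n)) φ ∧
      (∀ z ∈ Icc a (a + ε * n), φ z ≤ G z) ∧ y = φ u}.Nonempty := by
  set α := - ∑ k ∈ Finset.range (n + 1), |G (a + ε * k)| with hα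
  refine ⟨_, fun z => α + 0 * z, affine_convexOn _ _ _ (convex_Icc _ _),
    hG.affine_le hε fun k hk => ?_, rfl⟩
  have := Finset.single_le_sum (f := fun k : ℕ => |G (a + ε * k)|) (fun i _ => abs_nonneg _)
    (Finset.mem_range.2 (Nat.lt_succ_of_le hk))
  have h2 := neg_abs_le (G (a + ε * k))
  linarith

lemma PiecewiseAffine.convEnv_le (hε : 0 < ε) (hG : PiecewiseAffine ε a n G) {u : ℝ}
    (hu : u ∈ Icc a (a + ε * n)) : convEnv a (a + ε * n) G u ≤ G u := by
  refine csSup_le (hG.convEnv_set_nonempty hε u) ?_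
  rintro y ⟨ψ, -, hψ, rfl⟩
  exact hψ u hu

lemma PiecewiseAffine.convexOn_convEnv (hε : 0 < ε) (hG : PiecewiseAffine ε a n G) :
    ConvexOn ℝ (Icc a (a + ε * n)) (convEnv a (a + ε * n) G) := by
  refine ⟨convex_Icc _ _, fun x hx y hy p q hp hq hpq => ?_⟩
  refine csSup_le (hG.convEnv_set_nonempty hε _) ?_
  rintro z ⟨ψ, hψ, hle, rfl⟩
  refine (hψ.2 hx hy hp hq hpq).trans (add_le_add ?_ ?_)
  · exact smul_le_smul_of_nonneg_left (le_convEnv hψ hle hx) hp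
  · exact smul_le_smul_of_nonneg_left (le_convEnv hψ hle hy) hq

lemma PiecewiseAffine.affine_le_convEnv (hε : 0 < ε) (hG : PiecewiseAffine ε a n G) {α β : ℝ}
    (h : ∀ k ≤ n, α + β * (a + ε * k) ≤ G (a + ε * k)) {u : ℝ} (hu : u ∈ Icc a (a + ε * n)) :
    α + β * u ≤ convEnv a (a + ε * n) G u :=
  le_convEnv (φ := fun z => α + β * z) (affine_convexOn _ _ _ (convex_Icc _ _))
    (hG.affine_le hε h) hu

/-- Affine minorants suffice as competitors, and by piecewise affinity they need to be checked only
at the nodes. A steep line through an end point shows that the envelope is attained there. At a kink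
above which there is room, a line of intermediate slope could be lifted, which contradicts
maximality. -/
lemma PiecewiseAffine.isSeqEnvelope (hε : 0 < ε) (hG : PiecewiseAffine ε a n G) :
    IsSeqEnvelope n (fun k => convEnv a (a + ε * n) G (a + ε * k)) fun k => G (a + ε * k) := by
  set E : ℕ → ℝ := fun k => convEnv a (a + ε * n) G (a + ε * k) with hE
  set g : ℕ → ℝ := fun k => G (a + ε * k) with hg
  have hle : ∀ k ≤ n, E k ≤ g k := fun k hk => hG.convEnv_le hε (node_mem hε hk)
  have hconv : ∀ k, k + 2 ≤ n → E (k + 1) - E k ≤ E (k + 2) - E (k + 1) := by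
    intro k hk
    have h1 := (hG.convexOn_convEnv hε).2 (node_mem (a := a) hε (by omega : k ≤ n))
      (node_mem (a := a) hε hk) (by norm_num : (0 : ℝ) ≤ 1 / 2) (by norm_num : (0 : ℝ) ≤ 1 / 2)
      (by norm_num)
    have h2 : (1 / 2 : ℝ) • (a + ε * (k : ℝ)) + (1 / 2 : ℝ) • (a + ε * ((k + 2 : ℕ) : ℝ)) =
        a + ε * ((k + 1 : ℕ) : ℝ) := by
      simp only [smul_eq_mul]; push_cast; ring
    rw [h2] at h1
    simp only [smul_eq_mul] at h1
    simp only [hE]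
    linarith
  -- `M` exceeds all differences of node values, so a line which falls by `M` per cell from an end
  -- point stays below the graph.
  set M := ∑ k ∈ Finset.range (n + 1), ∑ i ∈ Finset.range (n + 1), |g k - g i| with hM
  have hM1 : ∀ k ≤ n, ∀ i ≤ n, g k - g i ≤ M := fun k hk i hi => by
    refine (le_abs_self _).trans ?_
    refine le_trans ?_ (Finset.single_le_sum
      (f := fun k => ∑ i ∈ Finset.range (n + 1), |g k - g i|)
      (fun i _ => Finset.sum_nonneg fun _ _ => abs_nonneg _)
      (Finset.mem_range.2 (Nat.lt_succ_of_le hk)))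
    exact Finset.single_le_sum (f := fun i => |g k - g i|) (fun i _ => abs_nonneg _)
      (Finset.mem_range.2 (Nat.lt_succ_of_le hi))
  have hM0 : 0 ≤ M := Finset.sum_nonneg fun _ _ => Finset.sum_nonneg fun _ _ => abs_nonneg _
  have hMε : M / ε * ε = M := by field_simp
  refine ⟨hconv, hle, le_antisymm (hle 0 (Nat.zero_le _)) ?_, le_antisymm (hle n le_rfl) ?_, ?_⟩
  · have h1 := hG.affine_le_convEnv hε (α := g 0 + M / ε * a) (β := - (M / ε)) (fun k hk => by
      rcases Nat.eq_zero_or_pos k with rfl | hk0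
      · apply le_of_eq; simp only [hg]; ring
      · have h2 := hM1 0 (Nat.zero_le _) k hk
        have h3 : M * 1 ≤ M * (k : ℝ) := mul_le_mul_of_nonneg_left (by exact_mod_cast hk0) hM0
        have h4 : g 0 + M / ε * a + - (M / ε) * (a + ε * k) = g 0 - M / ε * ε * k := by ring
        rw [h4, hMε]
        change _ ≤ g k
        linarith) (node_mem (a := a) (n := n) hε (Nat.zero_le n))
    refine le_trans (le_of_eq ?_) h1
    push_cast; ring
  · have h1 := hG.affine_le_convEnv hε (α := g n - M / ε * (a + ε * n)) (β := M / ε)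
      (fun k hk => by
      rcases hk.eq_or_lt with rfl | hkn
      · apply le_of_eq; simp only [hg]; ring
      · have h2 := hM1 n le_rfl k hk
        have hkn' : (k : ℝ) + 1 ≤ n := by exact_mod_cast hkn
        have h3 : M * 1 ≤ M * ((n : ℝ) - k) := mul_le_mul_of_nonneg_left (by linarith) hM0
        have h4 : g n - M / ε * (a + ε * n) + M / ε * (a + ε * k) =
          g n - M / ε * ε * (n - k) := by ring
        rw [h4, hMε]
        change _ ≤ g k
        linarith) (node_mem (a := a) (n := n) hε le_rfl)
    refine le_trans (le_of_eq ?_) h1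
    ring
  · intro k hk hlt
    by_contra hne
    have hgap : E (k + 1) < g (k + 1) := lt_of_le_of_ne (hle (k + 1) (by omega)) hne
    set d₁ := E (k + 1) - E k with hd₁
    set d₂ := E (k + 2) - E (k + 1) with hd₂
    have hmono : ∀ i, k + 1 ≤ i → i + 1 ≤ n → d₂ ≤ E (i + 1) - E i := by
      intro i hi
      induction i, hi using Nat.le_induction with
      | base => intro _; exact le_rfl
      | succ i hi ih => intro h; exact (ih (by omega)).trans (hconv i (by omega))
    have hup : ∀ i, k + 1 ≤ i → i ≤ n → E (k + 1) + d₂ * ((i : ℝ) - (k + 1)) ≤ E i := by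
      intro i hi
      induction i, hi using Nat.le_induction with
      | base => intro _; push_cast; linarith
      | succ i hi ih =>
        intro h
        have h1 := ih (by omega)
        have h2 := hmono i hi h
        push_cast
        linarith
    have hmono' : ∀ i, i ≤ k → E (i + 1) - E i ≤ d₁ := by
      intro i hi
      obtain ⟨p, rfl⟩ := Nat.exists_eq_add_of_le hi
      clear hmono hup
      have : ∀ p i : ℕ, i + p + 2 ≤ n → E (i + 1) - E i ≤ E (i + p + 1) - E (i + p) := by
        intro p
        induction p with
        | zero => intro i _; exact le_rfl
        | succ p ih => intro i h; exact (ih i (by omega)).trans (hconv (i + p) (by omega))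
      exact this p i hk
    have hdown : ∀ p i : ℕ, i + p = k + 1 → E (k + 1) - d₁ * p ≤ E i := by
      intro p
      induction p with
      | zero => intro i hi; rw [Nat.add_zero] at hi; rw [hi]; simp
      | succ p ih =>
        intro i hi
        have h1 := ih (i + 1) (by omega)
        have h2 := hmono' i (by omega)
        push_cast
        linarith
    -- The line through `E (k + 1) + η` whose rise per cell is the mean of `d₁` and `d₂` gains at
    -- least `(d₂ - d₁) / 2` on the convex sequence at every step away from node `k + 1`; hence this
    -- bound on `η`.
    set η := min (g (k + 1) - E (k + 1)) ((d₂ - d₁) / 2) with hη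
    have hη0 : 0 < η := lt_min (by linarith) (by linarith)
    have hη1 : η ≤ g (k + 1) - E (k + 1) := min_le_left _ _
    have hη2 : η ≤ (d₂ - d₁) / 2 := min_le_right _ _
    set p := (d₁ + d₂) / 2 with hp
    have hpε : p / ε * ε = p := by field_simp
    have h1 := hG.affine_le_convEnv hε
      (α := E (k + 1) + η - p / ε * (a + ε * (k + 1))) (β := p / ε) (fun i hi => by
        have h4 : E (k + 1) + η - p / ε * (a + ε * (k + 1)) + p / ε * (a + ε * i) =
          E (k + 1) + η + p / ε * ε * (i - (k + 1)) := by ring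
        rw [h4, hpε]
        change _ ≤ g i
        rcases lt_trichotomy i (k + 1) with hik | hik | hik
        · obtain ⟨q, hq⟩ := Nat.exists_eq_add_of_lt hik
          have h5 := hdown (q + 1) i (by omega)
          have h6 : (i : ℝ) - (k + 1) = - ((q + 1 : ℕ) : ℝ) := by
            have : ((k + 1 : ℕ) : ℝ) = ((i + q + 1 : ℕ) : ℝ) := by rw [hq]
            push_cast at this ⊢; linarith
          have h7 : (1 : ℝ) ≤ ((q + 1 : ℕ) : ℝ) := by
            have : (0 : ℝ) ≤ q := by positivity
            push_cast; linarith
          have h8 := hle i hi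
          rw [h6]
          nlinarith
        · rw [hik]; push_cast; linarith
        · have h5 := hup i hik.le hi
          have h7 : (1 : ℝ) ≤ (i : ℝ) - (k + 1) := by
            have : ((k + 1 + 1 : ℕ) : ℝ) ≤ i := by exact_mod_cast hik
            push_cast at this; linarith
          have h8 := hle i hi
          nlinarith) (node_mem (a := a) (n := n) hε (by omega : k + 1 ≤ n))
    have h2 : E (k + 1) + η - p / ε * (a + ε * (k + 1)) + p / ε * (a + ε * ((k + 1 : ℕ) : ℝ)) =
        E (k + 1) + η := by push_cast; ring
    rw [h2] at h1
    change _ ≤ E (k + 1) at h1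
    linarith

end Envelope

/-- Reflecting both the argument and the value exchanges convexity and concavity and preserves
slopes. So negative waves obey the same envelope rules as positive ones, listed from left to right.
-/
lemma concEnv_eq_neg_convEnv (a b : ℝ) (G : ℝ → ℝ) (u : ℝ) :
    concEnv a b G u = - convEnv (-b) (-a) (fun z => - G (-z)) (-u) := by
  have href : ∀ {c d : ℝ} {φ : ℝ → ℝ}, ConcaveOn ℝ (Icc c d) φ →
      ConvexOn ℝ (Icc (-d) (-c)) fun z => - φ (-z) := by
    intro c d φ h
    refine ⟨convex_Icc _ _, fun x hx y hy p q hp hq hpq => ?_⟩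
    have := h.2 (x := -x) ⟨by linarith [hx.2], by linarith [hx.1]⟩ (y := -y)
      ⟨by linarith [hy.2], by linarith [hy.1]⟩ hp hq hpq
    simp only [smul_eq_mul] at this ⊢
    rw [show -(p * x + q * y) = p * -x + q * -y by ring]
    linarith
  have href' : ∀ {c d : ℝ} {φ : ℝ → ℝ}, ConvexOn ℝ (Icc c d) φ →
      ConcaveOn ℝ (Icc (-d) (-c)) fun z => - φ (-z) := by
    intro c d φ h
    refine ⟨convex_Icc _ _, fun x hx y hy p q hp hq hpq => ?_⟩
    have := h.2 (x := -x) ⟨by linarith [hx.2], by linarith [hx.1]⟩ (y := -y)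
      ⟨by linarith [hy.2], by linarith [hy.1]⟩ hp hq hpq
    simp only [smul_eq_mul] at this ⊢
    rw [show -(p * x + q * y) = p * -x + q * -y by ring]
    linarith
  rw [concEnv, convEnv, Real.sInf_def]
  congr 2
  ext y
  rw [Set.mem_neg]
  constructor
  · rintro ⟨φ, h1, h2, h3⟩
    refine ⟨fun z => - φ (-z), href h1, fun z hz => ?_, by simp [← h3]⟩
    have := h2 (-z) ⟨by linarith [hz.2], by linarith [hz.1]⟩
    linarith
  · rintro ⟨φ, h1, h2, h3⟩
    refine ⟨fun z => - φ (-z), by simpa using href' h1, fun z hz => ?_, by simp [← h3]⟩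
    have := h2 (-z) ⟨by linarith [hz.2], by linarith [hz.1]⟩
    simp only [neg_neg] at this
    linarith

/-! ### The Riemann solver -/

lemma interp_cell {ε : ℝ} (hε : 0 < ε) (g : ℝ → ℝ) (m : ℤ) {θ : ℝ} (hθ : θ ∈ Icc (0 : ℝ) 1) :
    interp ε g (ε * (m + θ)) = g (m * ε) + θ * (g ((m + 1) * ε) - g (m * ε)) := by
  have hq : ε * (m + θ) / ε = m + θ := by field_simp
  rw [interp, hq]
  -- At `θ = 1` the floor already belongs to the next cell; the two formulas agree at the node.
  rcases hθ.2.eq_or_lt with rfl | h1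
  · have : ⌊(m : ℝ) + 1⌋ = m + 1 := by
      rw [show (m : ℝ) + 1 = ((m + 1 : ℤ) : ℝ) by push_cast; rfl, Int.floor_intCast]
    rw [this]
    push_cast
    ring
  · have : ⌊(m : ℝ) + θ⌋ = m := by
      rw [Int.floor_eq_iff]
      exact ⟨by linarith [hθ.1], by linarith⟩
    rw [this]
    ring

lemma interp_node {ε : ℝ} (hε : 0 < ε) (g : ℝ → ℝ) (m : ℤ) :
    interp ε g (ε * m) = g (ε * m) := by
  have := interp_cell hε g m (θ := 0) (by simp)
  rw [add_zero] at this
  rw [this, mul_comm (m : ℝ)]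
  ring

lemma piecewiseAffine_interp {ε : ℝ} (hε : 0 < ε) (g : ℝ → ℝ) (m : ℤ) (n : ℕ) :
    PiecewiseAffine ε (ε * m) n (interp ε g) := by
  intro k _ θ hθ
  have h0 := interp_cell hε g (m + k) hθ
  have h1 := interp_node hε g (m + k)
  have h2 := interp_node hε g (m + k + 1)
  push_cast at h0 h1 h2
  rw [show ε * (m : ℝ) + ε * (k + θ) = ε * (m + k + θ) by ring,
    show ε * (m : ℝ) + ε * k = ε * (m + k) by ring,
    show ε * (m : ℝ) + ε * (k + 1) = ε * (m + k + 1) by ring, h0, h1, h2,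
    mul_comm ε, mul_comm ε]

lemma piecewiseAffine_interp_reflect {ε : ℝ} (hε : 0 < ε) (g : ℝ → ℝ) (m : ℤ) (n : ℕ) :
    PiecewiseAffine ε (-(ε * m)) n fun z => - interp ε g (-z) := by
  intro k _ θ hθ
  have h0 := interp_cell hε g (m - k - 1) (θ := 1 - θ) ⟨by linarith [hθ.2], by linarith [hθ.1]⟩
  have h1 := interp_node hε g (m - k)
  have h2 := interp_node hε g (m - k - 1)
  push_cast at h0 h1 h2
  beta_reduce
  rw [show -(-(ε * (m : ℝ)) + ε * (k + θ)) = ε * (m - k - 1 + (1 - θ)) by ring,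
    show -(-(ε * (m : ℝ)) + ε * k) = ε * (m - k) by ring,
    show -(-(ε * (m : ℝ)) + ε * (k + 1)) = ε * (m - k - 1) by ring, h0, h1, h2,
    show ((m : ℝ) - k - 1) * ε = ε * (m - k - 1) by ring,
    show ((m : ℝ) - k - 1 + 1) * ε = ε * (m - k) by ring]
  ring

/-- Left end of the cell of an elementary jump with sign `S` and right state `r`. -/
def cellLeft (ε S r : ℝ) : ℝ := if 0 < S then r - ε else r

/-- The speeds of the elementary jumps of a Riemann problem are the slopes of an envelope. -/
lemma exists_isSeqEnvelope {ε : ℝ} (hε : 0 < ε) (g : ℝ → ℝ) {S : ℝ} (hS : S = 1 ∨ S = -1) (m : ℤ)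
    (n : ℕ) : ∃ E γ : ℕ → ℝ, IsSeqEnvelope n E γ ∧ ∀ k < n,
      cellSpeed ε g (ε * m) (ε * m + S * (ε * n)) (cellLeft ε S (ε * m + S * (ε * (k + 1 : ℕ)))) =
        (E (k + 1) - E k) / ε ∧
      cellSlope ε g (cellLeft ε S (ε * m + S * (ε * (k + 1 : ℕ)))) = (γ (k + 1) - γ k) / ε := by
  rcases hS with rfl | rfl
  · refine ⟨_, _, (piecewiseAffine_interp hε g m n).isSeqEnvelope hε, fun k hk => ⟨?_, ?_⟩⟩
    · have hlt : ε * (m : ℝ) < ε * m + 1 * (ε * n) := by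
        have : (0 : ℝ) < n := by exact_mod_cast (by omega : 0 < n)
        have := mul_pos hε this
        linarith
      rw [cellSpeed, if_pos hlt, cellLeft, if_pos one_pos, one_mul, one_mul]
      congr 3 <;> push_cast <;> ring
    · rw [cellSlope, cellLeft, if_pos one_pos, one_mul]
      have h1 := interp_node hε g (m + k)
      have h2 := interp_node hε g (m + k + 1)
      push_cast at h1 h2 ⊢
      rw [show ε * (m : ℝ) + ε * k = ε * (m + k) by ring,
        show ε * (m : ℝ) + ε * (k + 1) = ε * (m + k + 1) by ring, h1, h2]
      congr 3 <;> ring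
  · have hneg : ¬ (0 : ℝ) < -1 := by norm_num
    refine ⟨_, _, (piecewiseAffine_interp_reflect hε g m n).isSeqEnvelope hε,
      fun k hk => ⟨?_, ?_⟩⟩
    · have hlt : ¬ ε * (m : ℝ) < ε * m + -1 * (ε * n) := by
        have : (0 : ℝ) ≤ n := by positivity
        have := mul_nonneg hε.le this
        linarith
      rw [cellSpeed, if_neg hlt, cellLeft, if_neg hneg, concEnv_eq_neg_convEnv,
        concEnv_eq_neg_convEnv]
      rw [show -(ε * (m : ℝ) + -1 * (ε * n)) = -(ε * m) + ε * n by ring,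
        show -(ε * (m : ℝ) + -1 * (ε * (k + 1 : ℕ)) + ε) = -(ε * m) + ε * k by push_cast; ring,
        show -(ε * (m : ℝ) + -1 * (ε * (k + 1 : ℕ))) = -(ε * m) + ε * (k + 1 : ℕ) by ring]
      ring
    · rw [cellSlope, cellLeft, if_neg hneg]
      have h1 := interp_node hε g (m - k)
      have h2 := interp_node hε g (m - k - 1)
      push_cast at h1 h2 ⊢
      rw [show -(-(ε * (m : ℝ)) + ε * k) = ε * (m - k) by ring,
        show -(-(ε * (m : ℝ)) + ε * (k + 1)) = ε * (m - k - 1) by ring, h1, h2,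
        show ε * (m : ℝ) + -1 * (ε * (k + 1)) + ε = ε * (m - k) by ring,
        show ε * (m : ℝ) + -1 * (ε * (k + 1)) = ε * (m - k - 1) by ring]
      ring

lemma IsSeqEnvelope.slope_mono {n : ℕ} {E γ : ℕ → ℝ} (h : IsSeqEnvelope n E γ) {k k' : ℕ}
    (hk : k ≤ k') (hk' : k' < n) : E (k + 1) - E k ≤ E (k' + 1) - E k' := by
  induction k', hk using Nat.le_induction with
  | base => exact le_rfl
  | succ i hi ih => exact (ih (by omega)).trans (h.convex i (by omega))

/-- An initial segment of the naturals less than `n`. -/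
lemma exists_lt_iff_of_lower (n : ℕ) (p : ℕ → Prop) (hp : ∀ k k', k ≤ k' → k' < n → p k' → p k) :
    ∃ K ≤ n, ∀ k < n, p k ↔ k < K := by
  obtain ⟨K, hK⟩ := IsEnvelope.exists_lt_iff (Finset.range n) p
    (fun q _ q' hq' h1 h2 => hp q q' h1 (Finset.mem_range.1 hq') h2)
  refine ⟨min K n, min_le_right _ _, fun k hk => ?_⟩
  rw [hK k (Finset.mem_range.2 hk), lt_min_iff]
  exact ⟨fun h => ⟨h, hk⟩, fun h => h.1⟩

/-- Speeds increase along the jump, so the elementary jumps with speed at most `ξ` are the first `K`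
ones. The extremum in the solver is attained at the `K`-th node after the left state. -/
lemma riemann_eq {ε : ℝ} (hε : 0 < ε) (g : ℝ → ℝ) {S : ℝ} (hS : S = 1 ∨ S = -1) (m : ℤ)
    (n : ℕ) (ξ : ℝ) [DecidablePred fun k : ℕ => cellSpeed ε g (ε * m) (ε * m + S * (ε * n))
        (cellLeft ε S (ε * m + S * (ε * (k + 1 : ℕ)))) ≤ ξ] :
    riemann ε g (ε * m) (ε * m + S * (ε * n)) ξ = ε * m + S * (ε *
      ((Finset.range n).filter fun k : ℕ => cellSpeed ε g (ε * m) (ε * m + S * (ε * n))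
        (cellLeft ε S (ε * m + S * (ε * (k + 1 : ℕ)))) ≤ ξ).card) := by
  obtain ⟨E, γ, hE, hslope⟩ := exists_isSeqEnvelope hε g hS m n
  obtain ⟨K, hKn, hK⟩ := exists_lt_iff_of_lower n
    (fun k => cellSpeed ε g (ε * m) (ε * m + S * (ε * n))
        (cellLeft ε S (ε * m + S * (ε * (k + 1 : ℕ)))) ≤ ξ) (fun k k' h1 h2 h3 => by
      rw [(hslope k (by omega)).1]
      rw [(hslope k' h2).1] at h3
      exact (div_le_div_of_nonneg_right (hE.slope_mono h1 h2) hε.le).trans h3)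
  have hcard : ((Finset.range n).filter fun k : ℕ => cellSpeed ε g (ε * m)
      (ε * m + S * (ε * n)) (cellLeft ε S (ε * m + S * (ε * (k + 1 : ℕ)))) ≤ ξ) =
      Finset.range K := by
    ext k
    simp only [Finset.mem_filter, Finset.mem_range]
    constructor
    · rintro ⟨h1, h2⟩
      exact (hK k h1).1 h2
    · intro h
      exact ⟨by omega, (hK k (by omega)).2 h⟩
  rw [hcard, Finset.card_range]
  rcases hS with rfl | rfl
  · rcases Nat.eq_zero_or_pos n with rfl | hn
    -- Without a jump the solver falls into its second branch, which returns the left state.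
    · have : K = 0 := by omega
      subst this
      rw [riemann, if_neg (by simp)]
      have : {ω : ℝ | (∃ k : ℤ, ω = k * ε) ∧ ε * (m : ℝ) + 1 * (ε * (0 : ℕ)) ≤ ω ∧ ω < ε * m ∧
          cellSpeed ε g (ε * m) (ε * m + 1 * (ε * (0 : ℕ))) ω ≤ ξ} = ∅ := by
        ext ω
        simp only [mem_ofPred_eq, mem_empty_iff_false, iff_false]
        rintro ⟨-, h1, h2, -⟩
        simp at h1
        linarith
      rw [this]
      simp
    · have hlt : ε * (m : ℝ) < ε * m + 1 * (ε * n) := by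
        have : (0 : ℝ) < n := by exact_mod_cast hn
        have := mul_pos hε this
        linarith
      rw [riemann, if_pos hlt]
      refine IsGreatest.csSup_eq ⟨?_, ?_⟩
      · rcases Nat.eq_zero_or_pos K with rfl | hK0
        · left; simp
        · right
          obtain ⟨k, rfl⟩ : ∃ k, K = k + 1 := ⟨K - 1, by omega⟩
          refine ⟨⟨m + (k + 1), by push_cast; ring⟩, ?_, ?_, ?_⟩
          · have : 0 < ε * ((k + 1 : ℕ) : ℝ) := mul_pos hε (by positivity)
            linarith
          · have : ε * ((k + 1 : ℕ) : ℝ) ≤ ε * n :=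
              mul_le_mul_of_nonneg_left (by exact_mod_cast hKn) hε.le
            linarith
          · have := (hK k (by omega)).2 (by omega)
            rwa [cellLeft, if_pos one_pos] at this
      · rintro ω (rfl | ⟨⟨i, rfl⟩, h1, h2, h3⟩)
        · have : 0 ≤ ε * (K : ℝ) := by positivity
          linarith
        · have hmi : m < i := by
            have : (m : ℝ) < i := by nlinarith
            exact_mod_cast this
          obtain ⟨k, hk⟩ := Int.eq_ofNat_of_zero_le (by omega : 0 ≤ i - m - 1)
          have hi : (i : ℝ) = m + (k + 1) := by
            have : i = m + ((k : ℤ) + 1) := by omega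
            rw [this]; push_cast; ring
          have hkn : k < n := by
            have : (k : ℝ) + 1 ≤ n := by
              rw [hi] at h2
              nlinarith
            exact_mod_cast this
          have hkK : k < K := (hK k hkn).1 (by
            rw [cellLeft, if_pos one_pos]
            convert h3 using 2
            rw [hi]; push_cast; ring)
          have : (k : ℝ) + 1 ≤ K := by exact_mod_cast hkK
          rw [hi]
          nlinarith
  · have hneg : ¬ (0 : ℝ) < -1 := by norm_num
    have hlt : ¬ ε * (m : ℝ) < ε * m + -1 * (ε * n) := by
      have : (0 : ℝ) ≤ n := by positivity
      have := mul_nonneg hε.le this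
      linarith
    rw [riemann, if_neg hlt]
    refine IsLeast.csInf_eq ⟨?_, ?_⟩
    · rcases Nat.eq_zero_or_pos K with rfl | hK0
      · left; simp
      · right
        obtain ⟨k, rfl⟩ : ∃ k, K = k + 1 := ⟨K - 1, by omega⟩
        refine ⟨⟨m - (k + 1), by push_cast; ring⟩, ?_, ?_, ?_⟩
        · have : ε * ((k + 1 : ℕ) : ℝ) ≤ ε * n :=
            mul_le_mul_of_nonneg_left (by exact_mod_cast hKn) hε.le
          linarith
        · have : 0 < ε * ((k + 1 : ℕ) : ℝ) := mul_pos hε (by positivity)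
          linarith
        · have := (hK k (by omega)).2 (by omega)
          rwa [cellLeft, if_neg hneg] at this
    · rintro ω (rfl | ⟨⟨i, rfl⟩, h1, h2, h3⟩)
      · have : 0 ≤ ε * (K : ℝ) := by positivity
        linarith
      · have hmi : i < m := by
          have : (i : ℝ) < m := by nlinarith
          exact_mod_cast this
        obtain ⟨k, hk⟩ := Int.eq_ofNat_of_zero_le (by omega : 0 ≤ m - i - 1)
        have hi : (i : ℝ) = m - (k + 1) := by
          have : i = m - ((k : ℤ) + 1) := by omega
          rw [this]; push_cast; ring
        have hkn : k < n := by
          have : (k : ℝ) + 1 ≤ n := by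
            rw [hi] at h1
            nlinarith
          exact_mod_cast this
        have hkK : k < K := (hK k hkn).1 (by
          rw [cellLeft, if_neg hneg]
          convert h3 using 2
          rw [hi]; push_cast; ring)
        have : (k : ℝ) + 1 ≤ K := by exact_mod_cast hkK
        rw [hi]
        nlinarith

/-! ### Ranks -/

/-- The position of `s` in the increasing enumeration of `B`, counted from `0`. -/
def rank (B : Finset ℕ) (s : ℕ) : ℕ := (B.filter (· < s)).card

lemma sum_rank {M : Type*} [AddCommMonoid M] (B : Finset ℕ) (h : ℕ → M) :
    ∑ q ∈ B, h (rank B q) = ∑ i ∈ Finset.range B.card, h i := by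
  classical
  induction B using Finset.induction_on_max with
  | empty => simp
  | insert a B ha ih =>
    have hnot : a ∉ B := fun h => lt_irrefl a (ha a h)
    rw [Finset.sum_insert hnot, Finset.card_insert_of_notMem hnot, Finset.sum_range_succ, ← ih,
      add_comm]
    have hr : rank (insert a B) a = B.card := by
      rw [rank, Finset.filter_insert, if_neg (lt_irrefl a), Finset.filter_true_of_mem ha]
    rw [hr]
    congr 1
    refine Finset.sum_congr rfl fun q hq => ?_
    rw [rank, rank, Finset.filter_insert, if_neg (by have := ha q hq; omega)]

lemma rank_lt {B : Finset ℕ} {s : ℕ} (hs : s ∈ B) : rank B s < B.card :=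
  Finset.card_lt_card (Finset.filter_ssubset.2 ⟨s, hs, lt_irrefl s⟩)

lemma rank_mono (B : Finset ℕ) {s s' : ℕ} (h : s ≤ s') : rank B s ≤ rank B s' :=
  Finset.card_le_card (Finset.monotone_filter_right _ fun _ _ h' => lt_of_lt_of_le h' h)

/-- The slopes of the envelope of a sequence, carried by the increasing enumeration of a set. -/
lemma IsSeqEnvelope.isEnvelope {ε : ℝ} (hε : 0 < ε) {B : Finset ℕ} {E γ : ℕ → ℝ}
    (h : IsSeqEnvelope B.card E γ) {σ ℓ : ℕ → ℝ}
    (hσ : ∀ s ∈ B, σ s = (E (rank B s + 1) - E (rank B s)) / ε)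
    (hℓ : ∀ s ∈ B, ℓ s = (γ (rank B s + 1) - γ (rank B s)) / ε) : IsEnvelope B σ ℓ := by
  classical
  have hsum : ∀ (τ : ℕ → ℝ) (F : ℕ → ℝ), (∀ s ∈ B, τ s = (F (rank B s + 1) - F (rank B s)) / ε) →
      ∀ k, ∑ q ∈ B with q < k, τ q = (F (B.filter (· < k)).card - F 0) / ε := by
    intro τ F hτ k
    have h1 : ∑ q ∈ B with q < k, τ q = ∑ q ∈ B with q < k,
        (F (rank (B.filter (· < k)) q + 1) - F (rank (B.filter (· < k)) q)) / ε := by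
      refine Finset.sum_congr rfl fun q hq => ?_
      obtain ⟨hqB, hqk⟩ := Finset.mem_filter.1 hq
      have : rank (B.filter (· < k)) q = rank B q := by
        rw [rank, rank, Finset.filter_filter]
        congr 1
        refine Finset.filter_congr fun p _ => ⟨fun h => h.2, fun h => ⟨by omega, h⟩⟩
      rw [this, hτ q hqB]
    rw [h1, sum_rank (B.filter (· < k)) (fun i => (F (i + 1) - F i) / ε), ← Finset.sum_div,
      Finset.sum_range_sub]
  refine ⟨fun q hq q' hq' hle => ?_, fun k => ?_, fun k hk => ?_⟩
  · rw [hσ q hq, hσ q' hq']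
    exact div_le_div_of_nonneg_right (h.slope_mono (rank_mono B hle) (rank_lt hq')) hε.le
  · rw [hsum σ E hσ, hsum ℓ γ hℓ, h.left]
    refine div_le_div_of_nonneg_right (sub_le_sub_right (h.le _ ?_) _) hε.le
    exact Finset.card_filter_le _ _
  · rw [hsum σ E hσ, hsum ℓ γ hℓ, h.left]
    congr 2
    rcases (B.filter (· < k)).eq_empty_or_nonempty with he | hne
    · rw [he]; exact h.left
    rcases (B.filter (k ≤ ·)).eq_empty_or_nonempty with he' | hne'
    · have : B.filter (· < k) = B := by
        refine Finset.filter_true_of_mem fun q hq => ?_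
        by_contra hcon
        have : q ∈ B.filter (k ≤ ·) := Finset.mem_filter.2 ⟨hq, not_lt.1 hcon⟩
        rw [he'] at this
        simp at this
      rw [this]; exact h.right
    -- `q` and `q'` are the cells on the two sides of the cut. Their ranks are consecutive, so a
    -- jump of `σ` between them is a kink of `E`.
    obtain ⟨q, hq, hmax⟩ := (B.filter (· < k)).exists_max_image id hne
    obtain ⟨q', hq', hmin⟩ := (B.filter (k ≤ ·)).exists_min_image id hne'
    simp only [Finset.mem_filter, id_eq] at hq hq' hmax hmin
    have hr' : rank B q' = (B.filter (· < k)).card := by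
      rw [rank]
      congr 1
      refine Finset.filter_congr fun p hp => ⟨fun h1 => ?_, fun h1 => by omega⟩
      by_contra hcon
      have := hmin p ⟨hp, by omega⟩
      omega
    have hr : rank B q + 1 = (B.filter (· < k)).card := by
      have : B.filter (· < k) = insert q (B.filter (· < q)) := by
        ext p
        simp only [Finset.mem_filter, Finset.mem_insert]
        constructor
        · rintro ⟨h1, h2⟩
          have := hmax p ⟨h1, h2⟩
          rcases this.eq_or_lt with h3 | h3
          · exact Or.inl h3
          · exact Or.inr ⟨h1, h3⟩
        · rintro (rfl | ⟨h1, h2⟩)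
          · exact hq
          · exact ⟨h1, by omega⟩
      rw [this, Finset.card_insert_of_notMem (by simp), rank]
    have hlt := hk q hq.1 q' hq'.1 hq.2 hq'.2
    rw [hσ q hq.1, hσ q' hq'.1, div_lt_div_iff_of_pos_right hε, hr', ← hr] at hlt
    have hn := rank_lt hq'.1
    rw [← hr]
    exact h.touch (rank B q) (by omega) hlt

/-! ### Grid data of bounded variation -/

open Filter Topology in
lemma leftLim_eq_of_eqOn {u : ℝ → ℝ} {l x c : ℝ} (hl : l < x) (h : ∀ y ∈ Ioo l x, u y = c) :
    Function.leftLim u x = c := by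
  apply leftLim_eq_of_tendsto
  refine tendsto_const_nhds.congr' ?_
  filter_upwards [Ioo_mem_nhdsLT hl] with y hy using (h y hy).symm

open Filter Topology in
/-- A function which is constant on both sides of each point, with the same values, is constant. -/
lemma eq_of_locally_eq {α : Type*} {F : ℝ → α} (hr : ∀ x, ∃ b > x, ∀ y ∈ Ico x b, F y = F x)
    (hl : ∀ x, ∃ l < x, ∀ y ∈ Ioo l x, F y = F x) (x y : ℝ) : F x = F y := by
  refine IsLocallyConstant.apply_eq_of_preconnectedSpace ((IsLocallyConstant.iff_eventually_eq F).2
    fun x => ?_) x y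
  obtain ⟨b, hb, hb'⟩ := hr x
  obtain ⟨l, hl, hl'⟩ := hl x
  filter_upwards [Ioo_mem_nhds hl hb] with y hy
  rcases lt_or_ge y x with h | h
  · exact hl' y ⟨hy.1, h⟩
  · exact hb' y ⟨h, hy.2⟩

lemma grid_eq {ε a b : ℝ} (hε : 0 < ε) (ha : ∃ k : ℤ, a = k * ε) (hb : ∃ k : ℤ, b = k * ε)
    (h : |a - b| < ε) : a = b := by
  obtain ⟨k, rfl⟩ := ha
  obtain ⟨l, rfl⟩ := hb
  rw [← sub_mul, abs_mul, abs_of_pos hε] at h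
  have h1 : |((k - l : ℤ) : ℝ)| < 1 := by
    push_cast
    by_contra hcon
    nlinarith [not_lt.1 hcon]
  rw [← Int.cast_abs] at h1
  have h2 : |k - l| < 1 := by exact_mod_cast h1
  rw [Int.abs_lt_one_iff] at h2
  have : k = l := by omega
  rw [this]

namespace IsGridDatum

variable {ε : ℝ} {u : ℝ → ℝ}

open Filter Topology

lemma exists_right (hu : IsGridDatum ε u) (hε : 0 < ε) (x : ℝ) :
    ∃ b > x, ∀ y ∈ Ico x b, u y = u x := by
  have h1 : ∀ᶠ y in 𝓝[≥] x, |u y - u x| < ε := by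
    have := (hu.rightCont x).tendsto (Metric.ball_mem_nhds (u x) hε)
    exact this
  obtain ⟨b, hb, hsub⟩ := (mem_nhdsGE_iff_exists_Ico_subset (a := x)).1 h1
  exact ⟨b, hb, fun y hy => grid_eq hε (hu.grid y) (hu.grid x) (hsub hy)⟩

/-- Bounded variation provides a left limit. Near it the values differ from each other by less than
ε, hence coincide because they lie on the grid. -/
lemma exists_left (hu : IsGridDatum ε u) (hε : 0 < ε) (hbv : BoundedVariationOn u univ) (x : ℝ) :
    ∃ l < x, ∀ y ∈ Ioo l x, u y = Function.leftLim u x := by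
  have h1 : ∀ᶠ y in 𝓝[<] x, |u y - Function.leftLim u x| < ε / 2 := by
    have := (hbv.tendsto_leftLim x) (Metric.ball_mem_nhds (Function.leftLim u x) (half_pos hε))
    exact this
  obtain ⟨l, hl, hsub⟩ := (mem_nhdsLT_iff_exists_Ioo_subset (a := x)).1 h1
  have hl : l < x := hl
  obtain ⟨y₀, hy₀⟩ := exists_between hl
  have hc : ∀ y ∈ Ioo l x, u y = u y₀ := fun y hy => by
    have h2 : |u y - Function.leftLim u x| < ε / 2 := hsub hy
    have h3 : |u y₀ - Function.leftLim u x| < ε / 2 := hsub hy₀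
    refine grid_eq hε (hu.grid y) (hu.grid y₀) ?_
    rw [abs_lt] at h2 h3 ⊢
    constructor <;> linarith
  refine ⟨l, hl, fun y hy => ?_⟩
  rw [hc y hy, leftLim_eq_of_eqOn hl hc]

end IsGridDatum

/-! ### The total variation function. -/

section Variation

variable {u : ℝ → ℝ}

lemma eVariationOn_ne_top (hbv : BoundedVariationOn u univ) (s : Set ℝ) : eVariationOn u s ≠ ⊤ :=
  ne_top_of_le_ne_top hbv (eVariationOn.mono u (subset_univ s))

lemma varFun_add (hbv : BoundedVariationOn u univ) {y y' : ℝ} (h : y ≤ y') :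
    varFun u y' = varFun u y + (eVariationOn u (Icc y y')).toReal := by
  rw [varFun, varFun, ← Iic_union_Icc_eq_Iic h,
    eVariationOn.union u (isGreatest_Iic) (isLeast_Icc h),
    ENNReal.toReal_add (eVariationOn_ne_top hbv _) (eVariationOn_ne_top hbv _)]

lemma varFun_mono (hbv : BoundedVariationOn u univ) : Monotone (varFun u) := fun y y' h => by
  rw [varFun_add hbv h]
  exact le_add_of_nonneg_right ENNReal.toReal_nonneg

lemma abs_sub_le_varFun (hbv : BoundedVariationOn u univ) {y y' : ℝ} (h : y ≤ y') :
    |u y' - u y| ≤ varFun u y' - varFun u y := by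
  rw [varFun_add hbv h, add_sub_cancel_left, ← Real.dist_eq, dist_edist]
  exact ENNReal.toReal_mono (eVariationOn_ne_top hbv _)
    (eVariationOn.edist_le u (right_mem_Icc.2 h) (left_mem_Icc.2 h))

lemma varFun_nonneg (y : ℝ) : 0 ≤ varFun u y := ENNReal.toReal_nonneg

lemma varFun_le_totVar (hbv : BoundedVariationOn u univ) (y : ℝ) : varFun u y ≤ totVar u :=
  ENNReal.toReal_mono hbv (eVariationOn.mono u (subset_univ _))

lemma varFun_eq_of_eqOn (hbv : BoundedVariationOn u univ) {y y' c : ℝ} (h : y ≤ y')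
    (hc : ∀ z ∈ Icc y y', u z = c) : varFun u y' = varFun u y := by
  rw [varFun_add hbv h, eVariationOn.constant_on, ENNReal.toReal_zero, add_zero]
  rintro _ ⟨a, ha, rfl⟩ _ ⟨b, hb, rfl⟩
  rw [hc a ha, hc b hb]

lemma varFun_eq_add_abs (hbv : BoundedVariationOn u univ) {l x : ℝ}
    (h : ∀ y ∈ Ioo l x, u y = Function.leftLim u x) {y : ℝ} (hy : y ∈ Ioo l x) :
    varFun u x = varFun u y + |u x - Function.leftLim u x| := by
  have h1 : eVariationOn u (Iio x) = eVariationOn u (Iic y) := by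
    have : Iio x = Iic y ∪ Ico y x := by
      ext z
      simp only [mem_Iio, mem_union, mem_Iic, mem_Ico]
      constructor
      · intro hz
        rcases le_total z y with h | h
        · exact Or.inl h
        · exact Or.inr ⟨h, hz⟩
      · rintro (h | h)
        · exact h.trans_lt hy.2
        · exact h.2
    rw [this, eVariationOn.union u isGreatest_Iic (isLeast_Ico hy.2),
      eVariationOn.constant_on (s := Ico y x), add_zero]
    rintro _ ⟨a, ha, rfl⟩ _ ⟨b, hb, rfl⟩
    rw [h a ⟨hy.1.trans_le ha.1, ha.2⟩, h b ⟨hy.1.trans_le hb.1, hb.2⟩]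
  rw [varFun, varFun, hbv.eVariationOn_Iic_eq_Iio_add_edist, h1,
    ENNReal.toReal_add (eVariationOn_ne_top hbv _) (edist_ne_top _ _), ← dist_edist, Real.dist_eq]

end Variation

/-- A grid datum of bounded variation, with a positive grid size. -/
structure IsBVGridDatum (ε : ℝ) (u : ℝ → ℝ) : Prop extends IsGridDatum ε u where
  pos : 0 < ε
  bv : BoundedVariationOn u univ

/-! ### Enumeration of the initial waves. -/

namespace IsBVGridDatum

variable {ε : ℝ} {u : ℝ → ℝ}

lemma exists_right (hu : IsBVGridDatum ε u) (x : ℝ) : ∃ b > x, ∀ y ∈ Ico x b, u y = u x ∧ varFun u y = varFun u x := by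
  obtain ⟨b, hb, h⟩ := hu.toIsGridDatum.exists_right hu.pos x
  exact ⟨b, hb, fun y hy => ⟨h y hy, varFun_eq_of_eqOn hu.bv hy.1
    fun z hz => h z ⟨hz.1, hz.2.trans_lt hy.2⟩⟩⟩

lemma exists_left (hu : IsBVGridDatum ε u) (x : ℝ) : ∃ l < x, ∀ y ∈ Ioo l x, u y = Function.leftLim u x ∧
    varFun u x = varFun u y + |u x - Function.leftLim u x| := by
  obtain ⟨l, hl, h⟩ := hu.toIsGridDatum.exists_left hu.pos hu.bv x
  exact ⟨l, hl, fun y hy => ⟨h y hy, varFun_eq_add_abs hu.bv h hy⟩⟩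

lemma exists_support (hu : IsBVGridDatum ε u) : ∃ M : ℝ, (∀ x < -M, u x = 0) ∧ (∀ x, M ≤ x → u x = 0) ∧ 0 ≤ M := by
  obtain ⟨M, hM⟩ := hu.compactSupport.isBounded.subset_closedBall 0
  have h0 : ∀ x, M < |x| → u x = 0 := fun x hx => by
    apply image_eq_zero_of_notMem_tsupport
    intro hcon
    have := hM hcon
    rw [mem_closedBall_zero_iff, Real.norm_eq_abs] at this
    linarith
  refine ⟨|M| + 1, fun x hx => h0 x ?_, fun x hx => h0 x ?_, by positivity⟩
  · have := neg_le_abs x; have := le_abs_self M; linarith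
  · have := le_abs_self x; have := le_abs_self M; linarith

lemma exists_varFun_support (hu : IsBVGridDatum ε u) : ∃ M : ℝ, (∀ x < -M, u x = 0 ∧ varFun u x = 0) ∧
    (∀ x, M ≤ x → varFun u x = totVar u) := by
  obtain ⟨M, h1, h2, -⟩ := hu.exists_support
  refine ⟨M, fun x hx => ⟨h1 x hx, ?_⟩, fun x hx => ?_⟩
  · rw [varFun, eVariationOn.constant_on, ENNReal.toReal_zero]
    rintro _ ⟨a, ha, rfl⟩ _ ⟨b, hb, rfl⟩
    rw [h1 a (lt_of_le_of_lt ha hx), h1 b (lt_of_le_of_lt hb hx)]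
  · rw [varFun, totVar, ← Iic_union_Ici (a := x), eVariationOn.union u isGreatest_Iic isLeast_Ici,
      eVariationOn.constant_on (s := Ici x), add_zero]
    rintro _ ⟨a, ha, rfl⟩ _ ⟨b, hb, rfl⟩
    rw [h2 a (hx.trans ha), h2 b (hx.trans hb)]

lemma leftLim_grid (hu : IsBVGridDatum ε u) (x : ℝ) : ∃ k : ℤ, Function.leftLim u x = k * ε := by
  obtain ⟨l, hl, h⟩ := hu.exists_left x
  obtain ⟨y, hy⟩ := exists_between hl
  rw [← (h y hy).1]
  exact hu.grid y

/-- The jumps of `varFun u` are integer multiples of ε, so the fractional part of `varFun u / ε` is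
locally constant, hence constant; it vanishes on the left of the support. -/
lemma exists_varFun_eq (hu : IsBVGridDatum ε u) (x : ℝ) : ∃ k : ℕ, varFun u x = ε * k := by
  have hε := hu.pos
  have key : ∀ y y', Int.fract (varFun u y / ε) = Int.fract (varFun u y' / ε) := by
    refine eq_of_locally_eq (fun x => ?_) (fun x => ?_)
    · obtain ⟨b, hb, h⟩ := hu.exists_right x
      exact ⟨b, hb, fun y hy => by rw [(h y hy).2]⟩
    · obtain ⟨l, hl, h⟩ := hu.exists_left x
      refine ⟨l, hl, fun y hy => ?_⟩
      obtain ⟨k, hk⟩ := hu.grid x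
      obtain ⟨k', hk'⟩ := hu.leftLim_grid x
      have : varFun u x / ε = varFun u y / ε + (|k - k'| : ℤ) := by
        rw [(h y hy).2, hk, hk', ← sub_mul, abs_mul, abs_of_pos hε]
        push_cast
        field_simp
      rw [this, Int.fract_add_intCast]
  obtain ⟨M, hM, -⟩ := hu.exists_varFun_support
  have h0 := key x (-M - 1)
  rw [(hM (-M - 1) (by linarith)).2, zero_div, Int.fract_zero, Int.fract_eq_iff] at h0
  obtain ⟨-, -, z, hz⟩ := h0
  rw [sub_zero] at hz
  have hz0 : 0 ≤ z := by
    have : (0 : ℝ) ≤ z := by rw [← hz]; exact div_nonneg (varFun_nonneg x) hε.le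
    exact_mod_cast this
  obtain ⟨k, rfl⟩ := Int.eq_ofNat_of_zero_le hz0
  refine ⟨k, ?_⟩
  field_simp at hz
  rw [hz]
  push_cast
  ring

lemma card_waves (hu : IsBVGridDatum ε u) : ε * (waves ε u).card = totVar u := by
  obtain ⟨M, -, hM⟩ := hu.exists_varFun_support
  obtain ⟨k, hk⟩ := hu.exists_varFun_eq M
  rw [hM M le_rfl] at hk
  have : totVar u / ε = k := by rw [hk]; have := hu.pos.ne'; field_simp
  rw [waves, Nat.card_Icc, this, Nat.floor_natCast, hk]
  simp

lemma mem_waves (hu : IsBVGridDatum ε u) {s : ℕ} : s ∈ waves ε u ↔ 1 ≤ s ∧ ε * s ≤ totVar u := by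
  rw [← hu.card_waves, mul_le_mul_iff_right₀ hu.pos, Nat.cast_le, waves, Finset.mem_Icc,
    Nat.card_Icc, Nat.add_sub_cancel]

/-- `varFun u` is constant to the right of each point for a while, so the infimum is attained. The
support bounds make the set nonempty and bounded below. -/
lemma initPos_le_iff (hu : IsBVGridDatum ε u) {s : ℕ} (hs : s ∈ waves ε u) (x : ℝ) :
    initPos ε u s ≤ x ↔ ε * s ≤ varFun u x := by
  obtain ⟨h1, h2⟩ := hu.mem_waves.1 hs
  obtain ⟨M, hM, hM'⟩ := hu.exists_varFun_support
  have hpos : 0 < ε * s := mul_pos hu.pos (by exact_mod_cast h1)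
  have hbdd : BddBelow {x | ε * s ≤ varFun u x} := by
    refine ⟨-M, fun z hz => ?_⟩
    by_contra hcon
    have := (hM z (not_le.1 hcon)).2
    have hz' : ε * s ≤ varFun u z := hz
    linarith
  have hne : {x | ε * s ≤ varFun u x}.Nonempty := ⟨M, by
    change ε * s ≤ varFun u M
    rw [hM' M le_rfl]; exact h2⟩
  refine ⟨fun h => ?_, fun h => csInf_le hbdd h⟩
  by_contra hcon
  obtain ⟨b, hb, hb'⟩ := hu.exists_right x
  have : b ≤ initPos ε u s := by
    refine le_csInf hne fun z hz => ?_
    by_contra hzb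
    have hz' : ε * s ≤ varFun u z := hz
    rcases le_total z x with h3 | h3
    · exact hcon (hz'.trans (varFun_mono hu.bv h3))
    · rw [(hb' z ⟨h3, not_le.1 hzb⟩).2] at hz'
      exact hcon hz'
  have hb2 : x < b := hb
  linarith

lemma initPos_mono (hu : IsBVGridDatum ε u) {s s' : ℕ} (hs : s ∈ waves ε u) (hs' : s' ∈ waves ε u) (h : s ≤ s') :
    initPos ε u s ≤ initPos ε u s' := by
  rw [hu.initPos_le_iff hs]
  refine le_trans ?_ ((hu.initPos_le_iff hs' _).1 le_rfl)
  exact mul_le_mul_of_nonneg_left (by exact_mod_cast h) hu.pos.le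

/-- The number of waves which start on the left of `x`. -/
lemma varFun_eq_card (hu : IsBVGridDatum ε u) (x : ℝ) :
    varFun u x = ε * ((waves ε u).filter (initPos ε u · ≤ x)).card := by
  obtain ⟨k, hk⟩ := hu.exists_varFun_eq x
  have : (waves ε u).filter (initPos ε u · ≤ x) = Finset.Icc 1 k := by
    ext s
    rw [Finset.mem_filter, Finset.mem_Icc]
    constructor
    · rintro ⟨h1, h2⟩
      rw [hu.initPos_le_iff h1, hk, mul_le_mul_iff_right₀ hu.pos, Nat.cast_le] at h2
      exact ⟨(hu.mem_waves.1 h1).1, h2⟩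
    · rintro ⟨h1, h2⟩
      have h3 : ε * s ≤ varFun u x := by
        rw [hk, mul_le_mul_iff_right₀ hu.pos, Nat.cast_le]; exact h2
      have h4 : s ∈ waves ε u := hu.mem_waves.2 ⟨h1, h3.trans (varFun_le_totVar hu.bv x)⟩
      exact ⟨h4, (hu.initPos_le_iff h4 x).2 h3⟩
  rw [this, Nat.card_Icc, Nat.add_sub_cancel, hk]

lemma leftLim_varFun {l x : ℝ} (hl : ∀ y ∈ Ioo l x, u y = Function.leftLim u x ∧
    varFun u x = varFun u y + |u x - Function.leftLim u x|) {y : ℝ} (hy : y ∈ Ioo l x) :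
    Function.leftLim (varFun u) x = varFun u y := by
  refine leftLim_eq_of_eqOn (hy.1.trans hy.2) fun z hz => ?_
  have h1 := (hl y hy).2
  have h2 := (hl z hz).2
  linarith

lemma jump_ne_zero (hu : IsBVGridDatum ε u) {s : ℕ} (hs : s ∈ waves ε u) :
    u (initPos ε u s) - Function.leftLim u (initPos ε u s) ≠ 0 := by
  obtain ⟨l, hl, h⟩ := hu.exists_left (initPos ε u s)
  obtain ⟨y, hy⟩ := exists_between hl
  intro hcon
  have h1 := (h y hy).2
  rw [hcon, abs_zero, add_zero] at h1
  have h2 := (hu.initPos_le_iff hs (initPos ε u s)).1 le_rfl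
  rw [h1, ← hu.initPos_le_iff hs] at h2
  exact absurd hy.2 (not_lt.2 h2)

lemma waveSign_eq (hu : IsBVGridDatum ε u) {s : ℕ} (hs : s ∈ waves ε u) : waveSign ε u s = 1 ∨ waveSign ε u s = -1 := by
  have := hu.jump_ne_zero hs
  rw [waveSign]
  rcases lt_or_gt_of_ne this with h | h
  · exact Or.inr (Real.sign_of_neg h)
  · exact Or.inl (Real.sign_of_pos h)

lemma waveSign_congr {s s' : ℕ} (h : initPos ε u s = initPos ε u s') :
    waveSign ε u s = waveSign ε u s' := by
  rw [waveSign, waveSign, h]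

lemma waveSign_mul_abs {s : ℕ} : waveSign ε u s *
    |u (initPos ε u s) - Function.leftLim u (initPos ε u s)| =
      u (initPos ε u s) - Function.leftLim u (initPos ε u s) := by
  rw [waveSign]
  rcases lt_trichotomy (u (initPos ε u s) - Function.leftLim u (initPos ε u s)) 0 with h | h | h
  · rw [Real.sign_of_neg h, abs_of_neg h]; ring
  · rw [h]; simp
  · rw [Real.sign_of_pos h, abs_of_pos h]; ring

/-- Comparison of the waves on the left of `x` with the waves slightly on the left of `x`. -/
lemma mem_filter_left (hu : IsBVGridDatum ε u) {l x : ℝ} (hl : ∀ y ∈ Ioo l x, u y = Function.leftLim u x ∧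
    varFun u x = varFun u y + |u x - Function.leftLim u x|) {y : ℝ} (hy : y ∈ Ioo l x) {q : ℕ}
    (hq : q ∈ waves ε u) : initPos ε u q ≤ x ↔ initPos ε u q ≤ y ∨ initPos ε u q = x := by
  constructor
  · intro h
    by_cases hlt : initPos ε u q = x
    · exact Or.inr hlt
    · left
      set z := max (initPos ε u q) y with hz
      have hzI : z ∈ Ioo l x := ⟨hy.1.trans_le (le_max_right _ _),
        max_lt (lt_of_le_of_ne h hlt) hy.2⟩
      have h1 : varFun u z = varFun u y := by
        have e₁ := (hl y hy).2
        have e₂ := (hl z hzI).2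
        linarith
      rw [hu.initPos_le_iff hq, ← h1, ← hu.initPos_le_iff hq]
      exact le_max_left _ _
  · rintro (h | h)
    · exact h.trans hy.2.le
    · exact h.le

/-- The two sides have the same jumps and both vanish on the far left. At `x`, the number of
starting waves is the size of the jump over ε, and all of them carry its sign. -/
lemma eq_sum (hu : IsBVGridDatum ε u) (x : ℝ) : u x = ε * ∑ s ∈ waves ε u with initPos ε u s ≤ x, waveSign ε u s := by
  classical
  set F : ℝ → ℝ := fun x => u x - ε * ∑ s ∈ waves ε u with initPos ε u s ≤ x, waveSign ε u s
    with hF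
  have key : ∀ y y', F y = F y' := by
    refine eq_of_locally_eq (fun x => ?_) (fun x => ?_)
    · obtain ⟨b, hb, h⟩ := hu.exists_right x
      refine ⟨b, hb, fun y hy => ?_⟩
      have : (waves ε u).filter (initPos ε u · ≤ y) = (waves ε u).filter (initPos ε u · ≤ x) :=
        Finset.filter_congr fun q hq => by
          rw [hu.initPos_le_iff hq, hu.initPos_le_iff hq, (h y hy).2]
      simp only [hF, this, (h y hy).1]
    · obtain ⟨l, hl, h⟩ := hu.exists_left x
      refine ⟨l, hl, fun y hy => ?_⟩
      have hunion : (waves ε u).filter (initPos ε u · ≤ x) =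
          (waves ε u).filter (initPos ε u · ≤ y) ∪ (waves ε u).filter (initPos ε u · = x) := by
        rw [← Finset.filter_or]
        exact Finset.filter_congr fun q hq => hu.mem_filter_left h hy hq
      have hdisj : Disjoint ((waves ε u).filter (initPos ε u · ≤ y))
          ((waves ε u).filter (initPos ε u · = x)) := by
        rw [Finset.disjoint_filter]
        rintro q - h1 h2
        rw [h2] at h1
        exact absurd hy.2 (not_lt.2 h1)
      have hcard := (h y hy).2
      rw [hu.varFun_eq_card, hu.varFun_eq_card y, hunion, Finset.card_union_of_disjoint hdisj]
        at hcard
      push_cast at hcard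
      have hcard' : ε * ((waves ε u).filter (initPos ε u · = x)).card =
          |u x - Function.leftLim u x| := by linarith
      have hsum : ε * ∑ s ∈ waves ε u with initPos ε u s = x, waveSign ε u s =
          u x - Function.leftLim u x := by
        rcases ((waves ε u).filter (initPos ε u · = x)).eq_empty_or_nonempty with he | ⟨s, hs⟩
        · rw [he, Finset.card_empty, Nat.cast_zero, mul_zero] at hcard'
          rw [he, Finset.sum_empty, mul_zero, abs_eq_zero.1 hcard'.symm]
        · obtain ⟨-, hsx⟩ := Finset.mem_filter.1 hs
          rw [Finset.sum_congr rfl (g := fun _ => waveSign ε u s) fun q hq =>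
            waveSign_congr ((Finset.mem_filter.1 hq).2.trans hsx.symm), Finset.sum_const,
            nsmul_eq_mul, ← mul_assoc, hcard', mul_comm]
          have := waveSign_mul_abs (ε := ε) (u := u) (s := s)
          rwa [hsx] at this
      simp only [hF, hunion, Finset.sum_union hdisj, mul_add, hsum, (h y hy).1]
      ring
  obtain ⟨M, hM, -⟩ := hu.exists_varFun_support
  have h0 := key x (-M - 1)
  have hM1 := hM (-M - 1) (by linarith)
  have hemp : (waves ε u).filter (initPos ε u · ≤ -M - 1) = ∅ := by
    refine Finset.filter_eq_empty_iff.2 fun q hq hcon => ?_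
    rw [hu.initPos_le_iff hq, hM1.2] at hcon
    have h1 := (hu.mem_waves.1 hq).1
    have : 0 < ε * q := mul_pos hu.pos (by exact_mod_cast h1)
    linarith
  simp only [hF, hemp, hM1.1, Finset.sum_empty] at h0
  linarith

/-- The waves up to `s` are those which start on the left of its position, whose signs sum to the
left limit, and the first ones of its own jump, which all have the sign of `s`. Their total number
is `s`, since labels start from 1. -/
lemma rightState_eq (hu : IsBVGridDatum ε u) {s : ℕ} (hs : s ∈ waves ε u) :
    rightState ε u s = ε * ∑ q ∈ waves ε u with q ≤ s, waveSign ε u q := by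
  classical
  set x := initPos ε u s with hx
  obtain ⟨l, hl, h⟩ := hu.exists_left x
  obtain ⟨y, hy⟩ := exists_between hl
  have hys : varFun u y < ε * s := by
    by_contra hcon
    rw [not_lt, ← hu.initPos_le_iff hs] at hcon
    exact absurd hy.2 (not_lt.2 hcon)
  have hle : ∀ q ∈ waves ε u, initPos ε u q ≤ y → q ≤ s := fun q hq h1 => by
    rw [hu.initPos_le_iff hq] at h1
    have := h1.trans hys.le
    rw [mul_le_mul_iff_right₀ hu.pos, Nat.cast_le] at this
    exact this
  have hunion : (waves ε u).filter (· ≤ s) = (waves ε u).filter (initPos ε u · ≤ y) ∪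
      (waves ε u).filter (fun q => q ≤ s ∧ initPos ε u q = x) := by
    rw [← Finset.filter_or]
    refine Finset.filter_congr fun q hq => ⟨fun h1 => ?_, fun h1 => ?_⟩
    · rcases (hu.mem_filter_left h hy hq).1 (hu.initPos_mono hq hs h1) with h2 | h2
      · exact Or.inl h2
      · exact Or.inr ⟨h1, h2⟩
    · rcases h1 with h1 | h1
      · exact hle q hq h1
      · exact h1.1
  have hdisj : Disjoint ((waves ε u).filter (initPos ε u · ≤ y))
      ((waves ε u).filter (fun q => q ≤ s ∧ initPos ε u q = x)) := by
    rw [Finset.disjoint_filter]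
    rintro q - h1 ⟨-, h2⟩
    rw [h2] at h1
    exact absurd hy.2 (not_lt.2 h1)
  have hcard : (waves ε u).filter (· ≤ s) = Finset.Icc 1 s := by
    ext q
    rw [Finset.mem_filter, Finset.mem_Icc]
    constructor
    · rintro ⟨h1, h2⟩
      exact ⟨(hu.mem_waves.1 h1).1, h2⟩
    · rintro ⟨h1, h2⟩
      refine ⟨hu.mem_waves.2 ⟨h1, le_trans ?_ (hu.mem_waves.1 hs).2⟩, h2⟩
      exact mul_le_mul_of_nonneg_left (by exact_mod_cast h2) hu.pos.le
  have hc := congrArg Finset.card hcard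
  rw [hunion, Finset.card_union_of_disjoint hdisj, Nat.card_Icc, Nat.add_sub_cancel] at hc
  have hc' : (((waves ε u).filter (initPos ε u · ≤ y)).card : ℝ) +
      ((waves ε u).filter (fun q => q ≤ s ∧ initPos ε u q = x)).card = s := by exact_mod_cast hc
  rw [rightState, ← hx, leftLim_varFun h hy, hunion, Finset.sum_union hdisj, mul_add,
    ← hu.eq_sum y, (h y hy).1, hu.varFun_eq_card, Finset.sum_congr rfl
      (g := fun _ => waveSign ε u s) fun q (hq : q ∈ (waves ε u).filter
      (fun q => q ≤ s ∧ initPos ε u q = x)) => waveSign_congr ((Finset.mem_filter.1 hq).2.2),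
    Finset.sum_const, nsmul_eq_mul, ← hc']
  ring

/-- The cell of a wave lies between two values of the datum. -/
lemma exists_cell_bounds (hu : IsBVGridDatum ε u) {s : ℕ} (hs : s ∈ waves ε u) :
    ∃ a b, u a ≤ cellLeft ε (waveSign ε u s) (rightState ε u s) ∧
      cellLeft ε (waveSign ε u s) (rightState ε u s) + ε ≤ u b := by
  set x := initPos ε u s with hx
  obtain ⟨l, hl, h⟩ := hu.exists_left x
  obtain ⟨y, hy⟩ := exists_between hl
  have hys : varFun u y + ε ≤ ε * s := by
    obtain ⟨k, hk⟩ := hu.exists_varFun_eq y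
    have hlt : varFun u y < ε * s := by
      by_contra hcon
      rw [not_lt, ← hu.initPos_le_iff hs] at hcon
      exact absurd hy.2 (not_lt.2 hcon)
    rw [hk, mul_lt_mul_iff_right₀ hu.pos, Nat.cast_lt] at hlt
    have : (k : ℝ) + 1 ≤ s := by exact_mod_cast hlt
    rw [hk]
    nlinarith [hu.pos]
  have hsx : ε * s ≤ varFun u x := (hu.initPos_le_iff hs x).1 le_rfl
  rw [(h y hy).2] at hsx
  have habs := waveSign_mul_abs (ε := ε) (u := u) (s := s)
  rw [← hx] at habs
  rw [rightState, ← hx, leftLim_varFun h hy, cellLeft]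
  rcases hu.waveSign_eq hs with h1 | h1
  · rw [h1] at habs ⊢
    refine ⟨y, x, ?_, ?_⟩
    · rw [if_pos one_pos, (h y hy).1]; linarith
    · rw [if_pos one_pos]; linarith
  · rw [h1] at habs ⊢
    refine ⟨x, y, ?_, ?_⟩
    · rw [if_neg (by norm_num)]; linarith
    · rw [if_neg (by norm_num), (h y hy).1]; linarith

lemma leftLim_ne_iff (hu : IsBVGridDatum ε u) (x : ℝ) :
    Function.leftLim u x ≠ u x ↔ ∃ s ∈ waves ε u, initPos ε u s = x := by
  constructor
  · intro hne
    obtain ⟨l, hl, h⟩ := hu.exists_left x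
    obtain ⟨y, hy⟩ := exists_between hl
    have hlt : varFun u y < varFun u x := by
      rw [(h y hy).2]
      have : 0 < |u x - Function.leftLim u x| := abs_pos.2 (sub_ne_zero.2 hne.symm)
      linarith
    by_contra hcon
    push Not at hcon
    have hfil : (waves ε u).filter (initPos ε u · ≤ x) = (waves ε u).filter (initPos ε u · ≤ y) :=
      Finset.filter_congr fun q hq => by
        rw [hu.mem_filter_left h hy hq, or_iff_left (hcon q hq)]
    rw [hu.varFun_eq_card, hu.varFun_eq_card x, hfil] at hlt
    exact lt_irrefl _ hlt
  · rintro ⟨s, hs, rfl⟩ hcon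
    exact hu.jump_ne_zero hs (by rw [hcon, sub_self])

end IsBVGridDatum

/-! ### Profiles carried by waves -/

open Filter Topology in
lemma leftLim_step (A : Finset ℕ) (p h : ℕ → ℝ) (c ε x : ℝ) :
    Function.leftLim (fun y => c + ε * ∑ s ∈ A with p s ≤ y, h s) x =
      c + ε * ∑ s ∈ A with p s < x, h s := by
  apply leftLim_eq_of_tendsto
  have key : ∀ᶠ y in 𝓝[<] x, ∀ s ∈ A, (p s ≤ y ↔ p s < x) := by
    refine (eventually_all_finset A).2 fun s _ => ?_
    by_cases hs : p s < x
    · filter_upwards [Ioo_mem_nhdsLT hs] with y hy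
      exact ⟨fun _ => hs, fun _ => hy.1.le⟩
    · filter_upwards [self_mem_nhdsWithin] with y hy
      exact ⟨fun h' => lt_of_le_of_lt h' hy, fun h' => absurd h' hs⟩
  refine tendsto_const_nhds.congr' ?_
  filter_upwards [key] with y hy
  rw [Finset.filter_congr hy]

lemma exists_int_sum_sign {A : Finset ℕ} {S : ℕ → ℝ} (hS : ∀ s ∈ A, S s = 1 ∨ S s = -1) :
    ∃ m : ℤ, ∑ s ∈ A, S s = m := by
  classical
  induction A using Finset.induction_on with
  | empty => exact ⟨0, by simp⟩
  | insert a A ha ih =>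
    obtain ⟨m, hm⟩ := ih fun s hs => hS s (Finset.mem_insert_of_mem hs)
    rw [Finset.sum_insert ha, hm]
    rcases hS a (Finset.mem_insert_self _ _) with h | h
    · exact ⟨1 + m, by rw [h]; push_cast; ring⟩
    · exact ⟨-1 + m, by rw [h]; push_cast; ring⟩

lemma sum_filter_le_eq_lt_add_eq (A : Finset ℕ) (p S : ℕ → ℝ) (x : ℝ) :
    ∑ s ∈ A with p s ≤ x, S s = ∑ s ∈ A with p s < x, S s + ∑ s ∈ A with p s = x, S s := by
  classical
  rw [← Finset.sum_union]
  · rw [← Finset.filter_or]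
    simp only [le_iff_lt_or_eq]
  · rw [Finset.disjoint_filter]
    intro q _ h1 h2
    exact h1.ne h2

/-- The waves up to `s`, when the positions `p` are nondecreasing. -/
lemma sum_filter_le_eq_of_mono {A : Finset ℕ} {p : ℕ → ℝ}
    (hp : ∀ s ∈ A, ∀ s' ∈ A, s ≤ s' → p s ≤ p s') (S : ℕ → ℝ) {s : ℕ} (hs : s ∈ A) :
    ∑ q ∈ A with q ≤ s, S q = ∑ q ∈ A with p q < p s, S q +
      ∑ q ∈ A.filter (p · = p s) with q ≤ s, S q := by
  classical
  rw [Finset.filter_filter, ← Finset.sum_union]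
  · rw [← Finset.filter_or]
    congr 1
    refine Finset.filter_congr fun q hq => ⟨fun h => ?_, fun h => ?_⟩
    · rcases (hp q hq s hs h).lt_or_eq with h1 | h1
      · exact Or.inl h1
      · exact Or.inr ⟨h1, h⟩
    · rcases h with h | h
      · by_contra hcon
        have := hp s hs q hq (by omega)
        linarith
      · exact h.2
  · rw [Finset.disjoint_filter]
    intro q _ h1 h2
    exact h1.ne h2.1

lemma card_filter_le_eq_rank {B : Finset ℕ} {s : ℕ} (hs : s ∈ B) :
    (B.filter (· ≤ s)).card = rank B s + 1 := by
  classical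
  have : B.filter (· ≤ s) = insert s (B.filter (· < s)) := by
    ext q
    simp only [Finset.mem_filter, Finset.mem_insert]
    constructor
    · rintro ⟨h1, h2⟩
      rcases h2.lt_or_eq with h | h
      · exact Or.inr ⟨h1, h⟩
      · exact Or.inl h
    · rintro (rfl | ⟨h1, h2⟩)
      · exact ⟨hs, le_rfl⟩
      · exact ⟨h1, h2.le⟩
  rw [this, Finset.card_insert_of_notMem (by simp), rank]

/-- The profile `w` is carried by the waves `A` with signs `S`, right states `R` and positions `X`;
`σ` are the speeds which the Riemann problems of the profiles `(w, u)` give to the waves. -/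
structure WaveState (f : ℝ → ℝ → ℝ) (ε : ℝ) (S R : ℕ → ℝ) (A : Finset ℕ) (X σ : ℕ → ℝ)
    (w u : ℝ → ℝ) : Prop where
  pos : 0 < ε
  sign : ∀ s ∈ A, S s = 1 ∨ S s = -1
  profile : ∀ x, w x = ε * ∑ s ∈ A with X s ≤ x, S s
  mono : ∀ s ∈ A, ∀ s' ∈ A, s ≤ s' → X s ≤ X s'
  state : ∀ s ∈ A, R s = ε * ∑ q ∈ A with q ≤ s, S q
  same_sign : ∀ s ∈ A, ∀ s' ∈ A, X s = X s' → S s = S s'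
  speed : ∀ s ∈ A, σ s = cellSpeed ε (fun z => f z (u (X s))) (Function.leftLim w (X s)) (w (X s))
    (cellLeft ε (S s) (R s))

/-! ### Riemann solutions and wavefronts in terms of waves. -/

namespace WaveState

variable {f : ℝ → ℝ → ℝ} {ε : ℝ} {S R : ℕ → ℝ} {A : Finset ℕ} {X σ : ℕ → ℝ} {w u : ℝ → ℝ}

lemma leftLim_eq (h : WaveState f ε S R A X σ w u) (x : ℝ) :
    Function.leftLim w x = ε * ∑ s ∈ A with X s < x, S s := by
  have : w = fun y => 0 + ε * ∑ s ∈ A with X s ≤ y, S s := by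
    funext y; rw [h.profile, zero_add]
  rw [this, leftLim_step, zero_add]

lemma exists_leftLim_eq (h : WaveState f ε S R A X σ w u) (x : ℝ) :
    ∃ m : ℤ, Function.leftLim w x = ε * m := by
  obtain ⟨m, hm⟩ := exists_int_sum_sign (A := A.filter (X · < x)) (S := S)
    fun s hs => h.sign s (Finset.mem_filter.1 hs).1
  exact ⟨m, by rw [h.leftLim_eq, hm]⟩

lemma sum_eq_of_subset (h : WaveState f ε S R A X σ w u) {s : ℕ} (hs : s ∈ A) {B : Finset ℕ}
    (hB : B ⊆ A.filter (X · = X s)) : ∑ q ∈ B, S q = S s * B.card := by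
  rw [Finset.sum_congr rfl (g := fun _ => S s) fun q hq => h.same_sign q
    (Finset.mem_filter.1 (hB hq)).1 s hs (Finset.mem_filter.1 (hB hq)).2, Finset.sum_const,
    nsmul_eq_mul, mul_comm]

lemma apply_eq (h : WaveState f ε S R A X σ w u) {s : ℕ} (hs : s ∈ A) :
    w (X s) = Function.leftLim w (X s) + S s * (ε * (A.filter (X · = X s)).card) := by
  rw [h.profile, sum_filter_le_eq_lt_add_eq, mul_add, ← h.leftLim_eq,
    h.sum_eq_of_subset hs (Finset.Subset.refl _)]
  ring

lemma right_eq (h : WaveState f ε S R A X σ w u) {s : ℕ} (hs : s ∈ A) :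
    R s = Function.leftLim w (X s) + S s * (ε * (rank (A.filter (X · = X s)) s + 1 : ℕ)) := by
  rw [h.state s hs, sum_filter_le_eq_of_mono h.mono S hs, mul_add, ← h.leftLim_eq,
    h.sum_eq_of_subset hs (Finset.filter_subset _ _),
    card_filter_le_eq_rank (by simp [hs])]
  ring

/-- At one position all waves have the same sign, and the wave of rank k occupies the k-th cell
after the left state, so the envelope of the Riemann problem lists their speeds in order. -/
lemma isEnvelope (h : WaveState f ε S R A X σ w u) (x : ℝ) :
    IsEnvelope (A.filter (X · = x)) σ
      fun s => cellSlope ε (fun z => f z (u x)) (cellLeft ε (S s) (R s)) := by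
  rcases (A.filter (X · = x)).eq_empty_or_nonempty with he | ⟨s, hs⟩
  · rw [he]
    exact ⟨by simp, by simp, by simp⟩
  obtain ⟨hsA, hsx⟩ := Finset.mem_filter.1 hs
  obtain ⟨m, hm⟩ := h.exists_leftLim_eq x
  obtain ⟨E, γ, hE, hk⟩ := exists_isSeqEnvelope h.pos (fun z => f z (u x)) (h.sign s hsA) m
    (A.filter (X · = x)).card
  have hw := h.apply_eq hsA
  rw [hsx, hm] at hw
  have hR : ∀ q ∈ A.filter (X · = x), S q = S s ∧
      R q = ε * m + S s * (ε * (rank (A.filter (X · = x)) q + 1 : ℕ)) := fun q hq => by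
    obtain ⟨hqA, hqx⟩ := Finset.mem_filter.1 hq
    have h1 := h.same_sign q hqA s hsA (hqx.trans hsx.symm)
    have h2 := h.right_eq hqA
    rw [h1, hqx, hm] at h2
    exact ⟨h1, h2⟩
  refine hE.isEnvelope h.pos (fun q hq => ?_) (fun q hq => ?_)
  · obtain ⟨hqA, hqx⟩ := Finset.mem_filter.1 hq
    rw [← (hk _ (rank_lt hq)).1, h.speed q hqA, hqx, hm, hw, (hR q hq).1, (hR q hq).2]
  · rw [← (hk _ (rank_lt hq)).2, (hR q hq).1, (hR q hq).2]

lemma fan_eq (h : WaveState f ε S R A X σ w u) (y ξ : ℝ) :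
    fan f ε w u y ξ = Function.leftLim w y +
      ε * ∑ s ∈ A.filter (X · = y) with σ s ≤ ξ, S s := by
  classical
  obtain ⟨m, hm⟩ := h.exists_leftLim_eq y
  rw [fan]
  rcases (A.filter (X · = y)).eq_empty_or_nonempty with he | ⟨s, hs⟩
  · have hw : w y = ε * m + 1 * (ε * (0 : ℕ)) := by
      rw [h.profile, sum_filter_le_eq_lt_add_eq, he, mul_add, ← h.leftLim_eq, hm]
      simp
    rw [he, hm, hw, riemann_eq h.pos _ (Or.inl rfl)]
    simp
  obtain ⟨hsA, hsy⟩ := Finset.mem_filter.1 hs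
  have hw := h.apply_eq hsA
  rw [hsy, hm] at hw
  rw [hm, hw, riemann_eq h.pos _ (h.sign s hsA)]
  rw [h.sum_eq_of_subset hsA (by rw [hsy]; exact Finset.filter_subset _ _),
    Finset.card_filter _ (Finset.range _), Finset.card_filter _ (A.filter (X · = y)),
    ← sum_rank (A.filter (X · = y))]
  have : ∀ q ∈ A.filter (X · = y), (if cellSpeed ε (fun z => f z (u y)) (ε * m)
      (ε * m + S s * (ε * (A.filter (X · = y)).card))
      (cellLeft ε (S s) (ε * m + S s * (ε * (rank (A.filter (X · = y)) q + 1 : ℕ)))) ≤ ξ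
      then 1 else 0) = if σ q ≤ ξ then 1 else 0 := fun q hq => by
    obtain ⟨hqA, hqy⟩ := Finset.mem_filter.1 hq
    have h1 := h.same_sign q hqA s hsA (hqy.trans hsy.symm)
    have h2 := h.right_eq hqA
    rw [h1, hqy, hm] at h2
    rw [h.speed q hqA, hqy, hm, hw, h1, h2]
  rw [Finset.sum_congr rfl this]
  ring

/-- Each fan is the sum of its waves with speed at most `(x - y) / τ`, that is, of those which have
arrived at or before `x`. Summing over origins regroups all the waves. -/
lemma propagate_eq (h : WaveState f ε S R A X σ w u) {τ : ℝ} (hτ : 0 < τ) (x : ℝ) :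
    propagate f ε w u τ x = ε * ∑ s ∈ A with X s + σ s * τ ≤ x, S s := by
  classical
  have h1 : ∀ y, fan f ε w u y ((x - y) / τ) - Function.leftLim w y =
      ε * ∑ s ∈ A with X s = y, if X s + σ s * τ ≤ x then S s else 0 := fun y => by
    rw [h.fan_eq, add_sub_cancel_left, Finset.sum_filter]
    congr 1
    refine Finset.sum_congr rfl fun s hs => ?_
    have hiff : σ s ≤ (x - y) / τ ↔ X s + σ s * τ ≤ x := by
      rw [(Finset.mem_filter.1 hs).2, le_div_iff₀ hτ, le_sub_iff_add_le, add_comm]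
    simp only [hiff]
  rw [propagate]
  simp only [h1]
  rw [finsum_eq_sum_of_support_subset (s := A.image X), ← Finset.mul_sum,
    Finset.sum_fiberwise_of_maps_to fun s hs => Finset.mem_image_of_mem X hs, ← Finset.sum_filter]
  intro y hy
  rw [Function.mem_support] at hy
  by_contra hcon
  apply hy
  rw [Finset.filter_false_of_mem, Finset.sum_empty, mul_zero]
  intro s hs hsy
  exact hcon (by rw [← hsy]; exact Finset.mem_coe.2 (Finset.mem_image_of_mem X hs))

/-- The jump of the fan at speed `c` is ε times the sum of the signs of its waves with that speed.
They are equal, so the sum cannot vanish when there is such a wave. -/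
lemma mem_fronts_second (h : WaveState f ε S R A X σ w u) (o c : ℝ) :
    (⟨.second, o, c⟩ : Front) ∈ fronts f ε w u ↔ ∃ s ∈ A, X s = o ∧ σ s = c := by
  have hfan : fan f ε w u o = fun ξ => Function.leftLim w o +
      ε * ∑ s ∈ A.filter (X · = o) with σ s ≤ ξ, S s := funext fun ξ => h.fan_eq o ξ
  change Function.leftLim (fan f ε w u o) c ≠ fan f ε w u o c ↔ _
  rw [hfan, leftLim_step]
  beta_reduce
  rw [sum_filter_le_eq_lt_add_eq, mul_add, ← add_assoc, ne_eq, left_eq_add,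
    mul_eq_zero, not_or]
  constructor
  · rintro ⟨-, h2⟩
    obtain ⟨s, hs, -⟩ := Finset.exists_ne_zero_of_sum_ne_zero h2
    simp only [Finset.mem_filter] at hs
    exact ⟨s, hs.1.1, hs.1.2, hs.2⟩
  · rintro ⟨s, hs, rfl, rfl⟩
    refine ⟨h.pos.ne', ?_⟩
    rw [h.sum_eq_of_subset hs (Finset.filter_subset _ _)]
    refine mul_ne_zero ?_ ?_
    · rcases h.sign s hs with h1 | h1 <;> rw [h1] <;> norm_num
    · have : 0 < ((A.filter (X · = X s)).filter (σ · = σ s)).card :=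
        Finset.card_pos.2 ⟨s, by simp [hs]⟩
      exact_mod_cast this.ne'

lemma lt_speed (h : WaveState f ε S R A X σ w u) {b : ℝ}
    (hb : ∀ s ∈ A, ∀ y, b < cellSlope ε (fun z => f z (u y)) (cellLeft ε (S s) (R s)))
    {s : ℕ} (hs : s ∈ A) : b < σ s := by
  have hsB : s ∈ A.filter (X · = X s) := by simp [hs]
  obtain ⟨q, hq, hmin⟩ := (A.filter (X · = X s)).exists_min_image
    (fun s' => cellSlope ε (fun z => f z (u (X s))) (cellLeft ε (S s') (R s'))) ⟨s, hsB⟩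
  refine (hb q (Finset.mem_filter.1 hq).1 (X s)).trans_le
    ((h.isEnvelope (X s)).lower_bound (fun k => ?_) hsB)
  rw [mul_comm, ← nsmul_eq_mul]
  exact Finset.card_nsmul_le_sum _ _ _ fun q' hq' => hmin q' (Finset.mem_filter.1 hq').1

end WaveState

/-! ### Cancellation of waves -/

lemma card_filter_rank_lt (B : Finset ℕ) {n : ℕ} (hn : n ≤ B.card) :
    (B.filter (rank B · < n)).card = n := by
  rw [Finset.card_filter, sum_rank B (fun i => if i < n then 1 else 0), ← Finset.card_filter]
  have : (Finset.range B.card).filter (· < n) = Finset.range n := by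
    ext i
    simp only [Finset.mem_filter, Finset.mem_range]
    omega
  rw [this, Finset.card_range]

lemma card_filter_le_rank (B : Finset ℕ) {n : ℕ} (hn : n ≤ B.card) :
    (B.filter (n ≤ rank B ·)).card + n = B.card := by
  have h1 := B.card_filter_add_card_filter_not (rank B · < n)
  rw [card_filter_rank_lt B hn] at h1
  simp only [not_lt] at h1
  omega

/-- The wave `s` of the incoming group `P` lies in the outgoing jump. -/
def Remains (P : Finset ℕ) (S : ℕ → ℝ) (s : ℕ) : Prop :=
  1 ≤ S s * ∑ q ∈ P with q ≤ s, S q ∧ S s * ∑ q ∈ P with q ≤ s, S q ≤ S s * ∑ q ∈ P, S q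

/-- Two incoming groups, the first one with sign `c` and the second one with sign `-c`: the
remaining waves are an initial segment of the first group or a final segment of the second one. -/
lemma remains_spec {P P' : Finset ℕ} {S : ℕ → ℝ} {c : ℝ} {k : ℕ} (hc : c = 1 ∨ c = -1)
    (hL : ∀ q ∈ P, q < k → S q = c) (hR : ∀ q ∈ P, k ≤ q → S q = -c) (hsub : P' ⊆ P)
    (hP' : ∀ s ∈ P, s ∈ P' ↔ Remains P S s) :
    (∑ q ∈ P', S q = ∑ q ∈ P, S q) ∧
    (∀ s ∈ P', ∑ q ∈ P' with q ≤ s, S q = ∑ q ∈ P with q ≤ s, S q) ∧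
    ((∀ s ∈ P', s < k ∧ ∀ q ∈ P, q ≤ s → q ∈ P') ∨
      (∀ s ∈ P', k ≤ s ∧ ∀ q ∈ P, s ≤ q → q ∈ P')) ∧
    (P.filter (k ≤ ·) = ∅ → P' = P) := by
  classical
  set L := P.filter (· < k) with hLdef
  set U := P.filter (k ≤ ·) with hUdef
  have hcc : c * c = 1 := by rcases hc with h | h <;> rw [h] <;> norm_num
  have sumL : ∀ B ⊆ L, ∑ q ∈ B, S q = c * B.card := fun B hB => by
    rw [Finset.sum_congr rfl (g := fun _ => c) fun q hq => hL q
      (Finset.mem_filter.1 (hB hq)).1 (Finset.mem_filter.1 (hB hq)).2, Finset.sum_const,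
      nsmul_eq_mul, mul_comm]
  have sumU : ∀ B ⊆ U, ∑ q ∈ B, S q = -c * B.card := fun B hB => by
    rw [Finset.sum_congr rfl (g := fun _ => -c) fun q hq => hR q
      (Finset.mem_filter.1 (hB hq)).1 (Finset.mem_filter.1 (hB hq)).2, Finset.sum_const,
      nsmul_eq_mul, mul_comm]
  have hsplit : ∀ (p : ℕ → Prop) [DecidablePred p], ∑ q ∈ P with p q, S q =
      c * (L.filter p).card - c * (U.filter p).card := fun p _ => by
    have e₁ : (P.filter p).filter (· < k) = L.filter p := Finset.filter_comm _ _ _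
    have e₂ : (P.filter p).filter (k ≤ ·) = U.filter p := Finset.filter_comm _ _ _
    rw [← sum_filter_lt_add_ge (P.filter p) S k, e₁, e₂, sumL _ (Finset.filter_subset _ _), sumU _ (Finset.filter_subset _ _)]
    ring
  have htot : ∑ q ∈ P, S q = c * L.card - c * U.card := by
    rw [← sum_filter_lt_add_ge P S k, sumL _ (Finset.Subset.refl _), sumU _ (Finset.Subset.refl _)]
    ring
  have hNL : ∀ s ∈ L, ∑ q ∈ P with q ≤ s, S q = c * (rank L s + 1 : ℕ) := fun s hs => by
    have : U.filter (· ≤ s) = ∅ := by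
      refine Finset.filter_eq_empty_iff.2 fun q hq => ?_
      have h1 := (Finset.mem_filter.1 hq).2
      have h2 := (Finset.mem_filter.1 hs).2
      omega
    rw [hsplit, card_filter_le_eq_rank hs, this]
    simp
  have hNU : ∀ s ∈ U, ∑ q ∈ P with q ≤ s, S q = c * L.card - c * (rank U s + 1 : ℕ) :=
    fun s hs => by
    have : L.filter (· ≤ s) = L := by
      refine Finset.filter_true_of_mem fun q hq => ?_
      have h1 := (Finset.mem_filter.1 hq).2
      have h2 := (Finset.mem_filter.1 hs).2
      omega
    rw [hsplit, card_filter_le_eq_rank hs, this]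
  -- The partial sums along the first group rise one by one; a wave of `L` fits below the total
  -- exactly when at least `U.card` waves of `L` follow it.
  have hmemL : ∀ s ∈ L, s ∈ P' ↔ rank L s + 1 + U.card ≤ L.card := fun s hs => by
    obtain ⟨h1, h2⟩ := Finset.mem_filter.1 hs
    rw [hP' s h1, Remains, hNL s hs, htot, hL s h1 h2, mul_sub, ← mul_assoc, ← mul_assoc,
      ← mul_assoc, hcc, one_mul, one_mul, one_mul]
    rw [le_sub_iff_add_le]
    norm_cast
    omega
  -- The first `L.card` waves of the second group undo the first group, and only the later ones can
  -- remain.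
  have hmemU : ∀ s ∈ U, s ∈ P' ↔ L.card ≤ rank U s := fun s hs => by
    obtain ⟨h1, h2⟩ := Finset.mem_filter.1 hs
    have h3 := rank_lt hs
    have e₁ : -c * (c * L.card - c * (rank U s + 1 : ℕ)) = (rank U s + 1 : ℕ) - (L.card : ℝ) := by
      linear_combination ((rank U s + 1 : ℕ) - (L.card : ℝ)) * hcc
    have e₂ : -c * (c * L.card - c * U.card) = U.card - (L.card : ℝ) := by
      linear_combination (U.card - (L.card : ℝ)) * hcc
    rw [hP' s h1, Remains, hNU s hs, htot, hR s h1 h2, e₁, e₂, le_sub_iff_add_le,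
      sub_le_sub_iff_right]
    norm_cast
    omega
  have hor : ∀ s ∈ P, s ∈ L ∨ s ∈ U := fun s hs => by
    rcases lt_or_ge s k with h | h
    · exact Or.inl (Finset.mem_filter.2 ⟨hs, h⟩)
    · exact Or.inr (Finset.mem_filter.2 ⟨hs, h⟩)
  rcases le_or_gt U.card L.card with hle | hlt
  · have hinL : ∀ s ∈ P', s ∈ L := fun s hs => by
      rcases hor s (hsub hs) with h | h
      · exact h
      · have h1 := (hmemU s h).1 hs
        have h2 := rank_lt h
        omega
    have hPeq : P' = L.filter (rank L · < L.card - U.card) := by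
      ext s
      rw [Finset.mem_filter]
      constructor
      · intro hs
        have := (hmemL s (hinL s hs)).1 hs
        exact ⟨hinL s hs, by omega⟩
      · rintro ⟨h1, h2⟩
        rw [hmemL s h1]
        omega
    have hinitial : ∀ s ∈ P', ∀ q ∈ P, q ≤ s → q ∈ P' := fun s hs q hq hqs => by
      have h1 := hinL s hs
      have h2 : q ∈ L := Finset.mem_filter.2 ⟨hq, hqs.trans_lt (Finset.mem_filter.1 h1).2⟩
      have h3 := (hmemL s h1).1 hs
      have h4 := rank_mono L hqs
      rw [hmemL q h2]
      omega
    refine ⟨?_, fun s hs => ?_, Or.inl fun s hs => ⟨(Finset.mem_filter.1 (hinL s hs)).2,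
      hinitial s hs⟩, fun he => ?_⟩
    · rw [sumL P' hinL, htot, hPeq, card_filter_rank_lt L (Nat.sub_le _ _), Nat.cast_sub hle]
      ring
    · congr 1
      ext q
      simp only [Finset.mem_filter]
      exact ⟨fun h => ⟨hsub h.1, h.2⟩, fun h => ⟨hinitial s hs q h.1 h.2, h.2⟩⟩
    · refine Finset.Subset.antisymm hsub fun s hs => ?_
      rcases hor s hs with h | h
      · rw [hmemL s h, he, Finset.card_empty]
        exact rank_lt h
      · rw [he] at h
        simp at h
  · have hinU : ∀ s ∈ P', s ∈ U := fun s hs => by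
      rcases hor s (hsub hs) with h | h
      · have h1 := (hmemL s h).1 hs
        omega
      · exact h
    have hPeq : P' = U.filter (L.card ≤ rank U ·) := by
      ext s
      rw [Finset.mem_filter]
      constructor
      · intro hs
        exact ⟨hinU s hs, (hmemU s (hinU s hs)).1 hs⟩
      · rintro ⟨h1, h2⟩
        exact (hmemU s h1).2 h2
    have hfinal : ∀ s ∈ P', ∀ q ∈ P, s ≤ q → q ∈ P' := fun s hs q hq hqs => by
      have h1 := hinU s hs
      have h2 : q ∈ U := Finset.mem_filter.2 ⟨hq, (Finset.mem_filter.1 h1).2.trans hqs⟩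
      have h3 := (hmemU s h1).1 hs
      have h4 := rank_mono U hqs
      rw [hmemU q h2]
      omega
    refine ⟨?_, fun s hs => ?_, Or.inr fun s hs => ⟨(Finset.mem_filter.1 (hinU s hs)).2,
      hfinal s hs⟩, fun he => ?_⟩
    · have h1 : (P'.card : ℝ) + L.card = U.card := by
        rw [hPeq]; exact_mod_cast card_filter_le_rank U hlt.le
      rw [sumU P' hinU, htot, ← h1]
      ring
    · have hsU := hinU s hs
      have hrs := (hmemU s hsU).1 hs
      have h1 : (U.filter (· ≤ s)).filter (rank U · < L.card) = U.filter (rank U · < L.card) := by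
        rw [Finset.filter_filter]
        refine Finset.filter_congr fun q _ => ⟨fun h => h.2, fun h => ⟨?_, h⟩⟩
        by_contra hcon
        have := rank_mono U (not_le.1 hcon).le
        omega
      have h2 : (U.filter (· ≤ s)).filter (¬ rank U · < L.card) = P'.filter (· ≤ s) := by
        ext q
        rw [hPeq]
        simp only [Finset.mem_filter, not_lt]
        tauto
      have h3 := (U.filter (· ≤ s)).card_filter_add_card_filter_not (rank U · < L.card)
      rw [h1, h2, card_filter_rank_lt U hlt.le, card_filter_le_eq_rank hsU] at h3
      rw [hNU s hsU, sumU _ ((Finset.filter_subset _ _).trans hinU), ← h3]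
      push_cast
      ring
    · rw [he] at hlt
      simp at hlt

/-- The sums which define the profile and the right states do not change when the waves cancelled
at `x₀` are balanced. -/
lemma sum_eq_of_balanced {A A' : Finset ℕ} {p S : ℕ → ℝ} {x₀ : ℝ} (hsub : A' ⊆ A)
    (hne : ∀ s ∈ A, p s ≠ x₀ → s ∈ A') (P : ℕ → Prop) [DecidablePred P]
    (hbal : ∑ q ∈ A'.filter (p · = x₀) with P q, S q = ∑ q ∈ A.filter (p · = x₀) with P q, S q) :
    ∑ q ∈ A' with P q, S q = ∑ q ∈ A with P q, S q := by
  rw [← Finset.sum_filter_add_sum_filter_not (A'.filter P) (p · = x₀),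
    ← Finset.sum_filter_add_sum_filter_not (A.filter P) (p · = x₀),
    Finset.filter_comm P (p · = x₀) A', hbal, Finset.filter_comm P (p · = x₀) A]
  congr 2
  ext q
  simp only [Finset.mem_filter]
  exact ⟨fun h => ⟨⟨hsub h.1.1, h.1.2⟩, h.2⟩, fun h => ⟨⟨hne q h.1.1 h.2, h.1.2⟩, h.2⟩⟩

/-- The profile after a collision, when the remaining waves at the collision point are balanced. -/
lemma sums_of_balanced {A A' : Finset ℕ} {p S : ℕ → ℝ} {x₀ : ℝ} (hsub : A' ⊆ A)
    (hp : ∀ s ∈ A, ∀ s' ∈ A, s ≤ s' → p s ≤ p s')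
    (hne : ∀ s ∈ A, p s ≠ x₀ → s ∈ A')
    (htot : ∑ q ∈ A' with p q = x₀, S q = ∑ q ∈ A with p q = x₀, S q)
    (hpart : ∀ s ∈ A'.filter (p · = x₀), ∑ q ∈ A'.filter (p · = x₀) with q ≤ s, S q =
      ∑ q ∈ A.filter (p · = x₀) with q ≤ s, S q) :
    (∀ x, ∑ q ∈ A' with p q ≤ x, S q = ∑ q ∈ A with p q ≤ x, S q) ∧
    ∀ s ∈ A', ∑ q ∈ A' with q ≤ s, S q = ∑ q ∈ A with q ≤ s, S q := by
  classical
  have hall : ∀ (P : ℕ → Prop) [DecidablePred P], (∀ q ∈ A, p q = x₀ → P q) →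
      ∑ q ∈ A'.filter (p · = x₀) with P q, S q = ∑ q ∈ A.filter (p · = x₀) with P q, S q := by
    intro P _ hP
    rw [Finset.filter_true_of_mem (s := A'.filter (p · = x₀)),
      Finset.filter_true_of_mem (s := A.filter (p · = x₀)), htot]
    · exact fun q hq => hP q (Finset.mem_filter.1 hq).1 (Finset.mem_filter.1 hq).2
    · exact fun q hq => hP q (hsub (Finset.mem_filter.1 hq).1) (Finset.mem_filter.1 hq).2
  have hnone : ∀ (P : ℕ → Prop) [DecidablePred P], (∀ q ∈ A, p q = x₀ → ¬ P q) →
      ∑ q ∈ A'.filter (p · = x₀) with P q, S q = ∑ q ∈ A.filter (p · = x₀) with P q, S q := by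
    intro P _ hP
    rw [Finset.filter_false_of_mem (s := A'.filter (p · = x₀)),
      Finset.filter_false_of_mem (s := A.filter (p · = x₀))]
    · exact fun q hq => hP q (Finset.mem_filter.1 hq).1 (Finset.mem_filter.1 hq).2
    · exact fun q hq => hP q (hsub (Finset.mem_filter.1 hq).1) (Finset.mem_filter.1 hq).2
  constructor
  · intro x
    refine sum_eq_of_balanced hsub hne _ ?_
    rcases le_or_gt x₀ x with h | h
    · exact hall _ fun q _ hq => by rw [hq]; exact h
    · exact hnone _ fun q _ hq => by rw [hq]; exact not_le.2 h
  · intro s hs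
    refine sum_eq_of_balanced hsub hne _ ?_
    rcases lt_trichotomy (p s) x₀ with h | h | h
    · refine hnone _ fun q hq hqx hqs => ?_
      have := hp q hq s (hsub hs) hqs
      linarith
    · exact hpart s (Finset.mem_filter.2 ⟨hs, h⟩)
    · refine hall _ fun q hq hqx => ?_
      by_contra hcon
      have := hp s (hsub hs) q hq (by omega)
      linarith

/-! ### Wavefronts -/

lemma IsBVGridDatum.leftLim_transport {ε : ℝ} {v : ℝ → ℝ} (hv : IsBVGridDatum ε v) (t x : ℝ) :
    Function.leftLim (transport v t) x = Function.leftLim v (x + t) := by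
  obtain ⟨l, hl, h⟩ := hv.exists_left (x + t)
  exact leftLim_eq_of_eqOn (l := l - t) (by linarith) fun y hy =>
    (h (y + t) ⟨by linarith [hy.1], by linarith [hy.2]⟩).1

lemma IsBVGridDatum.mem_fronts_first {ε : ℝ} {v : ℝ → ℝ} (hv : IsBVGridDatum ε v)
    (f : ℝ → ℝ → ℝ) (w : ℝ → ℝ) (t o c : ℝ) :
    (⟨.first, o, c⟩ : Front) ∈ fronts f ε w (transport v t) ↔
      (∃ q ∈ waves ε v, initPos ε v q = o + t) ∧ c = -1 := by
  change Function.leftLim (transport v t) o ≠ transport v t o ∧ c = -1 ↔ _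
  rw [hv.leftLim_transport, transport, hv.leftLim_ne_iff]

namespace WaveState

variable {f : ℝ → ℝ → ℝ} {ε : ℝ} {S R : ℕ → ℝ} {A : Finset ℕ} {X σ : ℕ → ℝ} {w v : ℝ → ℝ} {t : ℝ}

lemma fronts_cases (h : WaveState f ε S R A X σ w (transport v t)) (hv : IsBVGridDatum ε v)
    {a : Front} (ha : a ∈ fronts f ε w (transport v t)) :
    (∃ s ∈ A, a = ⟨.second, X s, σ s⟩) ∨
      ∃ q ∈ waves ε v, a = ⟨.first, initPos ε v q - t, -1⟩ := by
  rcases a with ⟨_ | _, o, c⟩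
  · rw [hv.mem_fronts_first] at ha
    obtain ⟨⟨q, hq, hqo⟩, rfl⟩ := ha
    exact Or.inr ⟨q, hq, by rw [hqo, add_sub_cancel_right]⟩
  · rw [h.mem_fronts_second] at ha
    obtain ⟨s, hs, rfl, rfl⟩ := ha
    exact Or.inl ⟨s, hs, rfl⟩

lemma mem_fronts (h : WaveState f ε S R A X σ w (transport v t)) {s : ℕ} (hs : s ∈ A) :
    (⟨.second, X s, σ s⟩ : Front) ∈ fronts f ε w (transport v t) :=
  (h.mem_fronts_second _ _).2 ⟨s, hs, rfl, rfl⟩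

lemma fronts_finite (h : WaveState f ε S R A X σ w (transport v t)) (hv : IsBVGridDatum ε v) :
    (fronts f ε w (transport v t)).Finite := by
  refine ((A.finite_toSet.image fun s => (⟨.second, X s, σ s⟩ : Front)).union
    ((waves ε v).finite_toSet.image fun q => (⟨.first, initPos ε v q - t, -1⟩ : Front))).subset
    fun a ha => ?_
  rcases h.fronts_cases hv ha with ⟨s, hs, rfl⟩ | ⟨q, hq, rfl⟩
  · exact Or.inl ⟨s, hs, rfl⟩
  · exact Or.inr ⟨q, hq, rfl⟩

/-- Two wavefronts which meet have different speeds. -/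
lemma speed_ne_of_meet (h : WaveState f ε S R A X σ w (transport v t)) (hv : IsBVGridDatum ε v)
    (hσ : ∀ s ∈ A, -1 < σ s) {τ : ℝ} {a b : Front} (hm : Meet f ε w (transport v t) τ a b) :
    a.speed ≠ b.speed := by
  obtain ⟨ha, hb, hab, hpos⟩ := hm
  intro hsp
  have ho : a.origin = b.origin := by
    rw [Front.pos, Front.pos, hsp] at hpos
    linarith
  apply hab
  rcases h.fronts_cases hv ha with ⟨s, hs, rfl⟩ | ⟨q, hq, rfl⟩ <;>
    rcases h.fronts_cases hv hb with ⟨s', hs', rfl⟩ | ⟨q', hq', rfl⟩ <;>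
    simp only at hsp ho
  · rw [hsp, ho]
  · have := hσ s hs; linarith
  · have := hσ s' hs'; linarith
  · rw [ho]

/-- Two fronts which meet have different speeds, so the pair determines the time, and there are
finitely many fronts. Hence the infimum defining `delay` is attained and positive. -/
lemma meetingTimes_finite (h : WaveState f ε S R A X σ w (transport v t))
    (hv : IsBVGridDatum ε v) (hσ : ∀ s ∈ A, -1 < σ s) :
    (meetingTimes f ε w (transport v t)).Finite := by
  refine (((h.fronts_finite hv).prod (h.fronts_finite hv)).image fun ab : Front × Front =>
    (ab.2.origin - ab.1.origin) / (ab.1.speed - ab.2.speed)).subset ?_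
  rintro τ ⟨-, a, b, hm⟩
  refine ⟨(a, b), ⟨hm.1, hm.2.1⟩, ?_⟩
  have h1 := sub_ne_zero.2 (h.speed_ne_of_meet hv hσ hm)
  have h2 := hm.2.2.2
  rw [Front.pos, Front.pos] at h2
  change (b.origin - a.origin) / (a.speed - b.speed) = τ
  rw [div_eq_iff h1]
  linarith

end WaveState

/-! ### A binary collision -/

/-- The waves travel up to the first collision, after the time `Δ`, and the collision is binary. -/
structure BinaryStep (f : ℝ → ℝ → ℝ) (ε : ℝ) (S R : ℕ → ℝ) (A : Finset ℕ) (X σ : ℕ → ℝ)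
    (w v : ℝ → ℝ) (t Δ : ℝ) : Prop extends WaveState f ε S R A X σ w (transport v t) where
  datum : IsBVGridDatum ε v
  speed_gt : ∀ s ∈ A, -1 < σ s
  Δ_pos : 0 < Δ
  not_meet : ∀ τ, 0 < τ → τ < Δ → ∀ a b, ¬ Meet f ε w (transport v t) τ a b
  meet : ∃ a b, Meet f ε w (transport v t) Δ a b
  binary : ∃ a b, ∀ c d, Meet f ε w (transport v t) Δ c d → (c = a ∧ d = b) ∨ (c = b ∧ d = a)

lemma WaveState.binaryStep {f : ℝ → ℝ → ℝ} {ε : ℝ} {S R : ℕ → ℝ} {A : Finset ℕ} {X σ : ℕ → ℝ}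
    {w v : ℝ → ℝ} {t : ℝ} (h : WaveState f ε S R A X σ w (transport v t))
    (hv : IsBVGridDatum ε v) (hσ : ∀ s ∈ A, -1 < σ s)
    (hne : (meetingTimes f ε w (transport v t)).Nonempty)
    (hbin : ∃ a b : Front, ∀ c d : Front, Meet f ε w (transport v t)
      (delay f ε w (transport v t)) c d → (c = a ∧ d = b) ∨ (c = b ∧ d = a)) :
    BinaryStep f ε S R A X σ w v t (delay f ε w (transport v t)) := by
  have hmem : delay f ε w (transport v t) ∈ meetingTimes f ε w (transport v t) :=
    hne.csInf_mem (h.meetingTimes_finite hv hσ)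
  refine ⟨h, hv, hσ, hmem.1, fun τ h0 hlt a b hm => ?_, hmem.2, hbin⟩
  have : delay f ε w (transport v t) ≤ τ :=
    csInf_le (h.meetingTimes_finite hv hσ).bddBelow ⟨h0, a, b, hm⟩
  linarith

namespace BinaryStep

variable {f : ℝ → ℝ → ℝ} {ε : ℝ} {S R : ℕ → ℝ} {A : Finset ℕ} {X σ : ℕ → ℝ} {w v : ℝ → ℝ} {t Δ : ℝ}

/-- In one fan the speeds are ordered by the envelope. From different positions, an inversion would
force the two fronts to meet strictly before the first collision. -/
lemma arrival_mono (h : BinaryStep f ε S R A X σ w v t Δ) {s s' : ℕ} (hs : s ∈ A) (hs' : s' ∈ A)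
    (hle : s ≤ s') : X s + σ s * Δ ≤ X s' + σ s' * Δ := by
  rcases (h.mono s hs s' hs' hle).eq_or_lt with hX | hX
  · have := (h.isEnvelope (X s')).mono s (by simp [hs, hX]) s' (by simp [hs']) hle
    rw [hX]
    nlinarith [h.Δ_pos]
  · by_contra hcon
    push Not at hcon
    have hΔ := h.Δ_pos
    have hσ : 0 < σ s - σ s' := by nlinarith
    refine h.not_meet ((X s' - X s) / (σ s - σ s')) (div_pos (by linarith) hσ)
      (by rw [div_lt_iff₀ hσ]; nlinarith) ⟨.second, X s, σ s⟩ ⟨.second, X s', σ s'⟩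
      ⟨h.mem_fronts hs, h.mem_fronts hs', fun heq => ?_, ?_⟩
    · have : X s = X s' := by injection heq
      linarith
    · simp only [Front.pos]
      field_simp
      ring

/-- A wave does not cross the jumps of `v`. -/
lemma arrival_le_initPos (h : BinaryStep f ε S R A X σ w v t Δ) {s q : ℕ} (hs : s ∈ A)
    (hq : q ∈ waves ε v) (hlt : X s + t < initPos ε v q) :
    X s + σ s * Δ + (t + Δ) ≤ initPos ε v q := by
  by_contra hcon
  push Not at hcon
  have hσ : 0 < σ s + 1 := by linarith [h.speed_gt s hs]
  refine h.not_meet ((initPos ε v q - (X s + t)) / (σ s + 1)) (div_pos (by linarith) hσ)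
    (by rw [div_lt_iff₀ hσ]; linarith) ⟨.second, X s, σ s⟩ ⟨.first, initPos ε v q - t, -1⟩
    ⟨h.mem_fronts hs, (h.datum.mem_fronts_first _ _ _ _ _).2 ⟨⟨q, hq, by ring⟩, rfl⟩,
      fun heq => ?_, ?_⟩
  · have : Family.second = Family.first := by injection heq
    cases this
  · simp only [Front.pos]
    field_simp
    ring

lemma arrival_gt (h : BinaryStep f ε S R A X σ w v t Δ) {s : ℕ} (hs : s ∈ A) :
    X s + t ≤ X s + σ s * Δ + (t + Δ) := by
  nlinarith [h.speed_gt s hs, h.Δ_pos]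

/-- `varFun v` counts jumps of `v`, and a wave cannot pass one before the first collision. If no
jump is met on arrival, none is gained. -/
lemma varFun_eq (h : BinaryStep f ε S R A X σ w v t Δ) {s : ℕ} (hs : s ∈ A)
    (hq : ∀ q ∈ waves ε v, initPos ε v q ≠ X s + σ s * Δ + (t + Δ)) :
    varFun v (X s + t) = varFun v (X s + σ s * Δ + (t + Δ)) := by
  rw [h.datum.varFun_eq_card, h.datum.varFun_eq_card (X s + σ s * Δ + (t + Δ))]
  congr 3
  refine Finset.filter_congr fun q hqm => ⟨fun h1 => h1.trans (h.arrival_gt hs), fun h1 => ?_⟩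
  by_contra hcon
  exact hq q hqm (le_antisymm h1 (h.arrival_le_initPos hs hqm (not_le.1 hcon)))

/-- The possible configurations of the waves which arrive at the collision point. -/
lemma exists_collision (h : BinaryStep f ε S R A X σ w v t Δ) : ∃ x₀,
    {p | ∃ a b, Meet f ε w (transport v t) Δ a b ∧ p = a.pos Δ} = {x₀} ∧
    (∀ s ∈ A, ∀ s' ∈ A, X s + σ s * Δ = X s' + σ s' * Δ → X s + σ s * Δ ≠ x₀ →
      X s = X s' ∧ σ s = σ s') ∧
    ((∀ s ∈ A, ∀ s' ∈ A, X s + σ s * Δ = x₀ → X s' + σ s' * Δ = x₀ → X s = X s' ∧ σ s = σ s') ∨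
      ((∀ s ∈ A, X s + σ s * Δ = x₀ →
          varFun v (X s + t) = varFun v (X s + σ s * Δ + (t + Δ))) ∧
        ∃ sL ∈ A, ∃ sR ∈ A, X sL + σ sL * Δ = x₀ ∧ X sR + σ sR * Δ = x₀ ∧ X sL < X sR ∧
          ∀ s ∈ A, X s + σ s * Δ = x₀ → (X s = X sL ∧ σ s = σ sL) ∨ (X s = X sR ∧ σ s = σ sR))) := by
  obtain ⟨a, b, hab⟩ := h.meet
  obtain ⟨a', b', hbin⟩ := h.binary
  have hΔ := h.Δ_pos
  have huniq : ∀ c d, Meet f ε w (transport v t) Δ c d → (c = a ∧ d = b) ∨ (c = b ∧ d = a) := by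
    intro c d hcd
    rcases hbin a b hab with ⟨rfl, rfl⟩ | ⟨rfl, rfl⟩ <;>
      rcases hbin c d hcd with ⟨rfl, rfl⟩ | ⟨rfl, rfl⟩ <;> simp
  have hat : ∀ c ∈ fronts f ε w (transport v t), c.pos Δ = a.pos Δ → c = a ∨ c = b := by
    intro c hc hpos
    by_cases hca : c = a
    · exact Or.inl hca
    · rcases huniq c a ⟨hc, hab.1, hca, hpos⟩ with h1 | h1
      · exact Or.inl h1.1
      · exact Or.inr h1.1
  have hfront : ∀ s s', (⟨.second, X s, σ s⟩ : Front) = ⟨.second, X s', σ s'⟩ →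
      X s = X s' ∧ σ s = σ s' := fun s s' heq => by
    injection heq with _ h2 h3
    exact ⟨h2, h3⟩
  refine ⟨a.pos Δ, ?_, ?_, ?_⟩
  · ext p
    simp only [mem_ofPred_eq, mem_singleton_iff]
    constructor
    · rintro ⟨c, d, hcd, rfl⟩
      rcases huniq c d hcd with ⟨rfl, rfl⟩ | ⟨rfl, rfl⟩
      · rfl
      · exact hab.2.2.2.symm
    · rintro rfl
      exact ⟨a, b, hab, rfl⟩
  · intro s hs s' hs' hp hne
    by_contra hcon
    have hm : Meet f ε w (transport v t) Δ ⟨.second, X s, σ s⟩ ⟨.second, X s', σ s'⟩ :=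
      ⟨h.mem_fronts hs, h.mem_fronts hs', fun heq => hcon (hfront s s' heq), hp⟩
    rcases huniq _ _ hm with h1 | h1
    · exact hne (by rw [← h1.1]; rfl)
    · exact hne (by rw [hab.2.2.2, ← h1.1]; rfl)
  · rcases h.fronts_cases h.datum hab.1 with ⟨sa, hsa, rfl⟩ | ⟨qa, hqa, rfl⟩
    · rcases h.fronts_cases h.datum hab.2.1 with ⟨sb, hsb, rfl⟩ | ⟨qb, hqb, rfl⟩
      · right
        have hat' : ∀ s ∈ A, X s + σ s * Δ = X sa + σ sa * Δ →
            (X s = X sa ∧ σ s = σ sa) ∨ (X s = X sb ∧ σ s = σ sb) := fun s hs hp => by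
          rcases hat _ (h.mem_fronts hs) hp with h1 | h1
          · exact Or.inl (hfront _ _ h1)
          · exact Or.inr (hfront _ _ h1)
        have hpos : X sa + σ sa * Δ = X sb + σ sb * Δ := hab.2.2.2
        -- Two fronts of `w` already meet here, so a jump of `v` at the same point would be a third
        -- front.
        refine ⟨fun s hs hp => h.varFun_eq hs fun q hq hcon => ?_, ?_⟩
        · have hpq : (⟨.first, initPos ε v q - t, -1⟩ : Front).pos Δ =
              (⟨.second, X sa, σ sa⟩ : Front).pos Δ := by
            simp only [Front.pos] at hp ⊢
            linarith
          rcases hat _ ((h.datum.mem_fronts_first _ _ _ _ _).2 ⟨⟨q, hq, by ring⟩, rfl⟩) hpq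
            with h1 | h1
          · injection h1 with h2
            cases h2
          · injection h1 with h2
            cases h2
        · have hXne : X sa ≠ X sb := fun heq => by
            apply hab.2.2.1
            have : σ sa = σ sb := by
              rw [heq] at hpos
              exact mul_right_cancel₀ hΔ.ne' (by linarith)
            rw [heq, this]
          rcases lt_or_gt_of_ne hXne with hlt | hlt
          · exact ⟨sa, hsa, sb, hsb, rfl, hpos.symm, hlt, hat'⟩
          · exact ⟨sb, hsb, sa, hsa, hpos.symm, rfl, hlt, fun s hs hp => (hat' s hs hp).symm⟩
      -- The other front is a jump of `v`, so all waves arriving at the point belong to a single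
      -- front.
      · left
        have hall : ∀ s ∈ A, X s + σ s * Δ = X sa + σ sa * Δ → X s = X sa ∧ σ s = σ sa := by
          intro s hs hp
          rcases hat _ (h.mem_fronts hs) hp with h1 | h1
          · exact hfront _ _ h1
          · injection h1 with h2
            cases h2
        intro s hs s' hs' hp hp'
        rw [(hall s hs hp).1, (hall s' hs' hp').1, (hall s hs hp).2, (hall s' hs' hp').2]
        exact ⟨rfl, rfl⟩
    · rcases h.fronts_cases h.datum hab.2.1 with ⟨sb, hsb, rfl⟩ | ⟨qb, hqb, rfl⟩
      · left
        have hall : ∀ s ∈ A, X s + σ s * Δ = (⟨.first, initPos ε v qa - t, -1⟩ : Front).pos Δ →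
            X s = X sb ∧ σ s = σ sb := by
          intro s hs hp
          rcases hat _ (h.mem_fronts hs) hp with h1 | h1
          · injection h1 with h2
            cases h2
          · exact hfront _ _ h1
        intro s hs s' hs' hp hp'
        rw [(hall s hs hp).1, (hall s' hs' hp').1, (hall s hs hp).2, (hall s' hs' hp').2]
        exact ⟨rfl, rfl⟩
      · exact (h.speed_ne_of_meet h.datum h.speed_gt hab rfl).elim

/-- The waves which lie in a jump after the collision. -/
lemma survives_iff_remains (h : BinaryStep f ε S R A X σ w v t Δ) {s : ℕ} (hs : s ∈ A) {x : ℝ}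
    (hx : X s + σ s * Δ = x) :
    (S s * Function.leftLim (propagate f ε w (transport v t) Δ) x ≤ S s * R s - ε ∧
      S s * R s ≤ S s * propagate f ε w (transport v t) Δ x) ↔
      Remains (A.filter fun q => X q + σ q * Δ = x) S s := by
  have hw : propagate f ε w (transport v t) Δ =
      fun y => 0 + ε * ∑ s ∈ A with X s + σ s * Δ ≤ y, S s := by
    funext y; rw [h.propagate_eq h.Δ_pos, zero_add]
  have hR : R s = ε * ∑ q ∈ A with X q + σ q * Δ < x, S q +
      ε * ∑ q ∈ A.filter (fun q => X q + σ q * Δ = x) with q ≤ s, S q := by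
    rw [h.state s hs, sum_filter_le_eq_of_mono (p := fun q => X q + σ q * Δ)
      (fun q hq q' hq' => h.arrival_mono hq hq') S hs, mul_add]
    simp only [hx]
  rw [hw, leftLim_step A (fun q => X q + σ q * Δ)]
  beta_reduce
  rw [sum_filter_le_eq_lt_add_eq A (fun q => X q + σ q * Δ), hR, Remains]
  set Z := ∑ q ∈ A with X q + σ q * Δ < x, S q
  set N := ∑ q ∈ A.filter (fun q => X q + σ q * Δ = x) with q ≤ s, S q
  set M := ∑ q ∈ A with X q + σ q * Δ = x, S q
  have hε := h.pos
  -- The waves on the left of `x` contribute the same amount to all terms; after subtracting it and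
  -- dividing by ε only the sums over the arriving group are left.
  refine and_congr ?_ ?_
  · rw [← mul_le_mul_iff_right₀ hε (b := 1)]
    constructor <;> intro h1 <;> nlinarith
  · rw [← mul_le_mul_iff_right₀ hε (b := S s * N)]
    constructor <;> intro h1 <;> nlinarith

end BinaryStep

namespace BinaryStep

variable {f : ℝ → ℝ → ℝ} {ε : ℝ} {S R : ℕ → ℝ} {A A' : Finset ℕ} {X X' σ : ℕ → ℝ} {w v : ℝ → ℝ}
  {t Δ : ℝ}

/-- `A'` is the set of the waves which are not cancelled in the collision, `X'` are the positions
at the time of the collision. -/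
structure IsOutcome (f : ℝ → ℝ → ℝ) (ε : ℝ) (S R : ℕ → ℝ) (A A' : Finset ℕ) (X X' σ : ℕ → ℝ)
    (w v : ℝ → ℝ) (t Δ : ℝ) : Prop where
  mem_iff : ∀ s, s ∈ A' ↔ s ∈ A ∧
    ¬ (X s + σ s * Δ ∈ {p | ∃ a b, Meet f ε w (transport v t) Δ a b ∧ p = a.pos Δ} ∧
      ¬ (S s * Function.leftLim (propagate f ε w (transport v t) Δ) (X s + σ s * Δ)
          ≤ S s * R s - ε ∧
        S s * R s ≤ S s * propagate f ε w (transport v t) Δ (X s + σ s * Δ)))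
  pos_eq : ∀ s ∈ A', X' s = X s + σ s * Δ

/-- The state after a binary collision, and the type of the collision. -/
lemma outcome (h : BinaryStep f ε S R A X σ w v t Δ)
    (ho : IsOutcome f ε S R A A' X X' σ w v t Δ) :
    ((∀ x, propagate f ε w (transport v t) Δ x = ε * ∑ s ∈ A' with X' s ≤ x, S s) ∧
      (∀ s ∈ A', R s = ε * ∑ q ∈ A' with q ≤ s, S q) ∧
      (∀ s ∈ A', ∀ s' ∈ A', X' s = X' s' → S s = S s')) ∧
    ∃ x₀, (∀ x ≠ x₀, SingleAt A A' X σ (fun s => X s + σ s * Δ) x) ∧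
      (SingleAt A A' X σ (fun s => X s + σ s * Δ) x₀ ∨
        MergeAt A A' X σ (fun s => X s + σ s * Δ) (fun s => varFun v (X s + t))
          (fun s => varFun v (X s + σ s * Δ + (t + Δ))) x₀ ∨
        CancelAt A A' X σ (fun s => X s + σ s * Δ) (fun s => varFun v (X s + t))
          (fun s => varFun v (X s + σ s * Δ + (t + Δ))) x₀) := by
  classical
  obtain ⟨x₀, hset, hother, hcases⟩ := h.exists_collision
  set p : ℕ → ℝ := fun s => X s + σ s * Δ with hp
  have hpm : ∀ s ∈ A, ∀ s' ∈ A, s ≤ s' → p s ≤ p s' := fun s hs s' hs' => h.arrival_mono hs hs'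
  have hsub : A' ⊆ A := fun s hs => ((ho.mem_iff s).1 hs).1
  have hne : ∀ s ∈ A, p s ≠ x₀ → s ∈ A' := fun s hs hps => by
    rw [ho.mem_iff, hset]
    exact ⟨hs, fun hcon => hps hcon.1⟩
  set P := A.filter (p · = x₀) with hP
  set P' := A'.filter (p · = x₀) with hP'
  have hPP : P' ⊆ P := Finset.filter_subset_filter _ hsub
  have hrem : ∀ s ∈ P, s ∈ P' ↔ Remains P S s := fun s hs => by
    obtain ⟨hsA, hsx⟩ := Finset.mem_filter.1 hs
    have h1 := h.survives_iff_remains hsA (x := x₀) hsx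
    rw [Finset.mem_filter, ho.mem_iff, hset]
    change X s + σ s * Δ = x₀ at hsx
    rw [hsx, h1]
    simp only [mem_singleton_iff, true_and, not_not, hsA]
    exact ⟨fun h2 => h2.1, fun h2 => ⟨h2, hsx⟩⟩
  -- if the incoming waves have the same sign, none is cancelled
  have hconst : (∀ s ∈ P, ∀ s' ∈ P, S s = S s') → P' = P := by
    intro hS
    rcases P.eq_empty_or_nonempty with he | ⟨s₀, hs₀⟩
    · rw [he] at hPP
      rw [he, Finset.subset_empty.1 hPP]
    · have hlt : ∀ q ∈ P, q < P.sup id + 1 := fun q hq =>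
        Nat.lt_succ_of_le (Finset.le_sup (f := id) hq)
      -- With the cut placed beyond all labels the second group is empty, so nothing is cancelled.
      refine (remains_spec (k := P.sup id + 1) (h.sign s₀ (Finset.mem_filter.1 hs₀).1)
        (fun q hq _ => hS q hq s₀ hs₀) (fun q hq hk => absurd (hlt q hq) (not_lt.2 hk)) hPP
        hrem).2.2.2 ?_
      exact Finset.filter_eq_empty_iff.2 fun q hq => not_le.2 (hlt q hq)
  have hfinish : (∑ q ∈ P', S q = ∑ q ∈ P, S q) →
      (∀ s ∈ P', ∑ q ∈ P' with q ≤ s, S q = ∑ q ∈ P with q ≤ s, S q) →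
      (∀ s ∈ P', ∀ s' ∈ P', S s = S s') →
      ((∀ x, propagate f ε w (transport v t) Δ x = ε * ∑ s ∈ A' with X' s ≤ x, S s) ∧
      (∀ s ∈ A', R s = ε * ∑ q ∈ A' with q ≤ s, S q) ∧
      (∀ s ∈ A', ∀ s' ∈ A', X' s = X' s' → S s = S s')) := by
    intro htot hpart hsame
    obtain ⟨h1, h2⟩ := sums_of_balanced hsub hpm hne htot hpart
    refine ⟨fun x => ?_, fun s hs => ?_, fun s hs s' hs' hXX => ?_⟩
    · rw [h.propagate_eq h.Δ_pos]
      have h3 : A'.filter (X' · ≤ x) = A'.filter (p · ≤ x) :=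
        Finset.filter_congr fun q hq => by rw [ho.pos_eq q hq]
      rw [h3, h1]
    · rw [h2 s hs, h.state s (hsub hs)]
    · rw [ho.pos_eq s hs, ho.pos_eq s' hs'] at hXX
      by_cases hx : X s + σ s * Δ = x₀
      · exact hsame s (Finset.mem_filter.2 ⟨hs, hx⟩) s'
          (Finset.mem_filter.2 ⟨hs', hXX.symm.trans hx⟩)
      · exact h.same_sign s (hsub hs) s' (hsub hs') (hother s (hsub hs) s' (hsub hs') hXX hx).1
  have hsingle : ∀ x ≠ x₀, SingleAt A A' X σ p x := fun x hx =>
    ⟨fun s hs hps => hne s hs (by rw [hps]; exact hx), fun s hs s' hs' hps hps' =>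
      hother s hs s' hs' (hps.trans hps'.symm) (by change p s ≠ x₀; rw [hps]; exact hx)⟩
  rcases hcases with hone | ⟨hV, sL, hsL, sR, hsR, hpL, hpR, hlt, htwo⟩
  · have hS : ∀ s ∈ P, ∀ s' ∈ P, S s = S s' := fun s hs s' hs' => by
      rw [hP, Finset.mem_filter] at hs hs'
      exact h.same_sign s hs.1 s' hs'.1 (hone s hs.1 s' hs'.1 hs.2 hs'.2).1
    have heq := hconst hS
    refine ⟨hfinish (by rw [heq]) (fun s _ => by rw [heq])
      (fun s hs s' hs' => hS s (hPP hs) s' (hPP hs')), x₀, hsingle, Or.inl ⟨fun s hs hps => ?_,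
      fun s hs s' hs' hps hps' => hone s hs s' hs' hps hps'⟩⟩
    have : s ∈ P' := by rw [heq]; exact Finset.mem_filter.2 ⟨hs, hps⟩
    exact (Finset.mem_filter.1 this).1
  by_cases hLR : S sL = S sR
  · have hSL : ∀ s ∈ P, S s = S sL := fun s hs => by
      rw [hP, Finset.mem_filter] at hs
      rcases htwo s hs.1 hs.2 with h1 | h1
      · exact h.same_sign s hs.1 sL hsL h1.1
      · rw [hLR]; exact h.same_sign s hs.1 sR hsR h1.1
    have hS : ∀ s ∈ P, ∀ s' ∈ P, S s = S s' := fun s hs s' hs' => by rw [hSL s hs, hSL s' hs']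
    have heq := hconst hS
    refine ⟨hfinish (by rw [heq]) (fun s _ => by rw [heq])
      (fun s hs s' hs' => hS s (hPP hs) s' (hPP hs')), x₀, hsingle, Or.inr (Or.inl ⟨fun s hs hps =>
      ?_, hV, sL, hsL, sR, hsR, hpL, hpR, hlt, htwo⟩)⟩
    have : s ∈ P' := by rw [heq]; exact Finset.mem_filter.2 ⟨hs, hps⟩
    exact (Finset.mem_filter.1 this).1
  · have hopp : S sR = - S sL := by
      rcases h.sign sL hsL with h1 | h1 <;> rcases h.sign sR hsR with h2 | h2 <;>
        rw [h1, h2] at hLR ⊢ <;> first | exact absurd rfl hLR | norm_num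
    -- The left front precedes the right one in the labels, so a single cut `k` separates the two
    -- signs, as `remains_spec` requires.
    obtain ⟨k, hk⟩ := IsEnvelope.exists_lt_iff P (fun q => X q = X sL) fun q hq q' hq' hle hX => by
      rw [hP, Finset.mem_filter] at hq hq'
      have h1 := h.mono q hq.1 q' hq'.1 hle
      rcases htwo q hq.1 hq.2 with h2 | h2
      · exact h2.1
      · rw [h2.1, hX] at h1
        exact absurd hlt (not_lt.2 h1)
    have hkR : ∀ q ∈ P, k ≤ q → X q = X sR ∧ σ q = σ sR := fun q hq hkq => by
      have h1 : ¬ X q = X sL := fun hcon => absurd ((hk q hq).1 hcon) (not_lt.2 hkq)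
      rw [hP, Finset.mem_filter] at hq
      rcases htwo q hq.1 hq.2 with h2 | h2
      · exact absurd h2.1 h1
      · exact h2
    have hkL : ∀ q ∈ P, q < k → X q = X sL ∧ σ q = σ sL := fun q hq hkq => by
      have h1 := (hk q hq).2 hkq
      rw [hP, Finset.mem_filter] at hq
      rcases htwo q hq.1 hq.2 with h2 | h2
      · exact h2
      · rw [h1] at h2
        exact absurd h2.1 hlt.ne
    have hSL : ∀ q ∈ P, q < k → S q = S sL := fun q hq hkq =>
      h.same_sign q (Finset.mem_filter.1 hq).1 sL hsL (hkL q hq hkq).1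
    have hSR : ∀ q ∈ P, k ≤ q → S q = - S sL := fun q hq hkq => by
      rw [← hopp]
      exact h.same_sign q (Finset.mem_filter.1 hq).1 sR hsR (hkR q hq hkq).1
    obtain ⟨htot, hpart, hseg, -⟩ := remains_spec (h.sign sL hsL) hSL hSR hPP hrem
    have hmemP : ∀ s ∈ A', p s = x₀ → s ∈ P' := fun s hs hps => Finset.mem_filter.2 ⟨hs, hps⟩
    refine ⟨hfinish htot hpart ?_, x₀, hsingle, Or.inr (Or.inr ⟨fun s hs hps =>
      hV s (hsub hs) hps, ?_⟩)⟩
    · intro s hs s' hs'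
      rcases hseg with hseg | hseg
      · rw [hSL s (hPP hs) (hseg s hs).1, hSL s' (hPP hs') (hseg s' hs').1]
      · rw [hSR s (hPP hs) (hseg s hs).1, hSR s' (hPP hs') (hseg s' hs').1]
    · rcases hseg with hseg | hseg
      · refine ⟨sL, hsL, fun s hs hps => hkL s (hPP (hmemP s hs hps)) (hseg s (hmemP s hs hps)).1,
          Or.inl fun s hs s' hs' hXs hσs hps' hle => ?_⟩
        have hsP : s ∈ P := Finset.mem_filter.2 ⟨hs, by
          change X s + σ s * Δ = x₀; rw [hXs, hσs]; exact hpL⟩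
        exact (Finset.mem_filter.1 ((hseg s' (hmemP s' hs' hps')).2 s hsP hle)).1
      · refine ⟨sR, hsR, fun s hs hps => hkR s (hPP (hmemP s hs hps)) (hseg s (hmemP s hs hps)).1,
          Or.inr fun s hs s' hs' hXs hσs hps' hle => ?_⟩
        have hsP : s ∈ P := Finset.mem_filter.2 ⟨hs, by
          change X s + σ s * Δ = x₀; rw [hXs, hσs]; exact hpR⟩
        exact (Finset.mem_filter.1 ((hseg s' (hmemP s' hs' hps')).2 s hsP hle)).1

end BinaryStep

/-! ### The waves of the wavefront solution -/

variable {f : ℝ → ℝ → ℝ} {ε : ℝ} {w v : ℝ → ℝ}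

/-- The position of a wave which has not been cancelled. -/
def wavePos (f : ℝ → ℝ → ℝ) (ε : ℝ) (w v : ℝ → ℝ) (j s : ℕ) : ℝ :=
  (position f ε w v j s).untopD 0

lemma position_eq {j s : ℕ} (h : position f ε w v j s ≠ ⊤) :
    position f ε w v j s = (wavePos f ε w v j s : ℝ) := by
  obtain ⟨x, hx⟩ := WithTop.ne_top_iff_exists.1 h
  rw [wavePos, ← hx]
  rfl

open Classical in
lemma position_succ {j s : ℕ} {x : ℝ} (h : position f ε w v j s = (x : ℝ)) :
    position f ε w v (j + 1) s =
      if x + speedAt f ε w v j s x * delay f ε (wj f ε w v j) (vj f ε w v j) ∈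
          collisionPoints f ε w v j ∧
        ¬ Survives f ε w v (j + 1) s
          (x + speedAt f ε w v j s x * delay f ε (wj f ε w v j) (vj f ε w v j)) then ⊤
      else ((x + speedAt f ε w v j s x * delay f ε (wj f ε w v j) (vj f ε w v j) : ℝ) :
        WithTop ℝ) := by
  rw [position, h]

lemma position_succ_of_top {j s : ℕ} (h : position f ε w v j s = ⊤) :
    position f ε w v (j + 1) s = ⊤ := by
  rw [position, h]

lemma mem_realWaves {j s : ℕ} :
    s ∈ realWaves f ε w v j ↔ s ∈ waves ε w ∧ position f ε w v j s ≠ ⊤ := by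
  classical
  rw [realWaves, Finset.mem_filter]

lemma realWaves_zero : realWaves f ε w v 0 = waves ε w := by
  ext s
  rw [mem_realWaves, position]
  exact ⟨fun h => h.1, fun h => ⟨h, WithTop.coe_ne_top⟩⟩

lemma isOutcome_succ (j : ℕ) : BinaryStep.IsOutcome f ε (waveSign ε w) (rightState ε w)
    (realWaves f ε w v j) (realWaves f ε w v (j + 1)) (wavePos f ε w v j)
    (wavePos f ε w v (j + 1)) (sigma f ε w v j) (wj f ε w v j) v (tj f ε w v j)
    (delay f ε (wj f ε w v j) (transport v (tj f ε w v j))) := by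
  refine ⟨fun s => ?_, fun s hs => ?_⟩
  · rw [mem_realWaves, mem_realWaves, and_assoc]
    refine and_congr_right fun _ => ?_
    by_cases hpos : position f ε w v j s = ⊤
    · simp [position_succ_of_top hpos, hpos]
    · rw [position_succ (position_eq hpos)]
      simp only [hpos, ne_eq, not_false_eq_true, true_and, ite_eq_left_iff, WithTop.coe_ne_top,
        imp_false, not_not]
      rfl
  · obtain ⟨-, h1⟩ := mem_realWaves.1 hs
    have hpos : position f ε w v j s ≠ ⊤ := fun hcon => h1 (position_succ_of_top hcon)
    have h2 := position_succ (position_eq hpos)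
    split_ifs at h2 with hif
    · exact absurd h2 h1
    · rw [wavePos, h2]
      rfl

lemma waveState_zero (hw : IsBVGridDatum ε w) : WaveState f ε (waveSign ε w) (rightState ε w)
    (realWaves f ε w v 0) (wavePos f ε w v 0) (sigma f ε w v 0) (wj f ε w v 0)
    (transport v (tj f ε w v 0)) := by
  refine ⟨hw.pos, fun s hs => hw.waveSign_eq ?_, fun x => ?_, fun s hs s' hs' => ?_,
    fun s hs => ?_, fun s _ s' _ h => IsBVGridDatum.waveSign_congr h, fun s hs => rfl⟩
  · rwa [realWaves_zero] at hs
  · rw [realWaves_zero]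
    exact hw.eq_sum x
  · rw [realWaves_zero] at hs hs'
    exact hw.initPos_mono hs hs'
  · rw [realWaves_zero] at hs ⊢
    exact hw.rightState_eq hs

/-- The mean value theorem turns the slope into a value of f_w at a state between two values of the
datum, where strict hyperbolicity is assumed. -/
lemma neg_one_lt_cellSlope (hf : ContDiff ℝ 3 (Function.uncurry f)) (hw : IsBVGridDatum ε w)
    (hhyp : ∀ a b c ω : ℝ, w a ≤ ω → ω ≤ w b → -1 < dW f ω (v c)) {s : ℕ} (hs : s ∈ waves ε w)
    (y : ℝ) :
    -1 < cellSlope ε (fun z => f z (v y)) (cellLeft ε (waveSign ε w s) (rightState ε w s)) := by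
  obtain ⟨a, b, ha, hb⟩ := hw.exists_cell_bounds hs
  obtain ⟨ω, hω, h⟩ := exists_cellSlope_eq hf hw.pos (v y)
    (cellLeft ε (waveSign ε w s) (rightState ε w s))
  rw [h]
  exact hhyp a b y ω (ha.trans hω.1.le) (hω.2.le.trans hb)

/-- The hypotheses on the data of the wavefront solution. -/
structure IsAdmissible (f : ℝ → ℝ → ℝ) (ε : ℝ) (w v : ℝ → ℝ) (J : ℕ) : Prop where
  smooth : ContDiff ℝ 3 (Function.uncurry f)
  bdd_ww : IsBdd (dWW f)
  bdd_wv : IsBdd (dWV f)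
  bdd_wwv : IsBdd (dWWV f)
  datum_w : IsBVGridDatum ε w
  datum_v : IsBVGridDatum ε v
  hyperbolic : ∀ a b c ω : ℝ, w a ≤ ω → ω ≤ w b → -1 < dW f ω (v c)
  binary : ∀ j < J, BinaryCollision f ε w v j

/-! ### The wavefront solution as a wave history. -/

namespace IsAdmissible

variable {J : ℕ}

lemma binaryStep_of_waveState (h : IsAdmissible f ε w v J) {j : ℕ} (hj : j < J)
    (hst : WaveState f ε (waveSign ε w) (rightState ε w) (realWaves f ε w v j) (wavePos f ε w v j)
      (sigma f ε w v j) (wj f ε w v j) (transport v (tj f ε w v j))) :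
    BinaryStep f ε (waveSign ε w) (rightState ε w) (realWaves f ε w v j) (wavePos f ε w v j)
      (sigma f ε w v j) (wj f ε w v j) v (tj f ε w v j)
      (delay f ε (wj f ε w v j) (transport v (tj f ε w v j))) :=
  hst.binaryStep h.datum_v
    (fun _ hs => hst.lt_speed (fun _ hq _ => neg_one_lt_cellSlope h.smooth h.datum_w h.hyperbolic
      (mem_realWaves.1 hq).1 _) hs) (h.binary j hj).1 (h.binary j hj).2

/-- The invariant which links the solution to the waves. Cancelled waves balance each other at the
collision point, so `outcome` preserves both the profile formula and the right states. -/
lemma waveState (h : IsAdmissible f ε w v J) {j : ℕ} (hj : j ≤ J) :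
    WaveState f ε (waveSign ε w) (rightState ε w) (realWaves f ε w v j) (wavePos f ε w v j)
      (sigma f ε w v j) (wj f ε w v j) (transport v (tj f ε w v j)) := by
  induction j with
  | zero => exact waveState_zero h.datum_w
  | succ j ih =>
    have hb := h.binaryStep_of_waveState hj (ih (by omega))
    have ho := isOutcome_succ (f := f) (ε := ε) (w := w) (v := v) j
    obtain ⟨⟨h1, h2, h3⟩, -⟩ := hb.outcome ho
    have hsub : ∀ s ∈ realWaves f ε w v (j + 1), s ∈ realWaves f ε w v j :=
      fun s hs => ((ho.mem_iff s).1 hs).1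
    refine ⟨hb.pos, fun s hs => hb.sign s (hsub s hs), h1, fun s hs s' hs' hle => ?_, h2, h3,
      fun s _ => rfl⟩
    rw [ho.pos_eq s hs, ho.pos_eq s' hs']
    exact hb.arrival_mono (hsub s hs) (hsub s' hs') hle

lemma binaryStep (h : IsAdmissible f ε w v J) {j : ℕ} (hj : j < J) :
    BinaryStep f ε (waveSign ε w) (rightState ε w) (realWaves f ε w v j) (wavePos f ε w v j)
      (sigma f ε w v j) (wj f ε w v j) v (tj f ε w v j)
      (delay f ε (wj f ε w v j) (transport v (tj f ε w v j))) :=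
  h.binaryStep_of_waveState hj (h.waveState hj.le)

lemma abs_cellLeft_sub {S S' : ℝ} (hS : S = S') (r r' : ℝ) :
    |cellLeft ε S r - cellLeft ε S' r'| = |r - r'| := by
  rw [hS, cellLeft, cellLeft]
  split_ifs
  · rw [sub_sub_sub_cancel_right]
  · rfl

/-- The history of the waves of the wavefront solution. -/
def history (h : IsAdmissible f ε w v J) : WaveHistory where
  J := J
  ε := ε
  D₂ := supNorm (dWW f)
  D₃ := supNorm (dWWV f)
  Dv := supNorm (dWV f)
  T := totVar v
  S := waveSign ε w
  R := rightState ε w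
  Λ := fun u s => cellSlope ε (fun z => f z u) (cellLeft ε (waveSign ε w s) (rightState ε w s))
  v := v
  V := varFun v
  A := realWaves f ε w v
  X := wavePos f ε w v
  σ := sigma f ε w v
  t := tj f ε w v
  Δ := fun j => delay f ε (wj f ε w v j) (transport v (tj f ε w v j))
  ε_pos := h.datum_w.pos
  D₂_nonneg := supNorm_nonneg _
  D₃_nonneg := supNorm_nonneg _
  Dv_nonneg := supNorm_nonneg _
  V_nonneg := varFun_nonneg
  V_le := varFun_le_totVar h.datum_v.bv
  abs_v_sub_le := fun _ _ hy => abs_sub_le_varFun h.datum_v.bv hy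
  sign := (h.waveState (Nat.zero_le J)).sign
  slope_lip := fun u s s' hS => by
    rw [← abs_cellLeft_sub (ε := ε) hS (rightState ε w s)]
    exact abs_cellSlope_flux_sub_le h.smooth h.bdd_ww h.datum_w.pos u _ _
  slope_mixed := fun u u' s s' hS => by
    rw [← abs_cellLeft_sub (ε := ε) hS (rightState ε w s)]
    exact abs_cellSlope_mixed_le h.smooth h.bdd_wwv h.datum_w.pos u u' _ _
  slope_param := fun u u' s => abs_cellSlope_param_sub_le h.smooth h.bdd_wv h.datum_w.pos u u' _
  X_mono := fun _ hj => (h.waveState hj).mono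
  state := fun _ hj => (h.waveState hj).state
  same_sign := fun _ hj => (h.waveState hj).same_sign
  env := fun _ hj x => (h.waveState hj).isEnvelope x
  A_succ_subset := fun j _ s hs => (((isOutcome_succ j).mem_iff s).1 hs).1
  Δ_pos := fun _ hj => (h.binaryStep hj).Δ_pos
  X_succ := fun j _ => (isOutcome_succ j).pos_eq
  arrival_mono := fun _ hj _ hs _ hs' => (h.binaryStep hj).arrival_mono hs hs'
  y_mono := fun j hj s hs => by
    rw [(isOutcome_succ j).pos_eq s hs]
    exact (h.binaryStep hj).arrival_gt (((isOutcome_succ j).mem_iff s).1 hs).1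
  collision := fun j hj => ((h.binaryStep hj).outcome (isOutcome_succ j)).2

lemma interaction_estimate (h : IsAdmissible f ε w v J) :
    ∑ j ∈ Finset.range J, ∑ s ∈ realWaves f ε w v (j + 1),
        |sigma f ε w v (j + 1) s - sigma f ε w v j s| * ε
      ≤ (3 * supNorm (dWW f) + 2 * (supNorm (dWWV f) * totVar v)) * totVar w ^ 2
          + supNorm (dWV f) * totVar w * totVar v := by
  have key := h.history.interaction_estimate
  have hcard : h.history.ε * ((h.history.A 0).card : ℝ) = totVar w := by
    change ε * ((realWaves f ε w v 0).card : ℝ) = totVar w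
    rw [realWaves_zero, h.datum_w.card_waves]
  rw [hcard] at key
  exact key

end IsAdmissible

end TriangularSystem

end

theorem mainTheorem1
    (f : ℝ → ℝ → ℝ) (hf : ContDiff ℝ 3 (Function.uncurry f))
    (hww : TriangularSystem.IsBdd (TriangularSystem.dWW f))
    (hwv : TriangularSystem.IsBdd (TriangularSystem.dWV f))
    (hwwv : TriangularSystem.IsBdd (TriangularSystem.dWWV f))
    -- the initial data, of bounded variation, and their discretizations with grid size `ε`
    (w₀ v₀ : ℝ → ℝ) (hw₀ : BoundedVariationOn w₀ Set.univ) (hv₀ : BoundedVariationOn v₀ Set.univ)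
    (ε : ℝ) (hε : 0 < ε) (wε vε : ℝ → ℝ)
    (hwε : TriangularSystem.IsGridDatum ε wε) (hvε : TriangularSystem.IsGridDatum ε vε)
    (hTVw : eVariationOn wε Set.univ ≤ eVariationOn w₀ Set.univ)
    (hTVv : eVariationOn vε Set.univ ≤ eVariationOn v₀ Set.univ)
    -- strict hyperbolicity on the range of the data
    (hhyp : ∀ a b c ω : ℝ, wε a ≤ ω → ω ≤ wε b → -1 < TriangularSystem.dW f ω (vε c))
    -- the first `J` collisions are binary and occur at different times
    (J : ℕ) (hJ : ∀ j < J, TriangularSystem.BinaryCollision f ε wε vε j) :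
    ∑ j ∈ Finset.range J, ∑ s ∈ TriangularSystem.realWaves f ε wε vε (j + 1),
        |TriangularSystem.sigma f ε wε vε (j + 1) s - TriangularSystem.sigma f ε wε vε j s| * ε
      ≤ (3 * TriangularSystem.supNorm (TriangularSystem.dWW f)
            + 12 * Real.log 2 * TriangularSystem.supNorm (TriangularSystem.dWWV f)
              * TriangularSystem.totVar v₀) * TriangularSystem.totVar w₀ ^ 2
          + TriangularSystem.supNorm (TriangularSystem.dWV f)
              * TriangularSystem.totVar w₀ * TriangularSystem.totVar v₀ := by
  have hadm : TriangularSystem.IsAdmissible f ε wε vε J :=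
    ⟨hf, hww, hwv, hwwv, ⟨hwε, hε, ne_top_of_le_ne_top hw₀ hTVw⟩,
      ⟨hvε, hε, ne_top_of_le_ne_top hv₀ hTVv⟩, hhyp, hJ⟩
  refine hadm.interaction_estimate.trans ?_
  have hw : TriangularSystem.totVar wε ≤ TriangularSystem.totVar w₀ := ENNReal.toReal_mono hw₀ hTVw
  have hv : TriangularSystem.totVar vε ≤ TriangularSystem.totVar v₀ := ENNReal.toReal_mono hv₀ hTVv
  have hw0 : 0 ≤ TriangularSystem.totVar wε := ENNReal.toReal_nonneg
  have hv0 : 0 ≤ TriangularSystem.totVar vε := ENNReal.toReal_nonneg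
  have h2 := TriangularSystem.supNorm_nonneg (TriangularSystem.dWW f)
  have h3 := TriangularSystem.supNorm_nonneg (TriangularSystem.dWWV f)
  have h4 := TriangularSystem.supNorm_nonneg (TriangularSystem.dWV f)
  -- The argument gives the constant 2, and 12 log 2 exceeds 8.
  have hlog : 2 ≤ 12 * Real.log 2 := by
    have := Real.log_two_gt_d9
    linarith
  have h5 := mul_nonneg h3 hv0
  have hcoef : 2 * (TriangularSystem.supNorm (TriangularSystem.dWWV f) *
      TriangularSystem.totVar vε) ≤ 12 * Real.log 2 *
        TriangularSystem.supNorm (TriangularSystem.dWWV f) * TriangularSystem.totVar v₀ := by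
    rw [mul_assoc (12 * Real.log 2)]
    gcongr
  have hw0' := hw0.trans hw
  gcongr
  linarith
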